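/- Let $k\ge 1$ and $d\ge 1$ be integers, and let $H$ be the random operator on $\ell^2(\mathbb Z^d)\otimes\mathbb C^k$ $$(H\psi)(x)=(v(x)A+B)\psi(x)+g^{-1}\sum_{y:\ \|y-x\|_1=1}K(x-y)\psi(y),\qquad g>0,$$ where $A,B$ are Hermitian $k\times k$ matrices, $A$ is invertible, $\|A\|,\|A^{-1}\|\le C_{B1}$, $\|B\|\le C_{B2}$; $K(-e)=K(e)^*$ and $\|K(e)\|\le C_{B3}$ for every $e \in \mathbb Z^d$ with $\|e\|_1=1$; and $(v(x))_{x\in\mathbb Z^d}$ are independent real random variables on a probability space, with a common distribution $\mu$ such that, for some $\alpha,q>0$, $\mu[t-\epsilon,t+\epsilon]\le C_{A1}\epsilon^\alpha$ for all $\epsilon>0$, $t\in\mathbb R$, and $\int|x|^q\,d\mu(x)\le C_{A2}$. The density of states is the (unique) finite measure $\rho$ on $\mathbb R$ with $\int f\,d\rho=\frac1k\,\mathrm{tr}\,\langle f(H)(n,n)\rangle$ for all $f\in C_0(\mathbb R)$ and all $n\in\mathbb Z^d$, where $f(H)(n,n)$ is the diagonal $k\times k$ block of $f(H)$ at $n$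 and $\langle\cdot\rangle$ is the expectation; the integrated density of states is $N(\lambda)=\rho(-\infty,\lambda]$. (1) Put $s=\frac{\alpha q}{2k\alpha+kq}$. There is $C>0$, depending only on $k,\alpha,q,C_{A1},C_{A2},C_{B1},C_{B2},C_{B3}$ (in particular not on $d$, $g$, $\lambda$), such that whenever $\lambda\in\mathbb R$ and $g\ge C d^{1/s}/(1+|\lambda|)$, $$\rho[\lambda-\epsilon,\lambda+\epsilon]\le C(1+|\lambda|)^{-s}\epsilon^s\quad\text{for all }\epsilon>0,$$ and $N$ is $s$-Hölder at $\lambda$, uniformly in $g$: $|N(\lambda')-N(\lambda)|\le C(1+|\lambda|)^{-s}|\lambda'-\lambda|^s$ for all $\lambda'\in\mathbb R$. (2) In particular, let $\mu$ have a bounded density and finite moments of all orders, and let $\delta>0$. Then there is $C>0$, depending only on $k,\delta,\mu,C_{B1},C_{B2},C_{B3}$, such that whenever $g\ge Cd^{k+\delta}/(1+|\lambda|)$ one has $|N(\lambda')-N(\lambda)|\le C(1+|\lambda|)^{-1/(k+\delta)}|\lambda'-\lambda|^{1/(k+\delta)}$ for all $\lambda'\in\mathbb R$; and if $g\ge Cd^{k+\delta}$,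 then $N$ is $1/(k+\delta)$-Hölder on $\mathbb R$: $|N(\lambda')-N(\lambda)|\le C|\lambda'-\lambda|^{1/(k+\delta)}$ for all $\lambda,\lambda'\in\mathbb R$. -/

import Mathlib

open MeasureTheory ProbabilityTheory
open scoped ENNReal NNReal ZeroAtInfty Matrix.Norms.L2Operator

noncomputable section

/-! ### Functional calculus of an unbounded self-adjoint operator -/

/-- `R` is the bounded two-sided inverse of `T - z : dom T → E`, that is `R = (T - z)⁻¹`. -/
def IsResolventAt {E : Type*} [NormedAddCommGroup E] [NormedSpace ℂ E]
    (T : E →ₗ.[ℂ] E) (z : ℂ) (R : E →L[ℂ] E) : Prop :=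
  (∀ ψ : E, ∃ h : R ψ ∈ T.domain, T ⟨R ψ, h⟩ - z • R ψ = ψ) ∧
    ∀ φ : T.domain, R (T φ - z • (φ : E)) = φ

/-- There is at most one resolvent at `z`. -/
theorem IsResolventAt.unique {E : Type*} [NormedAddCommGroup E] [NormedSpace ℂ E]
    {T : E →ₗ.[ℂ] E} {z : ℂ} {R R' : E →L[ℂ] E}
    (h : IsResolventAt T z R) (h' : IsResolventAt T z R') : R = R' := by
  ext ψ
  obtain ⟨hm, he⟩ := h'.1 ψ
  have := h.2 ⟨R' ψ, hm⟩
  simp only [he] at this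
  exact this

open Classical in
/-- The resolvent `(T - z)⁻¹`; it exists for every self-adjoint `T` and every nonreal `z`
(and is set to `0` where it does not exist). -/
def resolventAt {E : Type*} [NormedAddCommGroup E] [NormedSpace ℂ E]
    (T : E →ₗ.[ℂ] E) (z : ℂ) : E →L[ℂ] E :=
  if h : ∃ R, IsResolventAt T z R then h.choose else 0

open Classical in
/-- `f(T)` for a self-adjoint operator `T` and `f ∈ C₀(ℝ)`. With `w(t) = (t + i)⁻¹`, a bijection
of `ℝ` onto a circle without the point `0`, one has `f(T) = F((T + i)⁻¹)`, where `F(w(t)) = f(t)`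
and `F(0) = 0`, and `F` is applied to the bounded normal operator `(T + i)⁻¹` through the
continuous functional calculus. Note that `t = Re (w(t)⁻¹)`. -/
def funCalc {E : Type*} [NormedAddCommGroup E] [InnerProductSpace ℂ E] [CompleteSpace E]
    (T : E →ₗ.[ℂ] E) (f : C₀(ℝ, ℝ)) : E →L[ℂ] E :=
  cfc (fun w : ℂ => if w = 0 then (0 : ℂ) else ((f (w⁻¹).re : ℝ) : ℂ))
    (resolventAt T (-Complex.I))

/-! ### The Hamiltonian on `ℓ²(ℤ^d) ⊗ ℂ^k` -/

/-- The vertices of the lattice `ℤ^d`. -/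
abbrev Site (d : ℕ) : Type := Fin d → ℤ

/-- The `i`-th unit vector of `ℤ^d`; the neighbours of `x` are the `2d` points `x ± e_i`. -/
abbrev unitVec {d : ℕ} (i : Fin d) : Site d := Pi.single i 1

/-- The space of internal degrees of freedom of a single site. -/
abbrev Spin (k : ℕ) : Type := EuclideanSpace ℂ (Fin k)

/-- The Hilbert space `ℓ²(ℤ^d) ⊗ ℂ^k` of square-summable functions `ℤ^d → ℂ^k`. -/
abbrev Wave (d k : ℕ) : Type := lp (fun _ : Site d => Spin k) 2

/-- The non-random data of the translation-invariant model: `V(x) = v(x) A + B`, and the hopping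
kernel `K(x, y) = K(x - y)` for adjacent `x`, `y` (the other values of `K` are never used). -/
structure ModelData (d k : ℕ) where
  A : Matrix (Fin k) (Fin k) ℂ
  B : Matrix (Fin k) (Fin k) ℂ
  K : Site d → Matrix (Fin k) (Fin k) ℂ

/-- The standing assumptions on the non-random data, with operator norms of matrices. -/
structure ModelData.Admissible {d k : ℕ} (M : ModelData d k) (CB1 CB2 CB3 : ℝ) : Prop where
  hermitian_A : M.A.IsHermitian
  hermitian_B : M.B.IsHermitian
  isUnit_A : IsUnit M.A
  norm_A : ‖M.A‖ ≤ CB1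
  norm_inv_A : ‖M.A⁻¹‖ ≤ CB1
  norm_B : ‖M.B‖ ≤ CB2
  hermitian_K : ∀ i : Fin d, M.K (-unitVec i) = (M.K (unitVec i)).conjTranspose
  norm_K : ∀ i : Fin d, ‖M.K (unitVec i)‖ ≤ CB3 ∧ ‖M.K (-unitVec i)‖ ≤ CB3

/-- The formal action
`(Hψ)(x) = (v(x) A + B) ψ(x) + g⁻¹ ∑_{y ∼ x} K(x - y) ψ(y)`
on all functions `ψ : ℤ^d → ℂ^k`, for a given configuration `v : ℤ^d → ℝ`. -/
def ModelData.formal {d k : ℕ} (M : ModelData d k) (g : ℝ) (v : Site d → ℝ) :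
    (Site d → Spin k) →ₗ[ℂ] (Site d → Spin k) where
  toFun ψ x :=
    Matrix.toEuclideanLin ((v x : ℂ) • M.A + M.B) (ψ x) +
      ((g⁻¹ : ℝ) : ℂ) • ∑ i : Fin d,
        (Matrix.toEuclideanLin (M.K (unitVec i)) (ψ (x - unitVec i)) +
          Matrix.toEuclideanLin (M.K (-unitVec i)) (ψ (x + unitVec i)))
  map_add' ψ φ := by
    funext x
    simp only [Pi.add_apply, map_add, Finset.sum_add_distrib, smul_add]
    abel
  map_smul' c ψ := by
    funext x
    simp only [Pi.smul_apply, map_smul, RingHom.id_apply, smul_add, ← Finset.smul_sum,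
      Finset.sum_add_distrib]
    simp only [smul_comm c]

/-- The Hamiltonian `H` as an unbounded operator on `ℓ²(ℤ^d) ⊗ ℂ^k`, with its natural (maximal)
domain `{ψ : Hψ ∈ ℓ²}`, on which it is self-adjoint. -/
def ModelData.hamiltonian {d k : ℕ} (M : ModelData d k) (g : ℝ) (v : Site d → ℝ) :
    Wave d k →ₗ.[ℂ] Wave d k where
  domain :=
    { carrier := {ψ | Memℓp (M.formal g v (fun x => ψ x)) 2}
      zero_mem' := by
        change Memℓp (M.formal g v 0) 2
        rw [map_zero]
        exact zero_memℓp
      add_mem' := by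
        intro ψ φ hψ hφ
        change Memℓp (M.formal g v ((fun x => ψ x) + fun x => φ x)) 2
        rw [map_add]
        exact Memℓp.add hψ hφ
      smul_mem' := by
        intro c ψ hψ
        change Memℓp (M.formal g v (c • fun x => ψ x)) 2
        rw [map_smul]
        exact Memℓp.const_smul hψ c }
  toFun :=
    { toFun := fun ψ => ⟨M.formal g v (fun x => ψ.1 x), ψ.2⟩
      map_add' := by
        intro ψ φ
        apply Subtype.ext
        change M.formal g v ((fun x => ψ.1 x) + fun x => φ.1 x) = _
        rw [map_add]
        rfl
      map_smul' := by
        intro c ψ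
        apply Subtype.ext
        change M.formal g v (c • fun x => ψ.1 x) = _
        rw [map_smul]
        rfl }

/-- The matrix kernel `T(m, n)` of a bounded operator `T` on `ℓ²(ℤ^d) ⊗ ℂ^k`. -/
def kernel {d k : ℕ} (T : Wave d k →L[ℂ] Wave d k) (m n : Site d) :
    Matrix (Fin k) (Fin k) ℂ :=
  Matrix.of fun i j => T (lp.single 2 n (EuclideanSpace.single j (1 : ℂ))) m i

/-! ### Random potential and density of states -/

/-- `μ` is `α`-regular with constant `C`. -/
def IsRegularWith (α C : ℝ) (μ : Measure ℝ) : Prop :=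
  ∀ ε : ℝ, 0 < ε → ∀ t : ℝ, μ.real (Set.Icc (t - ε) (t + ε)) ≤ C * ε ^ α

/-- `μ` has a finite `q`-moment, bounded by `C`. -/
def HasMomentBound (q C : ℝ) (μ : Measure ℝ) : Prop :=
  Integrable (fun x : ℝ => |x| ^ q) μ ∧ ∫ x, |x| ^ q ∂μ ≤ C

/-- `(v x)_{x ∈ ℤ^d}` are independent random variables, all with the distribution `μ`. -/
structure IsIID {Ω : Type*} [MeasurableSpace Ω] {d : ℕ} (v : Site d → Ω → ℝ) (P : Measure Ω)
    (μ : Measure ℝ) : Prop where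
  measurable : ∀ x, Measurable (v x)
  indep : iIndepFun v P
  law : ∀ x, P.map (v x) = μ

/-- `ρ` is the density of states of the random operator `H`: the finite measure with
`∫ f dρ = k⁻¹ tr ⟨f(H)(n, n)⟩` for all `f ∈ C₀(ℝ)` and at every vertex `n`. -/
structure IsDensityOfStates {Ω : Type*} [MeasurableSpace Ω] {d k : ℕ}
    (H : Ω → Wave d k →ₗ.[ℂ] Wave d k) (P : Measure Ω) (ρ : Measure ℝ) : Prop where
  finite : IsFiniteMeasure ρ
  integrable : ∀ (f : C₀(ℝ, ℝ)) (n : Site d) (i j : Fin k),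
    Integrable (fun ω => kernel (funCalc (H ω) f) n n i j) P
  integral_eq : ∀ (f : C₀(ℝ, ℝ)) (n : Site d),
    ((∫ t, f t ∂ρ : ℝ) : ℂ) =
      (k : ℂ)⁻¹ * Matrix.trace (Matrix.of fun i j => ∫ ω, kernel (funCalc (H ω) f) n n i j ∂P)

/-- The integrated density of states `λ ↦ ρ(-∞, λ]`. -/
def ids (ρ : Measure ℝ) (lam : ℝ) : ℝ := ρ.real (Set.Iic lam)

/-- The exponent `s = αq / (2kα + kq)`. -/
def wegnerExponent (α q : ℝ) (k : ℕ) : ℝ := α * q / (2 * k * α + k * q)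

end

noncomputable section

open scoped InnerProductSpace ComplexConjugate
open Filter Topology

/-! ### Resolvents of symmetric operators -/

section Resolvent

variable {E : Type*} [NormedAddCommGroup E] [InnerProductSpace ℂ E]

/-! The proof is a fractional moment argument. The indicator of [λ - ε, λ + ε] is at most 2ε times
the Poisson kernel at z = λ + iε, and the Poisson kernel of `H` is |Im z| G(z) G(z̄) with G(z) = (H
- z)⁻¹ (`calculus_poisson`). By the resolvent identity its diagonal entries are controlled by those
of G(z) and G(z̄). Since |Im z| ‖G(z)‖ ≤ 1 and s ≤ 1, the quantity |Im z| |G| is at most its own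
s-th power (`re_kernel_poisson_le`). So everything reduces to a bound on E‖(G(z)ψ)(x)‖^s by a
multiple of (1 + |z|)^(-s), uniform in Im z ≠ 0 (`exists_green_moment`).

For this bound put u = G(z)ψ, so that (v(x)A + B - z)u(x) = ψ(x) - g⁻¹ ∑ K(x - y)u(y). If E‖u(x)‖^s
is at most K(1 + |z|)^(-s) times the s-th moment of the left side (`exists_site_decoupling`), then
summing over the 2d neighbours and taking the supremum over x gives an inequality of the supremum
with itself. For large g its coefficient on the right is at most 1/2, and it can be absorbed because
the supremum is finite a priori, Im z being nonzero.

The decoupling holds because, with the other sites frozen, u(x) is a rational function P/Q of degree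
at most k in t = v(x) (`exists_rational_solution`). Its size is that of the ratio of the root
heights of P and Q. Off large t and neighbourhoods of finitely many points, a set of probability at
least 1/2, |P/Q| is bounded below by a multiple of this ratio; over the whole law the s-th moment is
bounded above by a multiple of its s-th power (`exists_decoupling`). The upper bound fixes the
exponent: k factors 1 + |x| cost k/q, each of at most k poles costs 1/q + 1/α, and s(2k/q + k/α) =
1. The good set may also avoid the eigenvalues of A⁻¹(z - B), and there the inverse of tA + B - z is
O((1 + |z|)⁻¹) (`exists_site_lower_bound`).

The density of states exists because f(H) is strongly continuous in the configuration, hence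
measurable, and covariant under shifts; its averaged trace is then a positive bounded functional on
C₀(ℝ), to which Riesz representation applies (`existsUnique_measure_integral_eq`). -/

theorem resolventAt_eq {T : E →ₗ.[ℂ] E} {z : ℂ} {R : E →L[ℂ] E} (h : IsResolventAt T z R) :
    resolventAt T z = R := by
  have hex : ∃ R, IsResolventAt T z R := ⟨R, h⟩
  rw [resolventAt, dif_pos hex]
  exact hex.choose_spec.unique h

theorem IsResolventAt.identity {T : E →ₗ.[ℂ] E} {z w : ℂ} {R S : E →L[ℂ] E}
    (hR : IsResolventAt T z R) (hS : IsResolventAt T w S) : R - S = (z - w) • (R * S) := by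
  ext ψ
  obtain ⟨hm, he⟩ := hS.1 ψ
  have h := hR.2 ⟨S ψ, hm⟩
  have : T ⟨S ψ, hm⟩ = ψ + w • S ψ := eq_add_of_sub_eq he
  rw [this] at h
  simp only [map_add, map_sub, map_smul] at h
  simp only [sub_apply, smul_apply, mul_apply_eq_comp]
  linear_combination (norm := module) h

theorem IsResolventAt.mul_comm {T : E →ₗ.[ℂ] E} {z w : ℂ} {R S : E →L[ℂ] E}
    (hR : IsResolventAt T z R) (hS : IsResolventAt T w S) : R * S = S * R := by
  by_cases hzw : z = w
  · subst hzw
    rw [hR.unique hS]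
  · have h1 := hR.identity hS
    have h2 := hS.identity hR
    have h3 : (z - w) • (R * S - S * R) = 0 := by
      linear_combination (norm := module) -h1 - h2
    exact sub_eq_zero.1 ((smul_eq_zero.1 h3).resolve_left (sub_ne_zero.2 hzw))

/-- A symmetric operator shifted by a nonreal number is bounded below. -/
theorem LinearPMap.IsFormalAdjoint.norm_le {T : E →ₗ.[ℂ] E} (hT : T.IsFormalAdjoint T) (z : ℂ)
    (φ : T.domain) : |z.im| * ‖(φ : E)‖ ≤ ‖T φ - z • (φ : E)‖ := by
  have hreal : (⟪T φ, (φ : E)⟫_ℂ).im = 0 := by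
    have h := hT φ φ
    have h2 := inner_conj_symm (𝕜 := ℂ) (T φ) (φ : E)
    rw [← h] at h2
    exact Complex.conj_eq_iff_im.1 h2
  have h1 : (⟪(φ : E), T φ - z • (φ : E)⟫_ℂ).im = - z.im * ‖(φ : E)‖ ^ 2 := by
    rw [inner_sub_right, inner_smul_right, inner_self_eq_norm_sq_to_K, ← hT φ φ, Complex.sub_im,
      hreal]
    simp [← Complex.ofReal_pow]
  have h2 : |z.im| * ‖(φ : E)‖ ^ 2 ≤ ‖(φ : E)‖ * ‖T φ - z • (φ : E)‖ := by
    calc |z.im| * ‖(φ : E)‖ ^ 2 = |(⟪(φ : E), T φ - z • (φ : E)⟫_ℂ).im| := by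
          rw [h1, abs_mul, abs_neg, abs_of_nonneg (sq_nonneg ‖(φ : E)‖)]
      _ ≤ ‖⟪(φ : E), T φ - z • (φ : E)⟫_ℂ‖ := Complex.abs_im_le_norm _
      _ ≤ _ := norm_inner_le_norm _ _
  rcases (norm_nonneg (φ : E)).eq_or_lt with h0 | h0
  · rw [← h0]; simp
  · exact le_of_mul_le_mul_left (by linarith) h0

theorem IsResolventAt.norm_le {T : E →ₗ.[ℂ] E} (hT : T.IsFormalAdjoint T) {z : ℂ} (hz : z.im ≠ 0)
    {R : E →L[ℂ] E} (hR : IsResolventAt T z R) : ‖R‖ ≤ |z.im|⁻¹ := by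
  refine R.opNorm_le_bound (by positivity) fun ψ => ?_
  obtain ⟨hm, he⟩ := hR.1 ψ
  have h := hT.norm_le z ⟨R ψ, hm⟩
  rw [he] at h
  rw [inv_mul_eq_div, le_div_iff₀ (abs_pos.2 hz), _root_.mul_comm]
  exact h

theorem IsResolventAt.adjoint_eq [CompleteSpace E] {T : E →ₗ.[ℂ] E} (hT : T.IsFormalAdjoint T)
    {z : ℂ} {R S : E →L[ℂ] E} (hR : IsResolventAt T z R) (hS : IsResolventAt T (conj z) S) :
    ContinuousLinearMap.adjoint R = S := by
  symm
  rw [ContinuousLinearMap.eq_adjoint_iff]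
  intro φ ψ
  obtain ⟨hm, he⟩ := hR.1 ψ
  obtain ⟨hm', he'⟩ := hS.1 φ
  have h := hT ⟨S φ, hm'⟩ ⟨R ψ, hm⟩
  nth_rewrite 1 [← he]
  nth_rewrite 2 [← he']
  rw [inner_sub_left, inner_sub_right, inner_smul_left, inner_smul_right, h]
  simp

/-- A closed symmetric operator such that `T - z` has dense range has a resolvent at `z`. -/
theorem exists_isResolventAt [CompleteSpace E] {T : E →ₗ.[ℂ] E} (hT : T.IsFormalAdjoint T)
    (hclosed : ∀ (f : ℕ → T.domain) (ψ χ : E), Tendsto (fun n => (f n : E)) atTop (𝓝 ψ) →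
      Tendsto (fun n => T (f n)) atTop (𝓝 χ) → ∃ h : ψ ∈ T.domain, T ⟨ψ, h⟩ = χ)
    {z : ℂ} (hz : z.im ≠ 0)
    (hdense : ∀ χ : E, (∀ φ : T.domain, ⟪T φ - z • (φ : E), χ⟫_ℂ = 0) → χ = 0) :
    ∃ R, IsResolventAt T z R := by
  let S : T.domain →ₗ[ℂ] E := T.toFun - z • T.domain.subtype
  have hSapp : ∀ φ, S φ = T φ - z • (φ : E) := fun φ => rfl
  have hbelow : ∀ φ : T.domain, |z.im| * ‖(φ : E)‖ ≤ ‖S φ‖ := fun φ => hT.norm_le z φ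
  have hzpos : 0 < |z.im| := abs_pos.2 hz
  have hinj : Function.Injective S := by
    rw [injective_iff_map_eq_zero]
    intro φ hφ
    have := hbelow φ
    rw [hφ, norm_zero] at this
    have h0 : ‖(φ : E)‖ = 0 := by nlinarith [norm_nonneg (φ : E)]
    exact Subtype.ext (norm_eq_zero.1 h0)
  -- The lower bound turns a convergent sequence of images into a Cauchy sequence of preimages;
  -- closedness of `T` then identifies the limit.
  have hrange_closed : IsClosed (LinearMap.range S : Set E) := by
    refine IsSeqClosed.isClosed fun u χ hu hχ => ?_
    choose f hf using hu
    have hcau : CauchySeq fun n => (f n : E) := by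
      rw [Metric.cauchySeq_iff']
      intro ε hε
      obtain ⟨N, hN⟩ := Metric.cauchySeq_iff'.1 hχ.cauchySeq (|z.im| * ε) (by positivity)
      refine ⟨N, fun n hn => ?_⟩
      have h1 := hbelow (f n - f N)
      have h2 := hN n hn
      rw [map_sub, hf, hf, ← dist_eq_norm] at h1
      rw [dist_eq_norm]
      have := h1.trans_lt h2
      exact lt_of_mul_lt_mul_left this hzpos.le
    obtain ⟨ψ, hψ⟩ := cauchySeq_tendsto_of_complete hcau
    have hT2 : Tendsto (fun n => T (f n)) atTop (𝓝 (χ + z • ψ)) := by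
      have : (fun n => T (f n)) = fun n => u n + z • (f n : E) := by
        funext n
        rw [← hf n, hSapp]
        simp
      rw [this]
      exact hχ.add (hψ.const_smul z)
    obtain ⟨h, h'⟩ := hclosed f ψ _ hψ hT2
    exact ⟨⟨ψ, h⟩, by rw [hSapp, h']; simp⟩
  have htop : LinearMap.range S = ⊤ := by
    have hcomp : CompleteSpace (LinearMap.range S) := hrange_closed.completeSpace_coe
    rw [← Submodule.orthogonal_eq_bot_iff, Submodule.eq_bot_iff]
    intro χ hχ
    exact hdense χ fun φ => (Submodule.mem_orthogonal _ _).1 hχ _ ⟨φ, rfl⟩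
  let e : T.domain ≃ₗ[ℂ] E := LinearEquiv.ofBijective S ⟨hinj, LinearMap.range_eq_top.1 htop⟩
  have he : ∀ φ, e φ = S φ := fun φ => rfl
  let R : E →L[ℂ] E := (T.domain.subtype.comp e.symm.toLinearMap).mkContinuous |z.im|⁻¹ (by
    intro ψ
    have h := hbelow (e.symm ψ)
    rw [← he, e.apply_symm_apply] at h
    rw [inv_mul_eq_div, le_div_iff₀ hzpos, _root_.mul_comm]
    exact h)
  have hR : ∀ ψ, R ψ = (e.symm ψ : E) := fun ψ => rfl
  refine ⟨R, fun ψ => ⟨by rw [hR]; exact (e.symm ψ).2, ?_⟩, fun φ => ?_⟩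
  · have := e.apply_symm_apply ψ
    rw [he, hSapp] at this
    exact this
  · rw [hR, ← hSapp, ← he, e.symm_apply_apply]

end Resolvent

/-! ### Shifts, block multiplications and the hopping operator -/

section Operators

variable {d k : ℕ}

theorem Memℓp.comp_equiv {ι : Type*} {F : Type*} [NormedAddCommGroup F] {f : ι → F}
    (hf : Memℓp f 2) (e : ι ≃ ι) : Memℓp (fun i => f (e i)) 2 := by
  have h2 : 0 < (2 : ℝ≥0∞).toReal := by simp
  rw [memℓp_gen_iff h2] at hf ⊢
  exact (e.summable_iff (f := fun i => ‖f i‖ ^ (2 : ℝ≥0∞).toReal)).2 hf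

/-- The unitary shift `(S_a ψ)(x) = ψ(x + a)`. -/
def shift (a : Site d) : Wave d k ≃ₗᵢ[ℂ] Wave d k where
  toFun ψ := ⟨fun x => ψ (x + a), (lp.memℓp ψ).comp_equiv (Equiv.addRight a)⟩
  invFun ψ := ⟨fun x => ψ (x - a), (lp.memℓp ψ).comp_equiv (Equiv.subRight a)⟩
  map_add' _ _ := rfl
  map_smul' _ _ := rfl
  left_inv ψ := by
    refine lp.ext (funext fun x => ?_)
    change ψ (x - a + a) = ψ x
    rw [sub_add_cancel]
  right_inv ψ := by
    refine lp.ext (funext fun x => ?_)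
    change ψ (x + a - a) = ψ x
    rw [add_sub_cancel_right]
  norm_map' ψ := by
    have h2 : 0 < (2 : ℝ≥0∞).toReal := by simp
    rw [lp.norm_eq_tsum_rpow h2, lp.norm_eq_tsum_rpow h2]
    congr 1
    exact (Equiv.addRight a).tsum_eq fun x => ‖ψ x‖ ^ (2 : ℝ≥0∞).toReal

@[simp]
theorem shift_apply (a : Site d) (ψ : Wave d k) (x : Site d) : shift a ψ x = ψ (x + a) := rfl

@[simp]
theorem shift_symm_apply (a : Site d) (ψ : Wave d k) (x : Site d) :
    (shift a).symm ψ x = ψ (x - a) := rfl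

theorem shift_inner (a : Site d) (ψ φ : Wave d k) :
    ⟪shift a ψ, φ⟫_ℂ = ⟪ψ, shift (-a) φ⟫_ℂ := by
  rw [← LinearIsometryEquiv.inner_map_map (shift a) ψ]
  congr 1
  refine lp.ext (funext fun x => ?_)
  simp

theorem norm_toEuclideanLin_le (K : Matrix (Fin k) (Fin k) ℂ) (ψ : Spin k) :
    ‖Matrix.toEuclideanLin K ψ‖ ≤ ‖K‖ * ‖ψ‖ := Matrix.l2_opNorm_mulVec K ψ

theorem memℓp_blockMul (K : Matrix (Fin k) (Fin k) ℂ) (ψ : Wave d k) :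
    Memℓp (fun x => Matrix.toEuclideanLin K (ψ x)) 2 := by
  refine Memℓp.mono' ((lp.memℓp ψ).const_smul ((‖K‖ : ℝ) : ℂ)) fun x => ?_
  rw [Pi.smul_apply, norm_smul, Complex.norm_real, norm_norm]
  exact norm_toEuclideanLin_le K _

/-- The multiplication `ψ ↦ K ψ(·)` by a fixed matrix. -/
def blockMul (K : Matrix (Fin k) (Fin k) ℂ) : Wave d k →L[ℂ] Wave d k :=
  LinearMap.mkContinuous
    { toFun := fun ψ => ⟨fun x => Matrix.toEuclideanLin K (ψ x), memℓp_blockMul K ψ⟩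
      map_add' := fun ψ φ => lp.ext (funext fun x => map_add _ _ _)
      map_smul' := fun c ψ => lp.ext (funext fun x => map_smul (Matrix.toEuclideanLin K) c (ψ x)) } ‖K‖ (by
    intro ψ
    have h : ‖((‖K‖ : ℝ) : ℂ) • ψ‖ = ‖K‖ * ‖ψ‖ := by
      rw [norm_smul, Complex.norm_real, norm_norm]
    rw [← h]
    refine lp.norm_mono two_ne_zero fun x => ?_
    change ‖Matrix.toEuclideanLin K (ψ x)‖ ≤ ‖((‖K‖ : ℝ) : ℂ) • ψ x‖
    rw [norm_smul, Complex.norm_real, norm_norm]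
    exact norm_toEuclideanLin_le K _)

@[simp]
theorem blockMul_apply (K : Matrix (Fin k) (Fin k) ℂ) (ψ : Wave d k) (x : Site d) :
    blockMul K ψ x = Matrix.toEuclideanLin K (ψ x) := rfl

theorem inner_toEuclideanLin (K : Matrix (Fin k) (Fin k) ℂ) (ψ φ : Spin k) :
    ⟪Matrix.toEuclideanLin K ψ, φ⟫_ℂ = ⟪ψ, Matrix.toEuclideanLin K.conjTranspose φ⟫_ℂ := by
  rw [Matrix.toEuclideanLin_conjTranspose_eq_adjoint, LinearMap.adjoint_inner_right]

theorem blockMul_inner (K : Matrix (Fin k) (Fin k) ℂ) (ψ φ : Wave d k) :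
    ⟪blockMul K ψ, φ⟫_ℂ = ⟪ψ, blockMul K.conjTranspose φ⟫_ℂ := by
  rw [lp.inner_eq_tsum, lp.inner_eq_tsum]
  refine tsum_congr fun x => ?_
  rw [blockMul_apply, blockMul_apply, inner_toEuclideanLin]

/-- The hopping operator `(Wψ)(x) = ∑_{y ∼ x} K(x - y) ψ(y)`. -/
def ModelData.hopping (M : ModelData d k) : Wave d k →L[ℂ] Wave d k :=
  ∑ i : Fin d, (blockMul (M.K (unitVec i)) ∘L (shift (k := k) (-unitVec i)).toContinuousLinearEquiv.toContinuousLinearMap +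
    blockMul (M.K (-unitVec i)) ∘L (shift (k := k) (unitVec i)).toContinuousLinearEquiv.toContinuousLinearMap)

theorem ModelData.hopping_apply (M : ModelData d k) (ψ : Wave d k) (x : Site d) :
    M.hopping ψ x = ∑ i : Fin d,
        (Matrix.toEuclideanLin (M.K (unitVec i)) (ψ (x - unitVec i)) +
          Matrix.toEuclideanLin (M.K (-unitVec i)) (ψ (x + unitVec i))) := by
  rw [ModelData.hopping, sum_apply, lp.coeFn_sum, Finset.sum_apply]
  refine Finset.sum_congr rfl fun i _ => ?_
  simp [sub_eq_add_neg]

theorem blockMul_shift (K : Matrix (Fin k) (Fin k) ℂ) (a : Site d) (ψ : Wave d k) :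
    blockMul K (shift a ψ) = shift a (blockMul K ψ) := rfl

theorem ModelData.hopping_inner {M : ModelData d k}
    (hK : ∀ i : Fin d, M.K (-unitVec i) = (M.K (unitVec i)).conjTranspose) (ψ φ : Wave d k) :
    ⟪M.hopping ψ, φ⟫_ℂ = ⟪ψ, M.hopping φ⟫_ℂ := by
  simp only [ModelData.hopping, sum_apply, sum_inner, inner_sum]
  refine Finset.sum_congr rfl fun i _ => ?_
  simp only [add_apply, ContinuousLinearMap.comp_apply, inner_add_left, inner_add_right]
  rw [add_comm]
  congr 1 <;>
  · simp only [ContinuousLinearEquiv.coe_coe, LinearIsometryEquiv.coe_toContinuousLinearEquiv]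
    rw [blockMul_inner, shift_inner, ← blockMul_shift]
    simp [hK]

theorem ModelData.formal_apply (M : ModelData d k) (g : ℝ) (v : Site d → ℝ) (ψ : Wave d k)
    (x : Site d) : M.formal g v (fun x => ψ x) x =
      Matrix.toEuclideanLin ((v x : ℂ) • M.A + M.B) (ψ x) + ((g⁻¹ : ℝ) : ℂ) • M.hopping ψ x := by
  rw [ModelData.hopping_apply]
  rfl

end Operators

/-! ### The Hamiltonian and its resolvent -/

section Hamiltonian

variable {d k : ℕ} {M : ModelData d k} {g : ℝ} {v : Site d → ℝ} {CB1 CB2 CB3 : ℝ}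

theorem ModelData.hamiltonian_apply (φ : (M.hamiltonian g v).domain) (x : Site d) :
    M.hamiltonian g v φ x = Matrix.toEuclideanLin ((v x : ℂ) • M.A + M.B) (φ.1 x) +
      ((g⁻¹ : ℝ) : ℂ) • M.hopping φ.1 x :=
  M.formal_apply g v φ.1 x

/-- The domain is maximal, so a pointwise equation with a square-summable right side is all that
membership requires. Every later verification of domain conditions goes through this. -/
theorem ModelData.mem_domain_of_eq {ψ χ : Wave d k}
    (h : ∀ x, Matrix.toEuclideanLin ((v x : ℂ) • M.A + M.B) (ψ x) +
      ((g⁻¹ : ℝ) : ℂ) • M.hopping ψ x = χ x) :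
    ∃ h : ψ ∈ (M.hamiltonian g v).domain, M.hamiltonian g v ⟨ψ, h⟩ = χ := by
  have h1 : M.formal g v (fun x => ψ x) = χ := by
    funext x
    rw [M.formal_apply, h]
  have h2 : ψ ∈ (M.hamiltonian g v).domain := by
    change Memℓp (M.formal g v (fun x => ψ x)) 2
    rw [h1]
    exact lp.memℓp χ
  refine ⟨h2, lp.ext (funext fun x => ?_)⟩
  rw [ModelData.hamiltonian_apply]
  exact h x

theorem ModelData.Admissible.isHermitian_site (hM : M.Admissible CB1 CB2 CB3) (t : ℝ) :
    ((t : ℂ) • M.A + M.B).conjTranspose = (t : ℂ) • M.A + M.B := by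
  rw [Matrix.conjTranspose_add, Matrix.conjTranspose_smul, hM.hermitian_A.eq, hM.hermitian_B.eq]
  simp

/-- After the bounded symmetric hopping term is subtracted, what remains acts on each site
separately by a Hermitian block, and the two inner products agree term by term. The splitting is
needed only inside the inner product, where the potential part is square-summable on the maximal
domain. -/
theorem ModelData.Admissible.isFormalAdjoint (hM : M.Admissible CB1 CB2 CB3) :
    (M.hamiltonian g v).IsFormalAdjoint (M.hamiltonian g v) := by
  intro φ ψ
  have h1 : ⟪M.hamiltonian g v φ - ((g⁻¹ : ℝ) : ℂ) • M.hopping φ.1, ψ.1⟫_ℂ =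
      ⟪φ.1, M.hamiltonian g v ψ - ((g⁻¹ : ℝ) : ℂ) • M.hopping ψ.1⟫_ℂ := by
    rw [lp.inner_eq_tsum, lp.inner_eq_tsum]
    refine tsum_congr fun x => ?_
    simp only [lp.coeFn_sub, lp.coeFn_smul, Pi.sub_apply, Pi.smul_apply,
      ModelData.hamiltonian_apply, add_sub_cancel_right]
    rw [inner_toEuclideanLin, hM.isHermitian_site]
  rw [inner_sub_left, inner_sub_right, inner_smul_left, inner_smul_right,
    ModelData.hopping_inner hM.hermitian_K, Complex.conj_ofReal] at h1
  exact sub_left_injective h1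

/-- Evaluation at a site and the hopping operator are continuous, so the pointwise equation passes
to the limit; the maximal domain does the rest. -/
theorem ModelData.hamiltonian_closed (f : ℕ → (M.hamiltonian g v).domain) (ψ χ : Wave d k)
    (hf : Tendsto (fun n => (f n : Wave d k)) atTop (𝓝 ψ))
    (hTf : Tendsto (fun n => M.hamiltonian g v (f n)) atTop (𝓝 χ)) :
    ∃ h : ψ ∈ (M.hamiltonian g v).domain, M.hamiltonian g v ⟨ψ, h⟩ = χ := by
  have hev : ∀ x : Site d, Continuous fun φ : Wave d k => φ x := fun x =>
    (lp.lipschitzWith_one_eval 2 x).continuous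
  refine ModelData.mem_domain_of_eq fun x => ?_
  have h1 : Tendsto (fun n => M.hamiltonian g v (f n) x) atTop (𝓝 (χ x)) :=
    ((hev x).tendsto χ).comp hTf
  have h2 : Continuous fun φ : Wave d k =>
      Matrix.toEuclideanLin ((v x : ℂ) • M.A + M.B) (φ x) + ((g⁻¹ : ℝ) : ℂ) • M.hopping φ x :=
    ((LinearMap.continuous_of_finiteDimensional _).comp (hev x)).add
      (((hev x).comp M.hopping.continuous).const_smul ((g⁻¹ : ℝ) : ℂ))
  refine tendsto_nhds_unique ((h2.tendsto ψ).comp hf) ?_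
  refine h1.congr fun n => ?_
  rw [ModelData.hamiltonian_apply]
  rfl

theorem ModelData.single_mem_domain (x : Site d) (a : Spin k) :
    ∃ h : (lp.single 2 x a : Wave d k) ∈ (M.hamiltonian g v).domain,
      M.hamiltonian g v ⟨lp.single 2 x a, h⟩ =
        lp.single 2 x (Matrix.toEuclideanLin ((v x : ℂ) • M.A + M.B) a) +
          ((g⁻¹ : ℝ) : ℂ) • M.hopping (lp.single 2 x a) := by
  refine ModelData.mem_domain_of_eq fun y => ?_
  rw [lp.coeFn_add, lp.coeFn_smul, Pi.add_apply, Pi.smul_apply]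
  congr 1
  by_cases h : y = x
  · subst h
    simp
  · rw [lp.single_apply_ne _ _ _ h, lp.single_apply_ne _ _ _ h, map_zero]

/-- `(H - z) (δ_x ⊗ a)`. -/
def ModelData.shiftedColumn (M : ModelData d k) (g : ℝ) (v : Site d → ℝ) (z : ℂ) (x : Site d)
    (a : Spin k) : Wave d k :=
  lp.single 2 x (Matrix.toEuclideanLin ((v x : ℂ) • M.A + M.B) a) +
          ((g⁻¹ : ℝ) : ℂ) • M.hopping (lp.single 2 x a) - z • lp.single 2 x a

/-- Orthogonality to all (H - z)(δ_x ⊗ a) says that χ solves (H - z̄)χ = 0 at every site. Then χ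
lies in the maximal domain, and a symmetric operator has no nonreal eigenvalue. This density
statement gives both the existence of the resolvent and its strong continuity. -/
theorem ModelData.Admissible.eq_zero_of_inner_shiftedColumn (hM : M.Admissible CB1 CB2 CB3)
    {z : ℂ} (hz : z.im ≠ 0) {χ : Wave d k}
    (h : ∀ x a, ⟪M.shiftedColumn g v z x a, χ⟫_ℂ = 0) : χ = 0 := by
  have key : ∀ x, Matrix.toEuclideanLin ((v x : ℂ) • M.A + M.B) (χ x) +
      ((g⁻¹ : ℝ) : ℂ) • M.hopping χ x = (conj z • χ) x := by
    intro x
    rw [← sub_eq_zero]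
    refine ext_inner_left ℂ fun a => ?_
    rw [inner_zero_right, ← h x a, ModelData.shiftedColumn, inner_sub_left, inner_add_left,
      inner_smul_left, inner_smul_left, ModelData.hopping_inner hM.hermitian_K,
      lp.inner_single_left, lp.inner_single_left, lp.inner_single_left, inner_sub_right,
      inner_add_right, inner_toEuclideanLin, hM.isHermitian_site, lp.coeFn_smul, Pi.smul_apply,
      inner_smul_right, inner_smul_right, Complex.conj_ofReal]
  obtain ⟨hm, he⟩ := ModelData.mem_domain_of_eq key
  have h1 := (hM.isFormalAdjoint (g := g) (v := v)).norm_le (conj z) ⟨χ, hm⟩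
  rw [he, sub_self, norm_zero, Complex.conj_im, abs_neg] at h1
  have h2 : 0 < |z.im| := abs_pos.2 hz
  have h3 : ‖χ‖ = 0 := by
    have := norm_nonneg χ
    nlinarith
  exact norm_eq_zero.1 h3

theorem ModelData.Admissible.exists_isResolventAt (hM : M.Admissible CB1 CB2 CB3) (g : ℝ)
    (v : Site d → ℝ) {z : ℂ} (hz : z.im ≠ 0) : ∃ R, IsResolventAt (M.hamiltonian g v) z R := by
  refine _root_.exists_isResolventAt hM.isFormalAdjoint ModelData.hamiltonian_closed hz
    fun χ hχ => hM.eq_zero_of_inner_shiftedColumn (g := g) (v := v) hz fun x a => ?_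
  obtain ⟨hm, he⟩ := ModelData.single_mem_domain (M := M) (g := g) (v := v) x a
  have := hχ ⟨_, hm⟩
  rw [he] at this
  exact this

/-- The resolvent `(H - z)⁻¹` of the Hamiltonian. -/
def ModelData.green (M : ModelData d k) (g : ℝ) (v : Site d → ℝ) (z : ℂ) :
    Wave d k →L[ℂ] Wave d k :=
  resolventAt (M.hamiltonian g v) z

theorem ModelData.Admissible.isResolventAt_green (hM : M.Admissible CB1 CB2 CB3) (g : ℝ)
    (v : Site d → ℝ) {z : ℂ} (hz : z.im ≠ 0) :
    IsResolventAt (M.hamiltonian g v) z (M.green g v z) := by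
  obtain ⟨R, hR⟩ := hM.exists_isResolventAt g v hz
  rw [ModelData.green, resolventAt_eq hR]
  exact hR

theorem ModelData.Admissible.norm_green_le (hM : M.Admissible CB1 CB2 CB3) (g : ℝ)
    (v : Site d → ℝ) {z : ℂ} (hz : z.im ≠ 0) : ‖M.green g v z‖ ≤ |z.im|⁻¹ :=
  (hM.isResolventAt_green g v hz).norm_le hM.isFormalAdjoint hz

theorem ModelData.Admissible.adjoint_green (hM : M.Admissible CB1 CB2 CB3) (g : ℝ)
    (v : Site d → ℝ) {z : ℂ} (hz : z.im ≠ 0) :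
    ContinuousLinearMap.adjoint (M.green g v z) = M.green g v (conj z) :=
  (hM.isResolventAt_green g v hz).adjoint_eq hM.isFormalAdjoint
    (hM.isResolventAt_green g v (by simpa using hz))

theorem ModelData.Admissible.green_equation (hM : M.Admissible CB1 CB2 CB3) (g : ℝ)
    (v : Site d → ℝ) {z : ℂ} (hz : z.im ≠ 0) (ψ : Wave d k) (x : Site d) :
    Matrix.toEuclideanLin ((v x : ℂ) • M.A + M.B) (M.green g v z ψ x) +
      ((g⁻¹ : ℝ) : ℂ) • M.hopping (M.green g v z ψ) x - z • M.green g v z ψ x = ψ x := by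
  obtain ⟨hm, he⟩ := (hM.isResolventAt_green g v hz).1 ψ
  have h := congrArg (fun φ : Wave d k => φ x) he
  simp only [lp.coeFn_sub, lp.coeFn_smul, Pi.sub_apply, Pi.smul_apply,
    ModelData.hamiltonian_apply] at h
  exact h

/-- The resolvent is characterised by its pointwise equation. -/
theorem ModelData.Admissible.green_eq_of_equation (hM : M.Admissible CB1 CB2 CB3) {g : ℝ}
    {v : Site d → ℝ} {z : ℂ} (hz : z.im ≠ 0) {ψ φ : Wave d k}
    (h : ∀ x, Matrix.toEuclideanLin ((v x : ℂ) • M.A + M.B) (φ x) +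
      ((g⁻¹ : ℝ) : ℂ) • M.hopping φ x - z • φ x = ψ x) : M.green g v z ψ = φ := by
  obtain ⟨hm, he⟩ := ModelData.mem_domain_of_eq (M := M) (g := g) (v := v) (ψ := φ)
    (χ := ψ + z • φ) (fun x => by
      rw [lp.coeFn_add, lp.coeFn_smul, Pi.add_apply, Pi.smul_apply, ← h x, sub_add_cancel])
  have h2 := (hM.isResolventAt_green g v hz).2 ⟨φ, hm⟩
  rw [he] at h2
  simpa using h2

/-- On δ_x ⊗ a the Hamiltonians of two configurations differ only by (v(x) - w(x))A at the site x.
The error thus tends to 0 as w(x) → v(x), although the potential is unbounded. -/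
theorem ModelData.Admissible.green_shiftedColumn (hM : M.Admissible CB1 CB2 CB3) (g : ℝ)
    (v w : Site d → ℝ) {z : ℂ} (hz : z.im ≠ 0) (x : Site d) (a : Spin k) :
    M.green g w z (M.shiftedColumn g v z x a) = lp.single 2 x a +
      ((v x - w x : ℝ) : ℂ) • M.green g w z (lp.single 2 x (Matrix.toEuclideanLin M.A a)) := by
  obtain ⟨hm, he⟩ := ModelData.single_mem_domain (M := M) (g := g) (v := w) x a
  have h2 := (hM.isResolventAt_green g w hz).2 ⟨_, hm⟩
  rw [he] at h2
  replace h2 : M.green g w z (M.shiftedColumn g w z x a) = lp.single 2 x a := h2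
  have hA : Matrix.toEuclideanLin ((v x : ℂ) • M.A + M.B) a =
      Matrix.toEuclideanLin ((w x : ℂ) • M.A + M.B) a +
        ((v x - w x : ℝ) : ℂ) • Matrix.toEuclideanLin M.A a := by
    simp only [map_add, map_smul, LinearMap.add_apply, LinearMap.smul_apply]
    push_cast
    module
  have h3 : M.shiftedColumn g v z x a = M.shiftedColumn g w z x a +
      ((v x - w x : ℝ) : ℂ) • lp.single 2 x (Matrix.toEuclideanLin M.A a) := by
    rw [ModelData.shiftedColumn, ModelData.shiftedColumn, hA, lp.single_add, lp.single_smul]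
    abel
  rw [h3, map_add, map_smul, h2]

/-- The resolvent depends continuously on the configuration, in the strong operator topology. -/
theorem ModelData.Admissible.continuous_green (hM : M.Admissible CB1 CB2 CB3) (g : ℝ) {z : ℂ}
    (hz : z.im ≠ 0) (ψ : Wave d k) : Continuous fun v : Site d → ℝ => M.green g v z ψ := by
  rw [continuous_iff_continuousAt]
  intro v₀
  have hzpos : 0 < |z.im| := abs_pos.2 hz
  -- The vectors with a continuous orbit at `v₀` form a subspace, closed by the uniform bound |Im
  -- z|⁻¹. It contains all shifted columns of `v₀`, whose span is dense.
  let N : Submodule ℂ (Wave d k) :=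
    { carrier := {ψ | ContinuousAt (fun v : Site d → ℝ => M.green g v z ψ) v₀}
      zero_mem' := by simpa using continuousAt_const
      add_mem' := fun {a b} ha hb => by
        simp only [Set.mem_ofPred_eq, map_add] at *
        exact ha.add hb
      smul_mem' := fun c a ha => by
        simp only [Set.mem_ofPred_eq, map_smul] at *
        exact ha.const_smul c }
  have hNmem : ∀ ψ, ψ ∈ N ↔ ContinuousAt (fun v : Site d → ℝ => M.green g v z ψ) v₀ :=
    fun ψ => Iff.rfl
  have hclosed : IsClosed (N : Set (Wave d k)) := by
    rw [← closure_subset_iff_isClosed]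
    intro ψ hψ
    change ψ ∈ N
    rw [hNmem, Metric.continuousAt_iff']
    intro ε hε
    obtain ⟨φ, hφ, hdist⟩ := Metric.mem_closure_iff.1 hψ (|z.im| * (ε / 3)) (by positivity)
    have hφ' := (hNmem φ).1 hφ
    filter_upwards [Metric.continuousAt_iff'.1 hφ' (ε / 3) (by positivity)] with v hv
    have hb : ∀ w, dist (M.green g w z ψ) (M.green g w z φ) < ε / 3 := by
      intro w
      rw [dist_eq_norm, ← map_sub]
      calc _ ≤ ‖M.green g w z‖ * ‖ψ - φ‖ := ContinuousLinearMap.le_opNorm _ _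
        _ ≤ |z.im|⁻¹ * ‖ψ - φ‖ := by gcongr; exact hM.norm_green_le g w hz
        _ < |z.im|⁻¹ * (|z.im| * (ε / 3)) := by
            rw [← dist_eq_norm]; gcongr
        _ = ε / 3 := by field_simp
    calc dist (M.green g v z ψ) (M.green g v₀ z ψ) ≤ dist (M.green g v z ψ) (M.green g v z φ) +
          dist (M.green g v z φ) (M.green g v₀ z φ) +
          dist (M.green g v₀ z φ) (M.green g v₀ z ψ) := dist_triangle4 _ _ _ _
      _ < ε / 3 + ε / 3 + ε / 3 := by
          gcongr
          · exact hb v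
          · rw [dist_comm]; exact hb v₀
      _ = ε := by ring
  have hcol : ∀ x a, M.shiftedColumn g v₀ z x a ∈ N := by
    intro x a
    rw [hNmem]
    simp only [hM.green_shiftedColumn g v₀ _ hz]
    refine continuousAt_const.add ?_
    have h0 : Tendsto (fun v : Site d → ℝ => ((v₀ x - v x : ℝ) : ℂ)) (𝓝 v₀) (𝓝 0) := by
      have : Continuous fun v : Site d → ℝ => ((v₀ x - v x : ℝ) : ℂ) := by fun_prop
      simpa using this.tendsto v₀
    have hb : IsBoundedUnder (· ≤ ·) (𝓝 v₀) (norm ∘ fun v : Site d → ℝ =>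
        M.green g v z (lp.single 2 x (Matrix.toEuclideanLin M.A a))) := by
      refine isBoundedUnder_of ⟨|z.im|⁻¹ * ‖(lp.single 2 x (Matrix.toEuclideanLin M.A a) :
        Wave d k)‖, fun v => ?_⟩
      exact ContinuousLinearMap.le_of_opNorm_le _ (hM.norm_green_le g v hz) _
    have := h0.zero_smul_isBoundedUnder_le hb
    simpa [ContinuousAt] using this
  have htop : N = ⊤ := by
    have hcomp : CompleteSpace N := hclosed.completeSpace_coe
    rw [← Submodule.orthogonal_eq_bot_iff, Submodule.eq_bot_iff]
    intro χ hχ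
    exact hM.eq_zero_of_inner_shiftedColumn (g := g) (v := v₀) hz fun x a =>
      (Submodule.mem_orthogonal _ _).1 hχ _ (hcol x a)
  rw [← hNmem, htop]
  trivial

/-- The dependence of the resolvent on the potential at a single site. -/
theorem ModelData.Admissible.green_update (hM : M.Admissible CB1 CB2 CB3) (g : ℝ)
    (v : Site d → ℝ) {z : ℂ} (hz : z.im ≠ 0) (x : Site d) (t : ℝ) (ψ : Wave d k) :
    M.green g (Function.update v x t) z ψ + ((t - v x : ℝ) : ℂ) • M.green g v z
      (lp.single 2 x (Matrix.toEuclideanLin M.A (M.green g (Function.update v x t) z ψ x))) =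
      M.green g v z ψ := by
  set φ := M.green g (Function.update v x t) z ψ with hφ
  -- The new solution solves the old equation with the change of potential, supported at `x`, moved
  -- to the source.
  have h : M.green g v z (ψ - ((t - v x : ℝ) : ℂ) •
      lp.single 2 x (Matrix.toEuclideanLin M.A (φ x))) = φ := by
    refine hM.green_eq_of_equation hz fun y => ?_
    have h := hM.green_equation g (Function.update v x t) hz ψ y
    rw [← hφ] at h
    rw [lp.coeFn_sub, lp.coeFn_smul, Pi.sub_apply, Pi.smul_apply, ← h]
    by_cases hy : y = x
    · subst hy
      simp only [lp.single_apply_self, Function.update_self, map_add, map_smul,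
        LinearMap.add_apply, LinearMap.smul_apply]
      push_cast
      module
    · rw [lp.single_apply_ne _ _ _ hy, Function.update_of_ne hy, smul_zero, sub_zero]
  rw [map_sub, map_smul] at h
  nth_rewrite 1 [← h]
  exact sub_add_cancel _ _

theorem ModelData.Admissible.green_shift (hM : M.Admissible CB1 CB2 CB3) (g : ℝ)
    (v : Site d → ℝ) {z : ℂ} (hz : z.im ≠ 0) (a : Site d) :
    M.green g (fun x => v (x + a)) z = (shift a).conjStarAlgEquiv (M.green g v z) := by
  ext1 ψ
  refine hM.green_eq_of_equation hz fun x => ?_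
  have h := hM.green_equation g v hz ((shift a).symm ψ) (x + a)
  rw [shift_symm_apply, add_sub_cancel_right] at h
  rw [← h]
  simp only [LinearIsometryEquiv.conjStarAlgEquiv_apply_apply, shift_apply,
    ModelData.hopping_apply, add_right_comm, sub_add_eq_add_sub]

theorem kernel_shift (T : Wave d k →L[ℂ] Wave d k) (a m n : Site d) :
    kernel ((shift a).conjStarAlgEquiv T) m n = kernel T (m + a) (n + a) := by
  ext i j
  have : (shift a).symm (lp.single 2 n (EuclideanSpace.single j (1 : ℂ)) : Wave d k) =
      lp.single 2 (n + a) (EuclideanSpace.single j (1 : ℂ)) := by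
    refine lp.ext (funext fun y => ?_)
    rw [shift_symm_apply]
    by_cases h : y = n + a
    · subst h
      rw [add_sub_cancel_right, lp.single_apply_self, lp.single_apply_self]
    · rw [lp.single_apply_ne _ _ _ h, lp.single_apply_ne]
      exact fun h' => h (by rw [← h', sub_add_cancel])
  simp only [kernel, Matrix.of_apply, LinearIsometryEquiv.conjStarAlgEquiv_apply_apply,
    shift_apply, this]

theorem norm_kernel_le (T : Wave d k →L[ℂ] Wave d k) (m n : Site d) (i j : Fin k) :
    ‖kernel T m n i j‖ ≤ ‖T‖ := by
  calc ‖kernel T m n i j‖ ≤ ‖T (lp.single 2 n (EuclideanSpace.single j (1 : ℂ))) m‖ :=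
        PiLp.norm_apply_le _ _
    _ ≤ ‖T (lp.single 2 n (EuclideanSpace.single j (1 : ℂ)))‖ :=
        lp.norm_apply_le_norm two_ne_zero _ _
    _ ≤ ‖T‖ * ‖(lp.single 2 n (EuclideanSpace.single j (1 : ℂ)) : Wave d k)‖ := T.le_opNorm _
    _ = ‖T‖ := by simp [lp.norm_single]

end Hamiltonian

/-! ### The functional calculus of the Hamiltonian -/

section Calculus

/-- The circle `{(t + i)⁻¹ : t ∈ ℝ} ∪ {0}`. -/
def cayleyCircle : Set ℂ := {w | w - conj w = -(2 * Complex.I) * (w * conj w)}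

theorem norm_le_one_of_mem_cayleyCircle {w : ℂ} (hw : w ∈ cayleyCircle) : ‖w‖ ≤ 1 := by
  have h : ‖w - conj w‖ = 2 * (‖w‖ * ‖w‖) := by
    rw [show w - conj w = _ from hw]
    simp
  have h2 : ‖w - conj w‖ ≤ ‖w‖ + ‖w‖ := by
    simpa using norm_sub_le w (conj w)
  nlinarith [norm_nonneg w]

instance : CompactSpace cayleyCircle := by
  refine isCompact_iff_compactSpace.1 (Metric.isCompact_of_isClosed_isBounded ?_ ?_)
  · exact isClosed_eq (by fun_prop) (by fun_prop)
  · refine (Metric.isBounded_closedBall (x := (0 : ℂ)) (r := 1)).subset fun w hw => ?_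
    simpa using norm_le_one_of_mem_cayleyCircle hw

theorem inv_im_of_mem_cayleyCircle {w : ℂ} (hw : w ∈ cayleyCircle) (h0 : w ≠ 0) :
    (w⁻¹).im = 1 := by
  have h1 : w - conj w = -(2 * Complex.I) * (w * conj w) := hw
  have h0' : conj w ≠ 0 := by simpa using h0
  have h2 : w⁻¹ - conj w⁻¹ = 2 * Complex.I := by
    rw [map_inv₀]
    field_simp
    linear_combination -h1
  have h3 := congrArg Complex.im h2
  simp only [Complex.sub_im, Complex.conj_im, Complex.mul_im] at h3
  simp at h3
  simp only [Complex.inv_im]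
  linarith

theorem inv_eq_of_mem_cayleyCircle {w : ℂ} (hw : w ∈ cayleyCircle) (h0 : w ≠ 0) :
    w⁻¹ = (((w⁻¹).re : ℝ) : ℂ) + Complex.I := by
  apply Complex.ext
  · simp
  · rw [inv_im_of_mem_cayleyCircle hw h0]
    simp

open Classical in
/-- The function on the circle that corresponds to a function on the real line. -/
def circleWeight (f : C₀(ℝ, ℝ)) (w : ℂ) : ℂ :=
  if w = 0 then (0 : ℂ) else ((f (w⁻¹).re : ℝ) : ℂ)

theorem continuousOn_circleWeight (f : C₀(ℝ, ℝ)) :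
    ContinuousOn (circleWeight f) cayleyCircle := by
  intro w hw
  by_cases h0 : w = 0
  · subst h0
    rw [← continuousWithinAt_sdiff_self]
    -- On the circle w⁻¹ = t + i, so w → 0 means |t| → ∞, where `f` vanishes.
    have h1 : Tendsto (fun w : ℂ => (w⁻¹).re) (𝓝[cayleyCircle \ {0}] 0) (cocompact ℝ) := by
      rw [← Metric.cobounded_eq_cocompact, ← tendsto_norm_atTop_iff_cobounded]
      have h2 : Tendsto (fun w : ℂ => ‖w⁻¹‖ - 1) (𝓝[cayleyCircle \ {0}] 0) atTop := by
        refine tendsto_atTop_add_const_right _ _ ?_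
        have := tendsto_norm_atTop_iff_cobounded.2 (tendsto_inv₀_nhdsNE_zero (α := ℂ))
        exact this.mono_left (nhdsWithin_mono _ fun w hw => hw.2)
      refine tendsto_atTop_mono' _ ?_ h2
      filter_upwards [self_mem_nhdsWithin] with w hw
      have h3 := inv_eq_of_mem_cayleyCircle hw.1 hw.2
      have h4 : ‖w⁻¹‖ ≤ ‖(w⁻¹).re‖ + 1 := by
        calc ‖w⁻¹‖ = ‖(((w⁻¹).re : ℝ) : ℂ) + Complex.I‖ := by rw [← h3]
          _ ≤ _ := by simpa using norm_add_le (((w⁻¹).re : ℝ) : ℂ) Complex.I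
      linarith
    have h2 : Tendsto (fun w : ℂ => ((f (w⁻¹).re : ℝ) : ℂ)) (𝓝[cayleyCircle \ {0}] 0)
        (𝓝 (circleWeight f 0)) := by
      have := (zero_at_infty f).comp h1
      simpa [circleWeight, Function.comp_def] using
        (Complex.continuous_ofReal.tendsto 0).comp this
    refine h2.congr' ?_
    filter_upwards [self_mem_nhdsWithin] with w hw
    exact (if_neg hw.2).symm
  · have h1 : ContinuousAt (fun w : ℂ => ((f (w⁻¹).re : ℝ) : ℂ)) w := by
      refine Complex.continuous_ofReal.continuousAt.comp ?_
      refine (map_continuous f).continuousAt.comp ?_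
      exact Complex.continuous_re.continuousAt.comp (continuousAt_inv₀ h0)
    refine (h1.congr ?_).continuousWithinAt
    filter_upwards [isOpen_ne.mem_nhds h0] with w' hw'
    exact (if_neg hw').symm

/-- The function on the circle that corresponds to a function on the real line, as a continuous
function. -/
def circleFun (f : C₀(ℝ, ℝ)) : C(cayleyCircle, ℂ) :=
  ⟨fun w => circleWeight f w, continuousOn_iff_continuous_domRestrict.1 (continuousOn_circleWeight f)⟩

@[simp]
theorem circleFun_apply (f : C₀(ℝ, ℝ)) (w : cayleyCircle) :
    circleFun f w = circleWeight f w := rfl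

theorem circleFun_add (f h : C₀(ℝ, ℝ)) : circleFun (f + h) = circleFun f + circleFun h := by
  ext w
  by_cases h0 : (w : ℂ) = 0 <;> simp [circleWeight, h0]

theorem circleFun_smul (c : ℝ) (f : C₀(ℝ, ℝ)) : circleFun (c • f) = (c : ℂ) • circleFun f := by
  ext w
  by_cases h0 : (w : ℂ) = 0 <;> simp [circleWeight, h0]

theorem norm_circleFun_le (f : C₀(ℝ, ℝ)) {C : ℝ} (hC : 0 ≤ C) (hf : ∀ t, |f t| ≤ C) :
    ‖circleFun f‖ ≤ C := by
  rw [ContinuousMap.norm_le _ hC]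
  intro w
  by_cases h0 : (w : ℂ) = 0
  · simpa [circleWeight, h0] using hC
  · simpa [circleWeight, h0] using hf _

variable {A : Type*} [CStarAlgebra A]

/-- The equation of the circle holds for `a` in the algebra, hence for the two corresponding
functions under the functional calculus, which is injective on functions on the spectrum. -/
theorem spectrum_subset_cayleyCircle {a : A} (ha : IsStarNormal a)
    (h : a - star a = (-(2 * Complex.I)) • (a * star a)) :
    spectrum ℂ a ⊆ cayleyCircle := by
  have h1 : cfc (fun w : ℂ => w - star w) a =
      cfc (fun w : ℂ => (-(2 * Complex.I)) • (w * star w)) a := by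
    rw [cfc_sub (fun w : ℂ => w) (fun w : ℂ => star w) a, cfc_smul _ (fun w : ℂ => w * star w) a,
      cfc_mul (fun w : ℂ => w) (fun w : ℂ => star w) a, cfc_star_id (a := a), cfc_id' ℂ a, h]
  intro w hw
  have h2 := eqOn_of_cfc_eq_cfc h1
  exact h2 hw

variable {d k : ℕ} {M : ModelData d k} {g : ℝ} {v : Site d → ℝ} {CB1 CB2 CB3 : ℝ}

theorem negI_im_ne_zero : (-Complex.I).im ≠ 0 := by simp

theorem ModelData.Admissible.star_green (hM : M.Admissible CB1 CB2 CB3) (g : ℝ)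
    (v : Site d → ℝ) {z : ℂ} (hz : z.im ≠ 0) : star (M.green g v z) = M.green g v (conj z) := by
  rw [ContinuousLinearMap.star_eq_adjoint, hM.adjoint_green g v hz]

theorem ModelData.Admissible.isStarNormal_green (hM : M.Admissible CB1 CB2 CB3) (g : ℝ)
    (v : Site d → ℝ) {z : ℂ} (hz : z.im ≠ 0) : IsStarNormal (M.green g v z) := by
  constructor
  rw [hM.star_green g v hz]
  exact (hM.isResolventAt_green g v (by simpa using hz)).mul_comm (hM.isResolventAt_green g v hz)

theorem ModelData.Admissible.spectrum_green (hM : M.Admissible CB1 CB2 CB3) (g : ℝ)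
    (v : Site d → ℝ) : spectrum ℂ (M.green g v (-Complex.I)) ⊆ cayleyCircle := by
  refine spectrum_subset_cayleyCircle (hM.isStarNormal_green g v negI_im_ne_zero) ?_
  rw [hM.star_green g v negI_im_ne_zero, (hM.isResolventAt_green g v negI_im_ne_zero).identity
    (hM.isResolventAt_green g v (by simp))]
  congr 1
  simp
  ring

/-- The functional calculus of the Hamiltonian, for functions on the circle. -/
def ModelData.Admissible.calculus (hM : M.Admissible CB1 CB2 CB3) (g : ℝ) (v : Site d → ℝ) :
    C(cayleyCircle, ℂ) →⋆ₐ[ℂ] (Wave d k →L[ℂ] Wave d k) :=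
  cfcHomSuperset (hM.isStarNormal_green g v negI_im_ne_zero) (hM.spectrum_green g v)

theorem ModelData.Admissible.funCalc_eq (hM : M.Admissible CB1 CB2 CB3) (f : C₀(ℝ, ℝ)) :
    funCalc (M.hamiltonian g v) f = hM.calculus g v (circleFun f) := by
  have hn := hM.isStarNormal_green g v negI_im_ne_zero
  change cfc (circleWeight f) (M.green g v (-Complex.I)) = _
  rw [ModelData.Admissible.calculus, cfcHomSuperset_apply, cfc_apply _ _ hn
    ((continuousOn_circleWeight f).mono (hM.spectrum_green g v))]
  rfl

theorem ModelData.Admissible.norm_calculus_le (hM : M.Admissible CB1 CB2 CB3)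
    (h : C(cayleyCircle, ℂ)) : ‖hM.calculus g v h‖ ≤ ‖h‖ :=
  NonUnitalStarAlgHom.norm_apply_le _ _

theorem ModelData.Admissible.calculus_id (hM : M.Admissible CB1 CB2 CB3) :
    hM.calculus g v (.restrict cayleyCircle <| .id ℂ) = M.green g v (-Complex.I) :=
  cfcHomSuperset_id _ _

theorem ModelData.Admissible.calculus_star_id (hM : M.Admissible CB1 CB2 CB3) :
    hM.calculus g v (star (.restrict cayleyCircle <| .id ℂ)) = M.green g v Complex.I := by
  rw [map_star, hM.calculus_id, hM.star_green g v negI_im_ne_zero]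
  simp

/-- Stone–Weierstrass induction from the strong continuity of the resolvents at ±i. This is the
source of measurability in the configuration. -/
theorem ModelData.Admissible.continuous_calculus (hM : M.Admissible CB1 CB2 CB3) (g : ℝ)
    (h : C(cayleyCircle, ℂ)) (ψ : Wave d k) :
    Continuous fun v : Site d → ℝ => hM.calculus g v h ψ := by
  induction h using ContinuousMap.induction_on_of_compact generalizing ψ with
  | const r =>
    have : ∀ v, hM.calculus g v (ContinuousMap.const _ r) = r • 1 := fun v => by
      rw [show ContinuousMap.const cayleyCircle r = r • 1 by ext; simp, map_smul, map_one]
    simp only [this]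
    exact continuous_const
  | id => simpa only [hM.calculus_id] using hM.continuous_green g negI_im_ne_zero ψ
  | star_id => simpa only [hM.calculus_star_id] using hM.continuous_green g (by simp) ψ
  | add f h hf hh => simp only [map_add]; exact (hf ψ).add (hh ψ)
  | mul f h hf hh =>
    simp only [map_mul]
    rw [continuous_iff_continuousAt]
    intro v₀
    -- Products are not jointly continuous in the strong topology; the bound ‖f‖, uniform in the
    -- configuration, makes up for it.
    have h1 : Tendsto (fun v => hM.calculus g v f (hM.calculus g v h ψ - hM.calculus g v₀ h ψ))
        (𝓝 v₀) (𝓝 0) := by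
      have h2 : Tendsto (fun v => ‖f‖ * ‖hM.calculus g v h ψ - hM.calculus g v₀ h ψ‖)
          (𝓝 v₀) (𝓝 0) := by
        have h3 : Continuous fun v => ‖f‖ * ‖hM.calculus g v h ψ - hM.calculus g v₀ h ψ‖ :=
          continuous_const.mul ((hh ψ).sub continuous_const).norm
        simpa using h3.tendsto v₀
      exact squeeze_zero_norm (fun v =>
        ContinuousLinearMap.le_of_opNorm_le _ (hM.norm_calculus_le f) _) h2
    have h4 := h1.add ((hf (hM.calculus g v₀ h ψ)).tendsto v₀)
    rw [zero_add] at h4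
    refine h4.congr fun v => ?_
    rw [← map_add, sub_add_cancel]
    rfl
  | frequently f hf =>
    have hΦ : ∀ v (a b : C(cayleyCircle, ℂ)),
        ‖hM.calculus g v a - hM.calculus g v b‖ ≤ ‖a - b‖ := fun v a b => by
      rw [← map_sub]
      exact hM.norm_calculus_le _
    rw [continuous_iff_continuousAt]
    intro v₀
    rw [Metric.continuousAt_iff']
    intro ε hε
    have hpos : 0 < ε / 3 / (‖ψ‖ + 1) := by positivity
    obtain ⟨b, hb, hball⟩ := (hf.and_eventually (Metric.ball_mem_nhds f hpos)).exists
    have hclose : ∀ v, dist (hM.calculus g v f ψ) (hM.calculus g v b ψ) < ε / 3 := fun v => by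
      rw [dist_eq_norm, ← sub_apply]
      calc _ ≤ ‖f - b‖ * ‖ψ‖ := ContinuousLinearMap.le_of_opNorm_le _ (hΦ v f b) _
        _ ≤ ε / 3 / (‖ψ‖ + 1) * ‖ψ‖ := by
          gcongr
          rw [← dist_eq_norm, dist_comm]
          exact (Metric.mem_ball.1 hball).le
        _ < ε / 3 / (‖ψ‖ + 1) * (‖ψ‖ + 1) := by gcongr; linarith
        _ = ε / 3 := by field_simp
    filter_upwards [Metric.continuousAt_iff'.1 (hb ψ).continuousAt (ε / 3) (by positivity)]
      with v hv
    calc dist (hM.calculus g v f ψ) (hM.calculus g v₀ f ψ) ≤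
          dist (hM.calculus g v f ψ) (hM.calculus g v b ψ) +
          dist (hM.calculus g v b ψ) (hM.calculus g v₀ b ψ) +
          dist (hM.calculus g v₀ b ψ) (hM.calculus g v₀ f ψ) := dist_triangle4 _ _ _ _
      _ < ε / 3 + ε / 3 + ε / 3 := by
          gcongr
          · exact hclose v
          · rw [dist_comm]; exact hclose v₀
      _ = ε := by ring

/-- Covariance of the resolvents propagates through the same induction, conjugation by the shift
being a continuous star-homomorphism. -/
theorem ModelData.Admissible.calculus_shift (hM : M.Admissible CB1 CB2 CB3) (a : Site d)
    (h : C(cayleyCircle, ℂ)) : hM.calculus g (fun x => v (x + a)) h =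
      (shift a).conjStarAlgEquiv (hM.calculus g v h) := by
  induction h using ContinuousMap.induction_on_of_compact with
  | const r =>
    rw [show ContinuousMap.const cayleyCircle r = r • 1 by ext; simp]
    rw [map_smul, map_one, map_smul, map_one]
    ext1 ψ
    rw [LinearIsometryEquiv.conjStarAlgEquiv_apply_apply, smul_apply, smul_apply,
      one_apply_eq_self, one_apply_eq_self, LinearIsometryEquiv.map_smul,
      LinearIsometryEquiv.apply_symm_apply]
  | id => simp only [hM.calculus_id, hM.green_shift g v negI_im_ne_zero]
  | star_id => simp only [hM.calculus_star_id, hM.green_shift g v (by simp : Complex.I.im ≠ 0)]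
  | add f h hf hh =>
    rw [map_add, map_add, hf, hh]
    ext1 ψ
    simp only [LinearIsometryEquiv.conjStarAlgEquiv_apply_apply, add_apply,
      LinearIsometryEquiv.map_add]
  | mul f h hf hh =>
    rw [map_mul, map_mul, hf, hh]
    ext1 ψ
    simp only [LinearIsometryEquiv.conjStarAlgEquiv_apply_apply, mul_apply_eq_comp,
      LinearIsometryEquiv.symm_apply_apply]
  | frequently f hf =>
    have hcl : IsClosed {f | hM.calculus g (fun x => v (x + a)) f =
        (shift a).conjStarAlgEquiv (hM.calculus g v f)} := by
      refine isClosed_eq (cfcHomSuperset_continuous _ _) ?_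
      have : Continuous fun T : Wave d k →L[ℂ] Wave d k => (shift a).conjStarAlgEquiv T := by
        simp only [LinearIsometryEquiv.conjStarAlgEquiv_apply]
        fun_prop
      exact this.comp (cfcHomSuperset_continuous _ _)
    exact hcl.closure_subset (mem_closure_iff_frequently.2 hf)

theorem kernel_self_eq_inner (T : Wave d k →L[ℂ] Wave d k) (n : Site d) (i : Fin k) :
    kernel T n n i i = ⟪(lp.single 2 n (EuclideanSpace.single i (1 : ℂ)) : Wave d k),
      T (lp.single 2 n (EuclideanSpace.single i (1 : ℂ)))⟫_ℂ := by
  rw [lp.inner_single_left, EuclideanSpace.inner_single_left]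
  simp [kernel]

/-- A nonnegative function is q̄q with q its square root, so the diagonal entry is the squared norm
of a vector. -/
theorem ModelData.Admissible.kernel_calculus_nonneg (hM : M.Admissible CB1 CB2 CB3)
    {f : C₀(ℝ, ℝ)} (hf : ∀ t, 0 ≤ f t) (n : Site d) (i : Fin k) :
    0 ≤ (kernel (hM.calculus g v (circleFun f)) n n i i).re := by
  let q : C(cayleyCircle, ℂ) := ⟨fun w => ((Real.sqrt (circleFun f w).re : ℝ) : ℂ), by fun_prop⟩
  have hq : star q * q = circleFun f := by
    ext w
    have h1 : 0 ≤ (circleFun f w).re ∧ ((circleFun f w).re : ℂ) = circleFun f w := by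
      by_cases h0 : (w : ℂ) = 0
      · simp [circleWeight, h0]
      · simpa [circleWeight, h0] using hf _
    rw [ContinuousMap.mul_apply, ContinuousMap.star_apply]
    change conj ((Real.sqrt (circleFun f w).re : ℝ) : ℂ) *
      ((Real.sqrt (circleFun f w).re : ℝ) : ℂ) = _
    rw [Complex.conj_ofReal, ← Complex.ofReal_mul, Real.mul_self_sqrt h1.1, h1.2]
  rw [kernel_self_eq_inner, ← hq, map_mul, map_star, mul_apply_eq_comp,
    ContinuousLinearMap.star_eq_adjoint, ContinuousLinearMap.adjoint_inner_right]
  exact inner_self_nonneg (𝕜 := ℂ)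

/-- The function `t ↦ ε / ((t - λ)² + ε²)`. -/
def poisson (z : ℂ) : C₀(ℝ, ℝ) where
  toFun t := if z.im = 0 then 0 else |z.im| / ((t - z.re) ^ 2 + z.im ^ 2)
  continuous_toFun := by
    split_ifs with h
    · exact continuous_const
    · refine Continuous.div (by fun_prop) (by fun_prop) fun t => ?_
      positivity
  zero_at_infty' := by
    split_ifs with h
    · exact tendsto_const_nhds
    · refine Tendsto.div_atTop tendsto_const_nhds ?_
      refine tendsto_atTop_add_const_right _ _ ?_
      have h1 : Tendsto (fun t : ℝ => ‖t‖ - |z.re|) (cocompact ℝ) atTop :=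
        tendsto_atTop_add_const_right _ _ (tendsto_norm_cocompact_atTop)
      refine tendsto_atTop_mono' _ ?_ ((tendsto_pow_atTop two_ne_zero).comp h1)
      filter_upwards [h1.eventually_ge_atTop 0] with t ht
      have h2 : ‖t‖ - |z.re| ≤ |t - z.re| := abs_sub_abs_le_abs_sub t z.re
      rw [← sq_abs (t - z.re)]
      exact pow_le_pow_left₀ ht h2 2

theorem poisson_apply {z : ℂ} (hz : z.im ≠ 0) (t : ℝ) :
    poisson z t = |z.im| / ((t - z.re) ^ 2 + z.im ^ 2) := if_neg hz

/-- On the circle, w = (t + i)⁻¹ gives 1 - (u + i)w = w(t - u). The Poisson kernel times the two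
such factors at z and z̄ is therefore |Im z| w², an identity that the calculus carries to operators,
where the factors are invertible. -/
theorem ModelData.Admissible.calculus_poisson (hM : M.Admissible CB1 CB2 CB3) {z : ℂ}
    (hz : z.im ≠ 0) : hM.calculus g v (circleFun (poisson z)) =
      ((|z.im| : ℝ) : ℂ) • (M.green g v z * M.green g v (conj z)) := by
  have hz' : (conj z).im ≠ 0 := by simpa using hz
  set R := M.green g v (-Complex.I) with hR
  have hRr := hM.isResolventAt_green g v negI_im_ne_zero
  rw [← hR] at hRr
  let ι : C(cayleyCircle, ℂ) := .restrict cayleyCircle <| .id ℂ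
  have hι : hM.calculus g v ι = R := hM.calculus_id
  have hfac : circleFun (poisson z) * ((1 - (z + Complex.I) • ι) *
      (1 - (conj z + Complex.I) • ι)) = ((|z.im| : ℝ) : ℂ) • (ι * ι) := by
    ext w
    simp only [ContinuousMap.mul_apply, ContinuousMap.sub_apply, ContinuousMap.smul_apply,
      ContinuousMap.one_apply, circleFun_apply]
    change circleWeight (poisson z) w * ((1 - (z + Complex.I) * (w : ℂ)) *
      (1 - (conj z + Complex.I) * (w : ℂ))) = ((|z.im| : ℝ) : ℂ) * ((w : ℂ) * (w : ℂ))
    by_cases h0 : (w : ℂ) = 0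
    · simp [circleWeight, h0]
    · rw [circleWeight, if_neg h0, poisson_apply hz]
      have h1 := inv_eq_of_mem_cayleyCircle w.2 h0
      set t := ((w : ℂ)⁻¹).re
      have h2 : (w : ℂ) * ((t : ℂ) + Complex.I) = 1 := by rw [← h1, mul_inv_cancel₀ h0]
      have h3 : ∀ u : ℂ, 1 - (u + Complex.I) * (w : ℂ) = (w : ℂ) * (t - u) := fun u => by
        linear_combination -h2
      have h4 : ((t : ℂ) - z) * (t - conj z) = (((t - z.re) ^ 2 + z.im ^ 2 : ℝ) : ℂ) := by
        have hc : conj z = (z.re : ℂ) - z.im * Complex.I := by apply Complex.ext <;> simp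
        rw [hc]
        nth_rewrite 1 [← Complex.re_add_im z]
        push_cast
        linear_combination (-(z.im : ℂ) ^ 2) * Complex.I_sq
      have h5 : (((t - z.re) ^ 2 + z.im ^ 2 : ℝ) : ℂ) ≠ 0 := by
        rw [Complex.ofReal_ne_zero]
        positivity
      rw [h3, h3, mul_mul_mul_comm, h4, Complex.ofReal_div]
      field_simp
  -- Two forms of the resolvent identity: 1 + (u + i)G(u) is a right inverse of 1 - (u + i)R, and
  -- multiplying it by R produces G(u).
  have hinv : ∀ u : ℂ, u.im ≠ 0 →
      (1 - (u + Complex.I) • R) * (1 + (u + Complex.I) • M.green g v u) = 1 ∧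
      R * (1 + (u + Complex.I) • M.green g v u) = M.green g v u := by
    intro u hu
    have hG := hM.isResolventAt_green g v hu
    have h1 := hG.identity hRr
    rw [hG.mul_comm hRr] at h1
    constructor
    · simp only [mul_add, sub_mul, mul_one, one_mul, smul_mul_assoc, mul_smul_comm]
      linear_combination (norm := module) (u + Complex.I) • h1
    · simp only [mul_add, mul_one, mul_smul_comm]
      linear_combination (norm := module) -h1
  have hmap := congrArg (hM.calculus g v) hfac
  simp only [map_mul, map_sub, map_one, map_smul, hι] at hmap
  set b := hM.calculus g v (circleFun (poisson z))
  obtain ⟨h1, h1'⟩ := hinv z hz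
  obtain ⟨h2, h2'⟩ := hinv (conj z) hz'
  set X := 1 + (z + Complex.I) • M.green g v z
  set Y := 1 + (conj z + Complex.I) • M.green g v (conj z)
  have hcomm : R * Y = Y * R := by
    have h3 := (hM.isResolventAt_green g v hz').mul_comm hRr
    simp only [Y, mul_add, add_mul, mul_one, one_mul, mul_smul_comm, smul_mul_assoc, h3]
  calc b = b * (1 - (z + Complex.I) • R) * ((1 - (conj z + Complex.I) • R) * Y) * X := by
        rw [h2, mul_one, mul_assoc, h1, mul_one]
    _ = b * ((1 - (z + Complex.I) • R) * (1 - (conj z + Complex.I) • R)) * Y * X := by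
        simp only [mul_assoc]
    _ = ((|z.im| : ℝ) : ℂ) • (R * (R * Y) * X) := by
        rw [hmap]; simp only [smul_mul_assoc, mul_assoc]
    _ = ((|z.im| : ℝ) : ℂ) • (M.green g v z * M.green g v (conj z)) := by
        rw [hcomm, ← mul_assoc, hcomm, mul_assoc, h1', ← hcomm, h2',
          (hM.isResolventAt_green g v hz').mul_comm (hM.isResolventAt_green g v hz)]

end Calculus

/-! ### Regular laws with finite moments -/

section Law

/-- A law that is `α`-regular and has a finite `q`-moment, with extended nonnegative bounds. -/
structure TameLaw (α q C₁ C₂ : ℝ) (μ : Measure ℝ) : Prop where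
  regular : ∀ ε : ℝ, 0 < ε → ∀ t : ℝ, μ (Set.Icc (t - ε) (t + ε)) ≤ ENNReal.ofReal (C₁ * ε ^ α)
  moment : ∫⁻ x, ENNReal.ofReal (|x| ^ q) ∂μ ≤ ENNReal.ofReal C₂

theorem TameLaw.of_bounds {α q CA1 CA2 : ℝ} {μ : Measure ℝ} [IsFiniteMeasure μ]
    (h1 : IsRegularWith α CA1 μ) (h2 : HasMomentBound q CA2 μ) :
    TameLaw α q (max CA1 1) (max CA2 1) μ where
  regular ε hε t := by
    rw [← ENNReal.ofReal_toReal (measure_ne_top μ _)]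
    refine ENNReal.ofReal_le_ofReal ((h1 ε hε t).trans ?_)
    gcongr
    exact le_max_left _ _
  moment := by
    rw [← ofReal_integral_eq_lintegral_ofReal h2.1 (ae_of_all _ fun x => by positivity)]
    exact ENNReal.ofReal_le_ofReal (h2.2.trans (le_max_left _ _))

variable {α q C₁ C₂ : ℝ} {μ : Measure ℝ}

theorem TameLaw.measure_singleton (hμ : TameLaw α q C₁ C₂ μ) (hα : 0 < α) (a : ℝ) :
    μ {a} = 0 := by
  have h1 : Tendsto (fun ε : ℝ => ENNReal.ofReal (C₁ * ε ^ α)) (𝓝[>] 0) (𝓝 0) := by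
    have : Tendsto (fun ε : ℝ => C₁ * ε ^ α) (𝓝[>] 0) (𝓝 (C₁ * 0 ^ α)) :=
      ((Real.continuousAt_rpow_const 0 α (Or.inr hα.le)).tendsto.mono_left
        nhdsWithin_le_nhds).const_mul _
    rw [Real.zero_rpow hα.ne', mul_zero] at this
    simpa using ENNReal.tendsto_ofReal this
  refine le_antisymm (ge_of_tendsto h1 ?_) zero_le
  filter_upwards [self_mem_nhdsWithin] with ε hε
  have hε' : 0 < ε := hε
  refine (measure_mono ?_).trans (hμ.regular ε hε' a)
  rw [Set.singleton_subset_iff]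
  constructor <;> linarith

theorem TameLaw.moment_affine (hμ : TameLaw α q C₁ C₂ μ) [IsProbabilityMeasure μ] (hC₂ : 0 ≤ C₂)
    (hq : 0 < q) :
    ∫⁻ x, ENNReal.ofReal ((4 * |x| + 2) ^ q) ∂μ ≤ ENNReal.ofReal (4 ^ q + 8 ^ q * C₂) := by
  have hpt : ∀ x : ℝ, ENNReal.ofReal ((4 * |x| + 2) ^ q) ≤
      ENNReal.ofReal (4 ^ q) + ENNReal.ofReal (8 ^ q) * ENNReal.ofReal (|x| ^ q) := by
    intro x
    rw [← ENNReal.ofReal_mul (by positivity), ← ENNReal.ofReal_add (by positivity) (by positivity)]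
    refine ENNReal.ofReal_le_ofReal ?_
    have hx := abs_nonneg x
    rcases le_total (4 * |x|) 2 with h | h
    · have : (4 * |x| + 2) ^ q ≤ 4 ^ q := by gcongr; linarith
      have h3 : 0 ≤ (8 : ℝ) ^ q * |x| ^ q := by positivity
      linarith
    · have : (4 * |x| + 2) ^ q ≤ (8 * |x|) ^ q := by gcongr; linarith
      rw [Real.mul_rpow (by norm_num) hx] at this
      have h3 : 0 ≤ (4 : ℝ) ^ q := by positivity
      linarith
  refine (lintegral_mono hpt).trans ?_
  rw [lintegral_add_left measurable_const, lintegral_const, measure_univ, mul_one,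
    lintegral_const_mul _ (by fun_prop), ENNReal.ofReal_add (by positivity) (by positivity),
    ENNReal.ofReal_mul (by positivity)]
  gcongr
  exact hμ.moment

/-- The singular integral near the singularity, by dyadic decomposition. -/
theorem TameLaw.lintegral_singular_le (hμ : TameLaw α q C₁ C₂ μ) (hC₁ : 0 ≤ C₁) {t : ℝ}
    (ht : 0 < t) (htα : t < α) (a : ℝ) {η : ℝ} (hη : 0 < η) :
    ∫⁻ x in Set.Icc (a - η) (a + η), ENNReal.ofReal (|x - a| ^ (-t)) ∂μ ≤
      ENNReal.ofReal (C₁ * 2 ^ t * (1 - 2 ^ (t - α))⁻¹ * η ^ (α - t)) := by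
  -- Dyadic radii: a point at distance between e n / 2 and e n from the singularity is charged to
  -- the n-th term.
  let e : ℕ → ℝ := fun n => η * (1 / 2) ^ n
  have he : ∀ n, 0 < e n := fun n => by positivity
  let F : ℕ → ℝ → ℝ≥0∞ := fun n => (Set.Icc (a - e n) (a + e n)).indicator
    fun _ => ENNReal.ofReal ((e n / 2) ^ (-t))
  have hpt : ∀ x ∈ Set.Icc (a - η) (a + η), ENNReal.ofReal (|x - a| ^ (-t)) ≤ ∑' n, F n x := by
    intro x hx
    by_cases hxa : x = a
    -- At the singularity the real power `0 ^ (-t)` is 0 by convention.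
    · subst hxa
      rw [sub_self, abs_zero, Real.zero_rpow (by linarith)]
      simp
    · have hpos : 0 < |x - a| := abs_pos.2 (sub_ne_zero.2 hxa)
      have hle : |x - a| ≤ η := by
        rw [abs_le]; constructor <;> linarith [hx.1, hx.2]
      obtain ⟨n, hn1, hn2⟩ := exists_nat_pow_near_of_lt_one (x := |x - a| / η) (y := (1 / 2 : ℝ))
        (by positivity) ((div_le_one hη).2 hle) (by norm_num) (by norm_num)
      rw [lt_div_iff₀ hη] at hn1
      rw [div_le_iff₀ hη] at hn2
      have hmem : x ∈ Set.Icc (a - e n) (a + e n) := by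
        have : |x - a| ≤ e n := hn2.trans_eq (mul_comm _ _)
        rw [abs_le] at this
        constructor <;> linarith [this.1, this.2]
      refine le_trans ?_ (ENNReal.le_tsum n)
      simp only [F, Set.indicator_of_mem hmem]
      refine ENNReal.ofReal_le_ofReal ?_
      refine Real.rpow_le_rpow_of_nonpos (by have := he n; positivity) ?_ (by linarith)
      have : e n / 2 = (1 / 2) ^ (n + 1) * η := by simp only [e]; ring
      rw [this]
      exact hn1.le
  have hgeo : (2 : ℝ) ^ (t - α) < 1 := Real.rpow_lt_one_of_one_lt_of_neg (by norm_num) (by linarith)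
  calc ∫⁻ x in Set.Icc (a - η) (a + η), ENNReal.ofReal (|x - a| ^ (-t)) ∂μ
      ≤ ∫⁻ x in Set.Icc (a - η) (a + η), ∑' n, F n x ∂μ :=
        setLIntegral_mono' measurableSet_Icc hpt
    _ ≤ ∫⁻ x, ∑' n, F n x ∂μ := setLIntegral_le_lintegral _ _
    _ = ∑' n, ∫⁻ x, F n x ∂μ := lintegral_tsum fun n =>
        (measurable_const.indicator measurableSet_Icc).aemeasurable
    _ ≤ ∑' n, ENNReal.ofReal ((C₁ * 2 ^ t * η ^ (α - t)) * ((2 : ℝ) ^ (t - α)) ^ n) := by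
        refine ENNReal.tsum_le_tsum fun n => ?_
        simp only [F]
        rw [lintegral_indicator_const measurableSet_Icc]
        calc _ ≤ ENNReal.ofReal ((e n / 2) ^ (-t)) * ENNReal.ofReal (C₁ * e n ^ α) := by
              gcongr; exact hμ.regular _ (he n) a
          _ = _ := by
              rw [← ENNReal.ofReal_mul (by have := he n; positivity)]
              congr 1
              have h1 : (e n / 2) ^ (-t) = e n ^ (-t) * 2 ^ t := by
                rw [Real.div_rpow (he n).le (by norm_num), Real.rpow_neg (by norm_num : (0:ℝ) ≤ 2)]
                field_simp
              have h2 : e n ^ (-t) * e n ^ α = η ^ (α - t) * ((2 : ℝ) ^ (t - α)) ^ n := by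
                rw [← Real.rpow_add (he n), neg_add_eq_sub]
                simp only [e]
                rw [Real.mul_rpow hη.le (by positivity), ← Real.rpow_natCast, ← Real.rpow_natCast,
                  ← Real.rpow_mul (by norm_num), ← Real.rpow_mul (by norm_num), one_div,
                  Real.inv_rpow (by norm_num), ← Real.rpow_neg (by norm_num)]
                congr 2
                ring
              rw [h1]
              linear_combination (C₁ * 2 ^ t) * h2
    _ = _ := by
        rw [← ENNReal.ofReal_tsum_of_nonneg (fun n => by positivity)
          ((summable_geometric_of_lt_one (by positivity) hgeo).mul_left _), tsum_mul_left,
          tsum_geometric_of_lt_one (by positivity) hgeo]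
        congr 1
        ring

/-- The inverse moment of the distance to a point of the complex plane, scaled by the size of the
point. -/
theorem TameLaw.lintegral_inv_le (hμ : TameLaw α q C₁ C₂ μ) [IsProbabilityMeasure μ]
    (hC₁ : 0 ≤ C₁) (hC₂ : 0 ≤ C₂) (hα : 0 < α) (hq : 0 < q) (r : ℂ) :
    ∫⁻ x : ℝ, ENNReal.ofReal (((1 + ‖r‖) / ‖(x : ℂ) - r‖) ^ (α * q / (α + q))) ∂μ ≤
      ENNReal.ofReal (4 ^ (α * q / (α + q)) + (4 ^ q + 8 ^ q * C₂) +
        C₁ * 2 ^ (α * q / (α + q)) * (1 - 2 ^ (α * q / (α + q) - α))⁻¹) := by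
  set t := α * q / (α + q) with ht_def
  have ht : 0 < t := by positivity
  have htα : t < α := by
    rw [ht_def, div_lt_iff₀ (by positivity)]; nlinarith
  set L := 1 + ‖r‖ with hL
  have hL1 : 1 ≤ L := by rw [hL]; linarith [norm_nonneg r]
  have hL0 : 0 < L := by linarith
  set a := r.re with ha
  -- This radius balances the two bad regions: (L/η)^t = L^q is cancelled by the moment bound, and
  -- L^t η^(α - t) = 1 makes the singular part bounded.
  set η := L ^ (-(q / α)) with hη_def
  have hη : 0 < η := by positivity
  let B : Set ℝ := {x | L ≤ 4 * |x| + 2}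
  have hB : MeasurableSet B := measurableSet_le measurable_const (by fun_prop)
  -- Three regions: far from `r` the quotient is at most 4; within η of Re r the singular integral
  -- applies; otherwise x is within L/4 of `r`, so |x| is of order L, an event of probability
  -- O(L^(-q)).
  let I : Set ℝ := Set.Icc (a - η) (a + η)
  have hpt : ∀ᵐ x : ℝ ∂μ, ENNReal.ofReal ((L / ‖(x : ℂ) - r‖) ^ t) ≤ ENNReal.ofReal (4 ^ t) +
      B.indicator (fun _ => ENNReal.ofReal ((L / η) ^ t)) x +
      ENNReal.ofReal (L ^ t) * I.indicator (fun x => ENNReal.ofReal (|x - a| ^ (-t))) x := by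
    have hne : ∀ᵐ x : ℝ ∂μ, x ≠ a := by
      rw [ae_iff]; simpa using hμ.measure_singleton hα a
    filter_upwards [hne] with x hx
    have hxa : 0 < |x - a| := abs_pos.2 (sub_ne_zero.2 hx)
    have hre : |x - a| ≤ ‖(x : ℂ) - r‖ := by
      simpa [ha] using Complex.abs_re_le_norm ((x : ℂ) - r)
    have hpos : 0 < ‖(x : ℂ) - r‖ := hxa.trans_le hre
    by_cases h1 : L / 4 ≤ ‖(x : ℂ) - r‖
    · refine le_trans ?_ (le_add_right (le_add_right le_rfl))
      refine ENNReal.ofReal_le_ofReal ?_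
      gcongr
      rw [div_le_iff₀ hpos]; linarith
    by_cases h2 : |x - a| ≤ η
    · have hmem : x ∈ I := by
        rw [abs_le] at h2
        constructor <;> linarith [h2.1, h2.2]
      refine le_trans ?_ (le_add_left le_rfl)
      rw [Set.indicator_of_mem hmem, ← ENNReal.ofReal_mul (by positivity)]
      refine ENNReal.ofReal_le_ofReal ?_
      rw [Real.div_rpow hL0.le hpos.le, div_eq_mul_inv, ← Real.rpow_neg hpos.le]
      gcongr ?_ * ?_
      exact Real.rpow_le_rpow_of_nonpos hxa hre (by linarith)
    · have hmem : x ∈ B := by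
        push Not at h1
        have h3 : ‖r‖ ≤ |x| + ‖(x : ℂ) - r‖ := by
          have := norm_sub_le (x : ℂ) ((x : ℂ) - r)
          simpa using this
        change L ≤ 4 * |x| + 2
        linarith
      refine le_trans ?_ (le_add_right (le_add_left le_rfl))
      rw [Set.indicator_of_mem hmem]
      refine ENNReal.ofReal_le_ofReal ?_
      push Not at h2
      gcongr
      linarith
  have hμB : ENNReal.ofReal (L ^ q) * μ B ≤ ENNReal.ofReal (4 ^ q + 8 ^ q * C₂) := by
    refine le_trans ?_ (hμ.moment_affine hC₂ hq)
    refine le_trans ?_ (mul_meas_ge_le_lintegral (by fun_prop) (ENNReal.ofReal (L ^ q)))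
    gcongr
    intro x hx
    refine ENNReal.ofReal_le_ofReal ?_
    have : L ≤ 4 * |x| + 2 := hx
    gcongr
  have hexp1 : (L / η) ^ t = L ^ q := by
    rw [hη_def, Real.rpow_neg hL0.le, div_inv_eq_mul, ← Real.rpow_one_add' hL0.le (by positivity),
      ← Real.rpow_mul hL0.le]
    congr 1
    rw [ht_def]; field_simp
  have hexp2 : L ^ t * η ^ (α - t) = 1 := by
    rw [hη_def, ← Real.rpow_mul hL0.le, ← Real.rpow_add hL0]
    convert Real.rpow_zero L using 2
    rw [ht_def]; field_simp; ring
  have hgeo : (2 : ℝ) ^ (t - α) < 1 := Real.rpow_lt_one_of_one_lt_of_neg (by norm_num) (by linarith)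
  have hgeo' : 0 < 1 - (2 : ℝ) ^ (t - α) := by linarith
  refine (lintegral_mono_ae hpt).trans ?_
  rw [lintegral_add_left (by fun_prop (disch := assumption)),
    lintegral_add_left measurable_const, lintegral_const, measure_univ, mul_one,
    lintegral_indicator_const hB, lintegral_const_mul' _ _ ENNReal.ofReal_ne_top,
    lintegral_indicator measurableSet_Icc, hexp1, ENNReal.ofReal_add (by positivity)
    (by positivity), ENNReal.ofReal_add (by positivity) (by positivity)]
  refine add_le_add (add_le_add le_rfl hμB) ?_
  refine (mul_le_mul_right (hμ.lintegral_singular_le hC₁ ht htα a hη) _).trans ?_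
  rw [← ENNReal.ofReal_mul (by positivity)]
  refine ENNReal.ofReal_le_ofReal (le_of_eq ?_)
  linear_combination (C₁ * 2 ^ t * (1 - 2 ^ (t - α))⁻¹) * hexp2

/-- Each half-line is covered by the other one together with the symmetric interval. This converts
interval estimates into Hölder bounds for distribution functions. -/
theorem abs_measureReal_Iic_sub_le (ρ : Measure ℝ) [IsFiniteMeasure ρ] (x y : ℝ) :
    |ρ.real (Set.Iic y) - ρ.real (Set.Iic x)| ≤
      ρ.real (Set.Icc (x - |y - x|) (x + |y - x|)) := by
  have h1 : Set.Iic y ⊆ Set.Iic x ∪ Set.Icc (x - |y - x|) (x + |y - x|) := by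
    intro u hu
    have hu' : u ≤ y := hu
    rcases le_or_gt u x with h | h
    · exact Or.inl h
    · exact Or.inr ⟨by linarith [abs_nonneg (y - x)], by linarith [le_abs_self (y - x)]⟩
  have h2 : Set.Iic x ⊆ Set.Iic y ∪ Set.Icc (x - |y - x|) (x + |y - x|) := by
    intro u hu
    have hu' : u ≤ x := hu
    rcases le_or_gt u y with h | h
    · exact Or.inl h
    · exact Or.inr ⟨by linarith [neg_abs_le (y - x)], by linarith [abs_nonneg (y - x)]⟩
  have h3 := (measureReal_mono h1 (μ := ρ)).trans (measureReal_union_le _ _)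
  have h4 := (measureReal_mono h2 (μ := ρ)).trans (measureReal_union_le _ _)
  rw [abs_le]
  constructor <;> linarith

/-- A probability law cannot be `α`-regular with an exponent `α > 1`. -/
theorem TameLaw.exponent_le_one (hμ : TameLaw α q C₁ C₂ μ) [IsProbabilityMeasure μ]
    (hC₁ : 0 ≤ C₁) : α ≤ 1 := by
  by_contra hα
  push Not at hα
  -- For α > 1 the increments of the distribution function are o(|y - x|), so it is constant,
  -- against its limits 0 and 1.
  have hderiv : ∀ x, HasDerivAt (cdf μ) 0 x := by
    intro x
    rw [hasDerivAt_iff_isLittleO, Asymptotics.isLittleO_iff]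
    intro c hc
    have h1 : Tendsto (fun y : ℝ => C₁ * |y - x| ^ (α - 1)) (𝓝 x) (𝓝 0) := by
      have : Continuous fun y : ℝ => C₁ * |y - x| ^ (α - 1) :=
        continuous_const.mul ((by fun_prop : Continuous fun y : ℝ => |y - x|).rpow_const
          fun y => Or.inr (by linarith))
      have h2 := this.tendsto x
      rw [sub_self, abs_zero, Real.zero_rpow (by linarith), mul_zero] at h2
      exact h2
    filter_upwards [h1.eventually_le_const hc] with y hy
    rw [smul_zero, sub_zero, cdf_eq_real, cdf_eq_real, Real.norm_eq_abs, Real.norm_eq_abs]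
    rcases eq_or_ne y x with rfl | hyx
    · simp
    have hpos : 0 < |y - x| := abs_pos.2 (sub_ne_zero.2 hyx)
    refine (abs_measureReal_Iic_sub_le μ x y).trans ?_
    calc _ ≤ C₁ * |y - x| ^ α :=
          ENNReal.toReal_le_of_le_ofReal (by positivity) (hμ.regular _ hpos x)
      _ = C₁ * |y - x| ^ (α - 1) * |y - x| := by
          rw [Real.rpow_sub_one hpos.ne']; field_simp
      _ ≤ c * |y - x| := by gcongr
  have hconst : ∀ x, cdf μ x = cdf μ 0 := fun x =>
    is_const_of_deriv_eq_zero (fun x => (hderiv x).differentiableAt)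
      (fun x => (hderiv x).deriv) x 0
  have h0 := tendsto_nhds_unique (tendsto_cdf_atBot μ)
    (tendsto_const_nhds.congr fun x => (hconst x).symm)
  have h1 := tendsto_nhds_unique (tendsto_cdf_atTop μ)
    (tendsto_const_nhds.congr fun x => (hconst x).symm)
  exact zero_ne_one (h0.trans h1.symm)

end Law

/-! ### Decoupling for rational functions -/

section Rational

open Polynomial

/-- The size of a polynomial, measured by its leading coefficient and its roots. -/
def Polynomial.rootHeight (P : ℂ[X]) : ℝ :=
  ‖P.leadingCoeff‖ * (P.roots.map fun r => 1 + ‖r‖).prod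

theorem Polynomial.norm_eval_eq (P : ℂ[X]) (x : ℂ) :
    ‖P.eval x‖ = ‖P.leadingCoeff‖ * (P.roots.map fun r => ‖x - r‖).prod := by
  rw [(IsAlgClosed.splits P).eval_eq_prod_roots, norm_mul]
  congr 1
  change normHom (P.roots.map fun r => x - r).prod = _
  rw [map_multiset_prod, Multiset.map_map]
  rfl

theorem Polynomial.rootHeight_pos {P : ℂ[X]} (hP : P ≠ 0) : 0 < P.rootHeight := by
  refine mul_pos (norm_pos_iff.2 (leadingCoeff_ne_zero.2 hP)) ?_
  refine Multiset.prod_pos fun a ha => ?_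
  obtain ⟨r, -, rfl⟩ := Multiset.mem_map.1 ha
  positivity

theorem Multiset.prod_map_le_pow {ι : Type*} {s : Multiset ι} {f : ι → ℝ} {b : ℝ} {n : ℕ}
    (h0 : ∀ i ∈ s, 0 ≤ f i) (h : ∀ i ∈ s, f i ≤ b) (hb : 1 ≤ b) (hn : s.card ≤ n) :
    (s.map f).prod ≤ b ^ n := by
  refine (Multiset.prod_map_le_prod_map₀ f (fun _ => b) h0 h).trans ?_
  rw [Multiset.map_const', Multiset.prod_replicate]
  exact pow_le_pow_right₀ hb hn

/-- Each factor satisfies |x - r| ≤ (1 + |r|)(1 + |x|). With `le_norm_eval_of_mem_goodSet` this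
shows that the root height measures the size of P on bounded sets away from its roots. -/
theorem Polynomial.norm_eval_le_rootHeight {P : ℂ[X]} {k : ℕ} (hk : P.natDegree ≤ k) (x : ℝ) :
    ‖P.eval (x : ℂ)‖ ≤ P.rootHeight * (1 + |x|) ^ k := by
  have h0 : 0 ≤ |x| := abs_nonneg x
  rw [P.norm_eval_eq, Polynomial.rootHeight, mul_assoc]
  refine mul_le_mul_of_nonneg_left ?_ (norm_nonneg _)
  calc (P.roots.map fun r => ‖(x : ℂ) - r‖).prod
      ≤ (P.roots.map fun r => (1 + ‖r‖) * (1 + |x|)).prod := by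
        refine Multiset.prod_map_le_prod_map₀ _ _ (fun r _ => norm_nonneg _) fun r _ => ?_
        have h1 := norm_sub_le (x : ℂ) r
        rw [Complex.norm_real, Real.norm_eq_abs] at h1
        nlinarith [norm_nonneg r]
    _ = (P.roots.map fun r => 1 + ‖r‖).prod * (1 + |x|) ^ P.roots.card := by
        rw [Multiset.prod_map_mul, Multiset.map_const', Multiset.prod_replicate]
    _ ≤ _ := by
        refine mul_le_mul_of_nonneg_left (pow_le_pow_right₀ (by linarith)
          ((Polynomial.card_roots' P).trans hk)) ?_
        refine Multiset.prod_nonneg fun a ha => ?_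
        obtain ⟨r, -, rfl⟩ := Multiset.mem_map.1 ha
        positivity

theorem Polynomial.inv_norm_eval_eq (P : ℂ[X]) (hP : P ≠ 0) (x : ℝ) :
    ‖P.eval (x : ℂ)‖⁻¹ =
      P.rootHeight⁻¹ * (P.roots.map fun r => (1 + ‖r‖) / ‖(x : ℂ) - r‖).prod := by
  have h1 := rootHeight_pos hP
  rw [Multiset.prod_map_div, P.norm_eval_eq]
  have h2 : ‖P.leadingCoeff‖ ≠ 0 := norm_ne_zero_iff.2 (leadingCoeff_ne_zero.2 hP)
  have h3 : (P.roots.map fun r => 1 + ‖r‖).prod ≠ 0 := by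
    rw [Polynomial.rootHeight] at h1
    exact (pos_of_mul_pos_right h1 (norm_nonneg _)).ne'
  rw [Polynomial.rootHeight, mul_inv, mul_inv]
  field_simp

/-- The points that are not too large and not too close to finitely many given points. -/
def goodSet (T c : ℝ) (R : Multiset ℂ) : Set ℝ := {x | |x| ≤ T ∧ ∀ r ∈ R, c ≤ ‖(x : ℂ) - r‖}

theorem measurableSet_goodSet (T c : ℝ) (R : Multiset ℂ) : MeasurableSet (goodSet T c R) := by
  refine IsClosed.measurableSet ?_
  rw [goodSet, Set.ofPred_and]
  refine (isClosed_le (by fun_prop) continuous_const).inter ?_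
  simp only [Set.ofPred_forall]
  refine isClosed_iInter fun r => isClosed_iInter fun _ => ?_
  exact isClosed_le continuous_const (by fun_prop)

theorem goodSet_anti {T c : ℝ} {R R' : Multiset ℂ} (h : R ≤ R') :
    goodSet T c R' ⊆ goodSet T c R :=
  fun _ hx => ⟨hx.1, fun r hr => hx.2 r (Multiset.mem_of_le h hr)⟩

variable {α q C₁ C₂ : ℝ}

theorem TameLaw.measure_near_le {μ : Measure ℝ} (hμ : TameLaw α q C₁ C₂ μ) {c : ℝ} (hc : 0 < c)
    (R : Multiset ℂ) : μ {x : ℝ | ∃ r ∈ R, ‖(x : ℂ) - r‖ < c} ≤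
      R.card * ENNReal.ofReal (C₁ * c ^ α) := by
  induction R using Multiset.induction with
  | empty => simp
  | cons a R ih =>
    have : {x : ℝ | ∃ r ∈ a ::ₘ R, ‖(x : ℂ) - r‖ < c} ⊆
        Set.Icc (a.re - c) (a.re + c) ∪ {x : ℝ | ∃ r ∈ R, ‖(x : ℂ) - r‖ < c} := by
      rintro x ⟨r, hr, hx⟩
      rcases Multiset.mem_cons.1 hr with rfl | hr
      · left
        have h1 := (Complex.abs_re_le_norm ((x : ℂ) - r)).trans hx.le
        simp only [Complex.sub_re, Complex.ofReal_re] at h1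
        rw [abs_le] at h1
        constructor <;> linarith [h1.1, h1.2]
      · exact Or.inr ⟨r, hr, hx⟩
    refine (measure_mono this).trans ((measure_union_le _ _).trans ?_)
    rw [Multiset.card_cons, Nat.cast_add, Nat.cast_one, add_mul, one_mul, add_comm]
    exact add_le_add ih (hμ.regular c hc a.re)

/-- Markov's inequality for large |x| and a union bound over the points each lose at most 1/4. The
thresholds depend on the number of points but not on their position nor on the particular law. -/
theorem exists_goodSet (hα : 0 < α) (hq : 0 < q) (hC₁ : 0 ≤ C₁) (hC₂ : 0 ≤ C₂) (N : ℕ) :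
    ∃ T c : ℝ, 1 ≤ T ∧ 0 < c ∧ c ≤ 1 ∧ ∀ (μ : Measure ℝ) [IsProbabilityMeasure μ],
      TameLaw α q C₁ C₂ μ → ∀ R : Multiset ℂ, R.card ≤ N → 1 / 2 ≤ μ (goodSet T c R) := by
  set T : ℝ := (4 * C₂ + 1) ^ q⁻¹ with hT
  set c : ℝ := (4 * (N * C₁ + 1))⁻¹ ^ α⁻¹ with hc
  have hTq : T ^ q = 4 * C₂ + 1 := by rw [hT, Real.rpow_inv_rpow (by positivity) hq.ne']
  have hcα : c ^ α = (4 * (N * C₁ + 1))⁻¹ := by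
    rw [hc, Real.rpow_inv_rpow (by positivity) hα.ne']
  have hNC : 0 ≤ N * C₁ := by positivity
  refine ⟨T, c, Real.one_le_rpow (by linarith) (by positivity), by positivity,
    Real.rpow_le_one (by positivity) (inv_le_one_of_one_le₀ (by linarith)) (by positivity), ?_⟩
  intro μ _ hμ R hR
  have hc0 : 0 < c := by positivity
  have hT0 : 0 < T := by positivity
  have h1 : μ {x : ℝ | T ≤ |x|} ≤ ENNReal.ofReal (1 / 4) := by
    have h2 := mul_meas_ge_le_lintegral (μ := μ) (f := fun x : ℝ => ENNReal.ofReal (|x| ^ q))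
      (by fun_prop) (ENNReal.ofReal (T ^ q))
    have h3 : μ {x : ℝ | T ≤ |x|} ≤
        μ {x : ℝ | ENNReal.ofReal (T ^ q) ≤ ENNReal.ofReal (|x| ^ q)} := by
      refine measure_mono fun x hx => ENNReal.ofReal_le_ofReal ?_
      have : T ≤ |x| := hx
      gcongr
    have h4 := ((mul_le_mul_right h3 (ENNReal.ofReal (T ^ q))).trans h2).trans hμ.moment
    rw [hTq, mul_comm, ← ENNReal.le_div_iff_mul_le
      (Or.inl (by rw [ne_eq, ENNReal.ofReal_eq_zero]; linarith)) (Or.inl ENNReal.ofReal_ne_top),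
      ← ENNReal.ofReal_div_of_pos (by linarith)] at h4
    refine h4.trans (ENNReal.ofReal_le_ofReal ?_)
    rw [div_le_iff₀ (by linarith)]
    linarith
  have h2 : μ {x : ℝ | ∃ r ∈ R, ‖(x : ℂ) - r‖ < c} ≤ ENNReal.ofReal (1 / 4) := by
    refine (hμ.measure_near_le hc0 R).trans ?_
    rw [hcα, ← ENNReal.ofReal_natCast, ← ENNReal.ofReal_mul (by positivity)]
    refine ENNReal.ofReal_le_ofReal ?_
    have h3 : (R.card : ℝ) ≤ N := by exact_mod_cast hR
    calc (R.card : ℝ) * (C₁ * (4 * (N * C₁ + 1))⁻¹) ≤ N * (C₁ * (4 * (N * C₁ + 1))⁻¹) := by gcongr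
      _ ≤ 1 / 4 := by
        rw [← mul_assoc, ← div_eq_mul_inv, div_le_iff₀ (by positivity)]
        linarith
  have h3 : (Set.univ : Set ℝ) ⊆ goodSet T c R ∪ ({x : ℝ | T ≤ |x|} ∪
      {x : ℝ | ∃ r ∈ R, ‖(x : ℂ) - r‖ < c}) := by
    intro x _
    by_cases hx : x ∈ goodSet T c R
    · exact Or.inl hx
    · right
      by_cases hx1 : T ≤ |x|
      · exact Or.inl hx1
      · right
        by_contra hx2
        refine hx ⟨(not_le.1 hx1).le, fun r hr => ?_⟩
        by_contra hx3
        exact hx2 ⟨r, hr, not_le.1 hx3⟩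
  have h4 := ((measure_mono h3).trans (measure_union_le _ _)).trans
    (add_le_add le_rfl ((measure_union_le _ _).trans (add_le_add h1 h2)))
  rw [measure_univ, ← ENNReal.ofReal_add (by norm_num) (by norm_num)] at h4
  have h5 : ENNReal.ofReal (1 / 4 + 1 / 4) = 1 / 2 := by
    rw [show (1 / 4 + 1 / 4 : ℝ) = 2⁻¹ by norm_num, ENNReal.ofReal_inv_of_pos (by norm_num)]
    simp
  rw [h5] at h4
  have h6 : (1 : ℝ≥0∞) / 2 + 1 / 2 ≤ μ (goodSet T c R) + 1 / 2 := by
    rwa [ENNReal.add_halves]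
  exact (ENNReal.add_le_add_iff_right (by simp)).1 h6

/-- On the good set 1 + |r| ≤ 1 + T + |x - r|, and 1 + T ≤ |x - r|(1 + T)/c because |x - r| ≥ c. -/
theorem Polynomial.le_norm_eval_of_mem_goodSet {P : ℂ[X]} {k : ℕ} (hk : P.natDegree ≤ k)
    {T c : ℝ} (hT : 1 ≤ T) (hc : 0 < c) {x : ℝ} (hx : x ∈ goodSet T c P.roots) :
    P.rootHeight ≤ ‖P.eval (x : ℂ)‖ * ((1 + T) / c + 1) ^ k := by
  rw [P.norm_eval_eq, Polynomial.rootHeight, mul_assoc]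
  refine mul_le_mul_of_nonneg_left ?_ (norm_nonneg _)
  have hb : 1 ≤ (1 + T) / c + 1 := by
    have : 0 ≤ (1 + T) / c := by positivity
    linarith
  calc (P.roots.map fun r => 1 + ‖r‖).prod
      ≤ (P.roots.map fun r => ‖(x : ℂ) - r‖ * ((1 + T) / c + 1)).prod := by
        refine Multiset.prod_map_le_prod_map₀ _ _ (fun r _ => by positivity) fun r hr => ?_
        have h1 := hx.2 r hr
        have h2 : ‖r‖ ≤ |x| + ‖(x : ℂ) - r‖ := by
          simpa using norm_sub_le (x : ℂ) ((x : ℂ) - r)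
        have h3 : 1 + T ≤ ‖(x : ℂ) - r‖ * ((1 + T) / c) := by
          calc 1 + T = c * ((1 + T) / c) := by field_simp
            _ ≤ _ := by gcongr
        linarith [hx.1]
    _ = (P.roots.map fun r => ‖(x : ℂ) - r‖).prod * ((1 + T) / c + 1) ^ P.roots.card := by
        rw [Multiset.prod_map_mul, Multiset.map_const', Multiset.prod_replicate]
    _ ≤ _ := by
        refine mul_le_mul_of_nonneg_left (pow_le_pow_right₀ hb
          ((Polynomial.card_roots' P).trans hk)) ?_
        refine Multiset.prod_nonneg fun a ha => ?_
        obtain ⟨r, -, rfl⟩ := Multiset.mem_map.1 ha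
        positivity

/-- A pointwise bound for a product of small powers by a sum. -/
theorem rpow_prod_le_sum {k : ℕ} {q t s a : ℝ} (hq : 0 < q) (ht : 0 < t) (hs : 0 < s)
    (hst : s * (k / q + k / t) = 1) (ha : 0 ≤ a) {ι : Type*} (S : Multiset ι) (hS : S.card ≤ k)
    (X : ι → ℝ) (hX : ∀ i, 0 ≤ X i) :
    (a ^ k * (S.map X).prod) ^ s ≤ 1 + a ^ q + (S.map fun i => X i ^ t).sum := by
  set m := 1 + a ^ q + (S.map fun i => X i ^ t).sum with hm
  have hsum : 0 ≤ (S.map fun i => X i ^ t).sum := by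
    refine Multiset.sum_nonneg fun b hb => ?_
    obtain ⟨i, -, rfl⟩ := Multiset.mem_map.1 hb
    exact Real.rpow_nonneg (hX i) t
  have haq : 0 ≤ a ^ q := by positivity
  have hm1 : 1 ≤ m := by linarith
  have hm0 : 0 < m := by linarith
  -- The sum m dominates every single power, so the product is at most m^(k/q + k/t), and the
  -- relation on s brings this back to m. Having m ≥ 1 permits fewer than k factors.
  have h1 : a ≤ m ^ q⁻¹ := by
    rw [Real.le_rpow_inv_iff_of_pos ha hm0.le hq]
    linarith
  have h2 : ∀ i ∈ S, X i ≤ m ^ t⁻¹ := by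
    intro i hi
    rw [Real.le_rpow_inv_iff_of_pos (hX i) hm0.le ht]
    have : X i ^ t ≤ (S.map fun i => X i ^ t).sum := by
      refine Multiset.single_le_sum (fun b hb => ?_) _ (Multiset.mem_map_of_mem _ hi)
      obtain ⟨i, -, rfl⟩ := Multiset.mem_map.1 hb
      exact Real.rpow_nonneg (hX i) t
    linarith
  have h3 : (S.map X).prod ≤ (m ^ t⁻¹) ^ k :=
    Multiset.prod_map_le_pow (fun i _ => hX i) h2 (Real.one_le_rpow hm1 (by positivity)) hS
  have h4 : 0 ≤ (S.map X).prod := Multiset.prod_nonneg fun b hb => by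
    obtain ⟨i, -, rfl⟩ := Multiset.mem_map.1 hb
    exact hX i
  calc (a ^ k * (S.map X).prod) ^ s ≤ ((m ^ q⁻¹) ^ k * (m ^ t⁻¹) ^ k) ^ s := by gcongr
    _ = m ^ (1 : ℝ) := by
      rw [← Real.rpow_natCast, ← Real.rpow_natCast, ← Real.rpow_mul hm0.le,
        ← Real.rpow_mul hm0.le, ← Real.rpow_add hm0, ← Real.rpow_mul hm0.le, ← hst]
      congr 1
      field_simp
    _ = m := Real.rpow_one m

theorem lintegral_multiset_sum_le {X : Type*} [MeasurableSpace X] {μ : Measure X} {ι : Type*}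
    (S : Multiset ι) (f : ι → X → ℝ) (hf : ∀ i, Measurable (f i)) (hf0 : ∀ i x, 0 ≤ f i x)
    {C : ℝ≥0∞} (h : ∀ i, ∫⁻ x, ENNReal.ofReal (f i x) ∂μ ≤ C) :
    ∫⁻ x, ENNReal.ofReal (S.map fun i => f i x).sum ∂μ ≤ S.card * C := by
  induction S using Multiset.induction with
  | empty => simp
  | cons a S ih =>
    have hS : ∀ x, 0 ≤ (S.map fun i => f i x).sum := fun x =>
      Multiset.sum_nonneg fun b hb => by
        obtain ⟨i, -, rfl⟩ := Multiset.mem_map.1 hb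
        exact hf0 i x
    simp only [Multiset.map_cons, Multiset.sum_cons, Multiset.card_cons, Nat.cast_add,
      Nat.cast_one, add_mul, one_mul]
    simp only [ENNReal.ofReal_add (hf0 a _) (hS _)]
    rw [lintegral_add_left (hf a).ennreal_ofReal, add_comm]
    exact add_le_add ih (h a)

/-- The fractional moment of a rational function is controlled by its contribution from a typical
set, uniformly in the rational function. -/
theorem exists_decoupling (hα : 0 < α) (hq : 0 < q) (hC₁ : 0 ≤ C₁) (hC₂ : 0 ≤ C₂) {k : ℕ}
    {s : ℝ} (hs : 0 < s) (hsk : s * (k * (2 / q + 1 / α)) = 1) :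
    ∃ T c C : ℝ, 1 ≤ T ∧ 0 < c ∧ c ≤ 1 ∧ 0 < C ∧ ∀ (μ : Measure ℝ) [IsProbabilityMeasure μ],
      TameLaw α q C₁ C₂ μ → ∀ P Q : ℂ[X], P.natDegree ≤ k → Q.natDegree ≤ k → Q ≠ 0 →
      ∀ R : Multiset ℂ, R.card ≤ k →
        ∫⁻ x : ℝ, ENNReal.ofReal ((‖P.eval (x : ℂ)‖ / ‖Q.eval (x : ℂ)‖) ^ s) ∂μ ≤
          ENNReal.ofReal C * ∫⁻ x : ℝ in goodSet T c R,
            ENNReal.ofReal ((‖P.eval (x : ℂ)‖ / ‖Q.eval (x : ℂ)‖) ^ s) ∂μ := by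
  -- The count 3k leaves room for `R`, the zeros of P and the zeros of Q at once.
  obtain ⟨T, c, hT, hc, hc1, hgood⟩ := exists_goodSet hα hq hC₁ hC₂ (3 * k)
  set t := α * q / (α + q) with ht_def
  have ht : 0 < t := by positivity
  have hst : s * (k / q + k / t) = 1 := by
    rw [← hsk, ht_def]; field_simp; ring
  set D : ℝ := 4 ^ t + (4 ^ q + 8 ^ q * C₂) + C₁ * 2 ^ t * (1 - 2 ^ (t - α))⁻¹ with hD
  have hgeo : 0 < 1 - (2 : ℝ) ^ (t - α) := by
    have : t < α := by rw [ht_def, div_lt_iff₀ (by positivity)]; nlinarith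
    have := Real.rpow_lt_one_of_one_lt_of_neg (by norm_num : (1 : ℝ) < 2)
      (by linarith : t - α < 0)
    linarith
  have hD0 : 0 < D := by positivity
  set D' : ℝ := 1 + (4 ^ q + 8 ^ q * C₂) + k * D with hD'
  have hD'0 : 0 < D' := by positivity
  -- The loss on the good set: one factor from bounding P below by its root height, the other from
  -- bounding Q above.
  set κ : ℝ := ((1 + T) / c + 1) ^ k * (1 + T) ^ k with hκ
  have hκ0 : 0 < κ := by positivity
  refine ⟨T, c, 2 * (D' * κ ^ s), hT, hc, hc1, by positivity, ?_⟩
  intro μ _ hμ P Q hP hQ hQ0 R hR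
  by_cases hP0 : P = 0
  · simp [hP0, Real.zero_rpow hs.ne']
  have hhP := rootHeight_pos hP0
  have hhQ := rootHeight_pos hQ0
  set ratio := P.rootHeight / Q.rootHeight with hratio
  have hratio0 : 0 < ratio := by positivity
  -- The leading coefficients and the root sizes factor out as `ratio`; the integrand left over is
  -- bounded by a sum of terms with known moments.
  have hupper : ∫⁻ x : ℝ, ENNReal.ofReal ((‖P.eval (x : ℂ)‖ / ‖Q.eval (x : ℂ)‖) ^ s) ∂μ ≤
      ENNReal.ofReal (ratio ^ s * D') := by
    have hpt : ∀ x : ℝ, ENNReal.ofReal ((‖P.eval (x : ℂ)‖ / ‖Q.eval (x : ℂ)‖) ^ s) ≤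
        ENNReal.ofReal (ratio ^ s) * (1 + ENNReal.ofReal ((4 * |x| + 2) ^ q) +
          ENNReal.ofReal (Q.roots.map fun r => ((1 + ‖r‖) / ‖(x : ℂ) - r‖) ^ t).sum) := by
      intro x
      have hx := abs_nonneg x
      have h1 := rpow_prod_le_sum hq ht hs hst (by positivity : 0 ≤ 1 + |x|) Q.roots
        ((card_roots' Q).trans hQ) (fun r => (1 + ‖r‖) / ‖(x : ℂ) - r‖)
        (fun r => by positivity)
      have h0 : 0 ≤ (Q.roots.map fun r => (1 + ‖r‖) / ‖(x : ℂ) - r‖).prod :=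
        Multiset.prod_nonneg fun b hb => by
          obtain ⟨i, -, rfl⟩ := Multiset.mem_map.1 hb
          positivity
      have h0' : 0 ≤ (Q.roots.map fun r => ((1 + ‖r‖) / ‖(x : ℂ) - r‖) ^ t).sum :=
        Multiset.sum_nonneg fun b hb => by
          obtain ⟨i, -, rfl⟩ := Multiset.mem_map.1 hb
          positivity
      have h2 : ‖P.eval (x : ℂ)‖ / ‖Q.eval (x : ℂ)‖ ≤ ratio *
          ((1 + |x|) ^ k * (Q.roots.map fun r => (1 + ‖r‖) / ‖(x : ℂ) - r‖).prod) := by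
        rw [div_eq_mul_inv, Q.inv_norm_eval_eq hQ0]
        calc _ ≤ P.rootHeight * (1 + |x|) ^ k * (Q.rootHeight⁻¹ *
              (Q.roots.map fun r => (1 + ‖r‖) / ‖(x : ℂ) - r‖).prod) := by
              gcongr
              exact norm_eval_le_rootHeight hP x
          _ = _ := by rw [hratio]; ring
      rw [← ENNReal.ofReal_one, ← ENNReal.ofReal_add (by positivity) (by positivity),
        ← ENNReal.ofReal_add (by positivity) h0', ← ENNReal.ofReal_mul (by positivity)]
      refine ENNReal.ofReal_le_ofReal ?_
      calc _ ≤ (ratio * ((1 + |x|) ^ k *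
            (Q.roots.map fun r => (1 + ‖r‖) / ‖(x : ℂ) - r‖).prod)) ^ s := by gcongr
        _ = ratio ^ s * ((1 + |x|) ^ k *
            (Q.roots.map fun r => (1 + ‖r‖) / ‖(x : ℂ) - r‖).prod) ^ s :=
          Real.mul_rpow hratio0.le (by positivity)
        _ ≤ _ := by
          gcongr
          have h5 : (1 + |x|) ^ q ≤ (4 * |x| + 2) ^ q :=
            Real.rpow_le_rpow (by positivity) (by linarith) hq.le
          linarith
    refine (lintegral_mono hpt).trans ?_
    rw [lintegral_const_mul' _ _ ENNReal.ofReal_ne_top, lintegral_add_left (by fun_prop),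
      lintegral_add_left measurable_const, lintegral_const, measure_univ, mul_one,
      ENNReal.ofReal_mul (by positivity), hD', ENNReal.ofReal_add (by positivity) (by positivity),
      ENNReal.ofReal_add (by positivity) (by positivity), ENNReal.ofReal_one]
    gcongr
    · exact hμ.moment_affine hC₂ hq
    · refine (lintegral_multiset_sum_le Q.roots
        (fun r (x : ℝ) => ((1 + ‖r‖) / ‖(x : ℂ) - r‖) ^ t) (fun r => by fun_prop)
        (fun r x => by positivity)
        (fun r => hμ.lintegral_inv_le hC₁ hC₂ hα hq r)).trans ?_
      rw [ENNReal.ofReal_mul (by positivity), ENNReal.ofReal_natCast]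
      gcongr
      exact (card_roots' Q).trans hQ
  -- Deleting neighbourhoods of the zeros of P and Q as well only shrinks the set, and still leaves
  -- probability 1/2 on which |P/Q| is at least ratio/κ.
  have hlower : ENNReal.ofReal ((ratio / κ) ^ s) * (1 / 2) ≤ ∫⁻ x : ℝ in goodSet T c R,
      ENNReal.ofReal ((‖P.eval (x : ℂ)‖ / ‖Q.eval (x : ℂ)‖) ^ s) ∂μ := by
    have hcard : (R + P.roots + Q.roots).card ≤ 3 * k := by
      rw [Multiset.card_add, Multiset.card_add]
      have := (card_roots' P).trans hP
      have := (card_roots' Q).trans hQ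
      omega
    have hsub : goodSet T c (R + P.roots + Q.roots) ⊆ goodSet T c R :=
      goodSet_anti (by rw [add_assoc]; exact Multiset.le_add_right _ _)
    calc ENNReal.ofReal ((ratio / κ) ^ s) * (1 / 2)
        ≤ ENNReal.ofReal ((ratio / κ) ^ s) * μ (goodSet T c (R + P.roots + Q.roots)) := by
          gcongr
          exact hgood μ hμ _ hcard
      _ = ∫⁻ x : ℝ in goodSet T c (R + P.roots + Q.roots), ENNReal.ofReal ((ratio / κ) ^ s) ∂μ := by
          rw [setLIntegral_const]
      _ ≤ ∫⁻ x : ℝ in goodSet T c (R + P.roots + Q.roots),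
          ENNReal.ofReal ((‖P.eval (x : ℂ)‖ / ‖Q.eval (x : ℂ)‖) ^ s) ∂μ := by
          refine setLIntegral_mono' (measurableSet_goodSet _ _ _) fun x hx => ?_
          refine ENNReal.ofReal_le_ofReal ?_
          have hxP : x ∈ goodSet T c P.roots :=
            goodSet_anti ((Multiset.le_add_left _ _).trans (Multiset.le_add_right _ _)) hx
          have hxQ : x ∈ goodSet T c Q.roots := goodSet_anti (Multiset.le_add_left _ _) hx
          have h1 := le_norm_eval_of_mem_goodSet hP hT hc hxP
          have h2 := le_norm_eval_of_mem_goodSet hQ hT hc hxQ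
          have h3 := norm_eval_le_rootHeight hQ x
          have hQpos : 0 < ‖Q.eval (x : ℂ)‖ := by
            have : 0 < ‖Q.eval (x : ℂ)‖ * ((1 + T) / c + 1) ^ k := hhQ.trans_le h2
            exact pos_of_mul_pos_left this (by positivity)
          have h4 : (1 + |x|) ^ k ≤ (1 + T) ^ k := by
            have := hx.1
            gcongr
          refine Real.rpow_le_rpow (by positivity) ?_ hs.le
          rw [hratio, div_div, div_le_div_iff₀ (by positivity) hQpos]
          calc P.rootHeight * ‖Q.eval (x : ℂ)‖ ≤ (‖P.eval (x : ℂ)‖ * ((1 + T) / c + 1) ^ k) *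
                (Q.rootHeight * (1 + T) ^ k) := by
                gcongr
                exact h3.trans (by gcongr)
            _ = _ := by rw [hκ]; ring
      _ ≤ _ := lintegral_mono_set hsub
  calc _ ≤ ENNReal.ofReal (ratio ^ s * D') := hupper
    _ = ENNReal.ofReal (2 * (D' * κ ^ s)) * (ENNReal.ofReal ((ratio / κ) ^ s) * (1 / 2)) := by
      have : (1 / 2 : ℝ≥0∞) = ENNReal.ofReal (2⁻¹) := by
        rw [ENNReal.ofReal_inv_of_pos (by norm_num)]; simp
      rw [this, ← ENNReal.ofReal_mul (by positivity), ← ENNReal.ofReal_mul (by positivity)]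
      congr 1
      rw [Real.div_rpow hratio0.le hκ0.le]
      field_simp
    _ ≤ _ := by gcongr

end Rational

/-! ### Decoupling at a single site -/

section Site

open Polynomial

variable {k : ℕ}

theorem rpow_sum_le_sum_rpow {ι : Type*} (S : Finset ι) {f : ι → ℝ} (hf : ∀ i, 0 ≤ f i) {s : ℝ}
    (hs : 0 < s) (hs1 : s ≤ 1) : (∑ i ∈ S, f i) ^ s ≤ ∑ i ∈ S, f i ^ s := by
  classical
  induction S using Finset.induction_on with
  | empty => simp [Real.zero_rpow hs.ne']
  | insert a S ha ih =>
    rw [Finset.sum_insert ha, Finset.sum_insert ha]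
    exact (Real.rpow_add_le_add_rpow (hf a) (Finset.sum_nonneg fun i _ => hf i) hs.le hs1).trans
      (by gcongr)

theorem norm_le_sum_norm_apply (u : Spin k) : ‖u‖ ≤ ∑ i, ‖u i‖ := by
  rw [EuclideanSpace.norm_eq]
  refine Real.sqrt_le_iff.2 ⟨by positivity, ?_⟩
  exact Finset.sum_sq_le_sq_sum_of_nonneg fun i _ => norm_nonneg _

theorem Matrix.norm_apply_le_l2 (N : Matrix (Fin k) (Fin k) ℂ) (i j : Fin k) : ‖N i j‖ ≤ ‖N‖ := by
  have h1 := norm_toEuclideanLin_le N (EuclideanSpace.single j (1 : ℂ))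
  have h2 := PiLp.norm_apply_le (Matrix.toEuclideanLin N (EuclideanSpace.single j (1 : ℂ))) i
  rw [PiLp.norm_single, norm_one, mul_one] at h1
  refine le_trans (le_of_eq ?_) (h2.trans h1)
  simp [Matrix.toLpLin_apply]

theorem Matrix.norm_det_le (N : Matrix (Fin k) (Fin k) ℂ) {b : ℝ} (hb : ∀ i j, ‖N i j‖ ≤ b) :
    ‖N.det‖ ≤ k.factorial * b ^ k := by
  have := Matrix.det_le (A := N) (abv := NormedField.toAbsoluteValue ℂ) (x := b) hb
  rw [Fintype.card_fin, nsmul_eq_mul] at this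
  exact this

theorem Matrix.norm_adjugate_apply_le (N : Matrix (Fin k) (Fin k) ℂ) {b : ℝ} (h1 : 1 ≤ b)
    (hb : ∀ i j, ‖N i j‖ ≤ b) (i j : Fin k) : ‖N.adjugate i j‖ ≤ k.factorial * b ^ k := by
  rw [Matrix.adjugate_apply]
  refine Matrix.norm_det_le _ fun i' j' => ?_
  rw [Matrix.updateRow_apply]
  split_ifs with h
  · by_cases h2 : j' = i
    · subst h2; simpa using h1
    · rw [Pi.single_eq_of_ne h2, norm_zero]; linarith
  · exact hb i' j'

theorem Matrix.det_smul_eq_adjugate (N : Matrix (Fin k) (Fin k) ℂ) (u : Spin k) :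
    N.det • u = Matrix.toEuclideanLin N.adjugate (Matrix.toEuclideanLin N u) := by
  ext i
  simp only [Matrix.toLpLin_apply, Matrix.mulVec_mulVec, Matrix.adjugate_mul,
    Matrix.smul_mulVec, Matrix.one_mulVec]
  rfl

/-- The adjugate replaces the inverse, so a lower bound for the determinant becomes a lower bound
for N without any inversion. -/
theorem Matrix.norm_det_mul_norm_le (N : Matrix (Fin k) (Fin k) ℂ) {b : ℝ} (h1 : 1 ≤ b)
    (hb : ∀ i j, ‖N i j‖ ≤ b) (u : Spin k) :
    ‖N.det‖ * ‖u‖ ≤ k * (k * (k.factorial * b ^ k)) * ‖Matrix.toEuclideanLin N u‖ := by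
  set y := Matrix.toEuclideanLin N u with hy
  rw [← norm_smul, N.det_smul_eq_adjugate, ← hy]
  refine (norm_le_sum_norm_apply _).trans ?_
  have h2 : ∀ i, ‖Matrix.toEuclideanLin N.adjugate y i‖ ≤ k * (k.factorial * b ^ k) * ‖y‖ := by
    intro i
    have h3 : Matrix.toEuclideanLin N.adjugate y i = ∑ j, N.adjugate i j * y j := rfl
    rw [h3]
    calc ‖∑ j, N.adjugate i j * y j‖ ≤ ∑ j : Fin k, (k.factorial * b ^ k) * ‖y‖ := by
          refine (norm_sum_le _ _).trans (Finset.sum_le_sum fun j _ => ?_)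
          rw [norm_mul]
          exact mul_le_mul (N.norm_adjugate_apply_le h1 hb i j) (PiLp.norm_apply_le y j)
            (norm_nonneg _) (by positivity)
      _ = _ := by simp [mul_assoc]
  refine (Finset.sum_le_sum fun i _ => h2 i).trans (le_of_eq ?_)
  simp [mul_assoc]

theorem toEuclideanLin_site (A B : Matrix (Fin k) (Fin k) ℂ) (t : ℝ) (z : ℂ) (u : Spin k) :
    Matrix.toEuclideanLin ((t : ℂ) • A + B) u - z • u =
      Matrix.toEuclideanLin ((t : ℂ) • A + B - z • 1) u := by
  simp only [map_sub, map_smul, LinearMap.sub_apply, LinearMap.smul_apply]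
  congr 2
  simp

/-- Off finitely many energies, `t A + B - z` is invertible, with a bound on the inverse. -/
theorem exists_site_lower_bound (k : ℕ) {CB1 CB2 T c : ℝ} (h1 : 0 ≤ CB1) (h2 : 0 ≤ CB2)
    (hT : 1 ≤ T) (hc : 0 < c) (hc1 : c ≤ 1) :
    ∃ C : ℝ, 0 < C ∧ ∀ A B : Matrix (Fin k) (Fin k) ℂ, IsUnit A → ‖A‖ ≤ CB1 → ‖A⁻¹‖ ≤ CB1 →
      ‖B‖ ≤ CB2 → ∀ (z : ℂ) (t : ℝ), t ∈ goodSet T c (A⁻¹ * (z • 1 - B)).charpoly.roots →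
      ∀ u : Spin k, (1 + ‖z‖) * ‖u‖ ≤
        C * ‖Matrix.toEuclideanLin ((t : ℂ) • A + B) u - z • u‖ := by
  set Y := T * CB1 + CB2 with hY
  have hY0 : 0 ≤ Y := by positivity
  set K := (2 * Y + 2) * (k.factorial * CB1 ^ k * (k * (k * (k.factorial * (3 * Y + 1) ^ k))) /
    c ^ k) with hK
  have hK0 : 0 ≤ K := by positivity
  refine ⟨4 + K, by linarith, ?_⟩
  intro A B hA hAn hAi hB z t ht u
  have hnorm : ‖(t : ℂ) • A + B‖ ≤ Y := by
    refine (norm_add_le _ _).trans ?_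
    rw [norm_smul, Complex.norm_real, Real.norm_eq_abs, hY]
    gcongr
    exact ht.1
  set y := Matrix.toEuclideanLin ((t : ℂ) • A + B) u - z • u with hy
  -- `Y` bounds ‖tA + B‖. For |z| ≥ 2Y + 1 the term zu dominates, since |z| - Y ≥ (1 + |z|)/2; for
  -- smaller z, 1 + |z| is bounded and only invertibility matters.
  rcases le_or_gt (2 * Y + 1) ‖z‖ with hz | hz
  · have h3 : ‖z‖ * ‖u‖ ≤ Y * ‖u‖ + ‖y‖ := by
      have h4 : z • u = Matrix.toEuclideanLin ((t : ℂ) • A + B) u - y := by rw [hy]; abel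
      rw [← norm_smul, h4]
      refine (norm_sub_le _ _).trans ?_
      gcongr
      exact (norm_toEuclideanLin_le _ _).trans (by gcongr)
    have := norm_nonneg u
    have := norm_nonneg y
    nlinarith [mul_nonneg hK0 (norm_nonneg y)]
  · set N := (t : ℂ) • A + B - z • 1 with hN
    have hyN : y = Matrix.toEuclideanLin N u := toEuclideanLin_site A B t z u
    have hAdet : IsUnit A.det := (Matrix.isUnit_iff_isUnit_det A).1 hA
    -- Factoring out A makes the determinant a monic characteristic polynomial in t, so distance c
    -- from its k roots gives the lower bound c^k.
    have hNfac : N = A * (Matrix.scalar (Fin k) (t : ℂ) - A⁻¹ * (z • 1 - B)) := by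
      rw [mul_sub, ← mul_assoc, Matrix.mul_nonsing_inv A hAdet, one_mul, hN]
      simp [← Matrix.smul_one_eq_diagonal]
      abel
    have hNdet : N.det = A.det * (A⁻¹ * (z • 1 - B)).charpoly.eval (t : ℂ) := by
      rw [hNfac, Matrix.det_mul, Matrix.eval_charpoly]
    have hF : c ^ k ≤ ‖(A⁻¹ * (z • 1 - B)).charpoly.eval (t : ℂ)‖ := by
      set F := (A⁻¹ * (z • 1 - B)).charpoly with hFdef
      have hmon : F.Monic := Matrix.charpoly_monic _
      have hdeg : F.natDegree = k := by
        rw [hFdef, Matrix.charpoly_natDegree_eq_dim, Fintype.card_fin]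
      rw [F.norm_eval_eq, hmon.leadingCoeff, norm_one, one_mul]
      calc c ^ k ≤ c ^ F.roots.card :=
            pow_le_pow_of_le_one hc.le hc1 ((card_roots' F).trans hdeg.le)
        _ = (F.roots.map fun _ => c).prod := by rw [Multiset.map_const', Multiset.prod_replicate]
        _ ≤ _ := Multiset.prod_map_le_prod_map₀ _ _ (fun _ _ => hc.le) fun r hr => ht.2 r hr
    have hAlow : 1 ≤ ‖A.det‖ * (k.factorial * CB1 ^ k) := by
      have h3 : A.det * A⁻¹.det = 1 := by
        rw [← Matrix.det_mul, Matrix.mul_nonsing_inv A hAdet, Matrix.det_one]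
      have h4 : ‖A.det‖ * ‖A⁻¹.det‖ = 1 := by rw [← norm_mul, h3, norm_one]
      rw [← h4]
      gcongr
      exact Matrix.norm_det_le _ fun i j => (Matrix.norm_apply_le_l2 _ i j).trans hAi
    have hNent : ∀ i j, ‖N i j‖ ≤ 3 * Y + 1 := by
      intro i j
      have h3 : ‖(z • (1 : Matrix (Fin k) (Fin k) ℂ)) i j‖ ≤ ‖z‖ := by
        rw [Matrix.smul_apply, Matrix.one_apply]
        split_ifs <;> simp
      have h4 : ‖((t : ℂ) • A + B) i j‖ ≤ Y := (Matrix.norm_apply_le_l2 _ i j).trans hnorm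
      rw [hN, Matrix.sub_apply]
      refine (norm_sub_le _ _).trans ?_
      linarith
    have hmain := N.norm_det_mul_norm_le (by linarith) hNent u
    rw [← hyN, hNdet, norm_mul] at hmain
    have hu : c ^ k * ‖u‖ ≤
        k.factorial * CB1 ^ k * (k * (k * (k.factorial * (3 * Y + 1) ^ k))) * ‖y‖ := by
      calc c ^ k * ‖u‖ ≤ ‖(A⁻¹ * (z • 1 - B)).charpoly.eval (t : ℂ)‖ * ‖u‖ * 1 := by
            rw [mul_one]; gcongr
        _ ≤ ‖(A⁻¹ * (z • 1 - B)).charpoly.eval (t : ℂ)‖ * ‖u‖ *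
            (‖A.det‖ * (k.factorial * CB1 ^ k)) := by gcongr
        _ = k.factorial * CB1 ^ k * (‖A.det‖ * ‖(A⁻¹ * (z • 1 - B)).charpoly.eval (t : ℂ)‖ *
            ‖u‖) := by ring
        _ ≤ k.factorial * CB1 ^ k * (k * (k * (k.factorial * (3 * Y + 1) ^ k)) * ‖y‖) := by gcongr
        _ = _ := by ring
    have hu2 : ‖u‖ ≤ k.factorial * CB1 ^ k * (k * (k * (k.factorial * (3 * Y + 1) ^ k))) /
        c ^ k * ‖y‖ := by
      rw [div_mul_eq_mul_div, le_div_iff₀ (by positivity), mul_comm ‖u‖]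
      exact hu
    calc (1 + ‖z‖) * ‖u‖ ≤ (2 * Y + 2) * (k.factorial * CB1 ^ k *
          (k * (k * (k.factorial * (3 * Y + 1) ^ k))) / c ^ k * ‖y‖) := by
          refine mul_le_mul (by linarith) hu2 (norm_nonneg _) (by linarith)
      _ = K * ‖y‖ := by rw [hK]; ring
      _ ≤ (4 + K) * ‖y‖ := by
          have := norm_nonneg y
          nlinarith

theorem eval_det_X_smul_add (N N' : Matrix (Fin k) (Fin k) ℂ) (t : ℂ) :
    (Matrix.det ((X : ℂ[X]) • N.map C + N'.map C)).eval t = (t • N + N').det := by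
  rw [← coe_evalRingHom, RingHom.map_det]
  congr 1
  ext i j
  simp
  exact mul_comm _ _

/-- Solutions of a linear system that depends affinely on a parameter are rational functions. -/
theorem exists_rational_solution (L : Spin k →ₗ[ℂ] Spin k) (w : Spin k) :
    ∃ (P : Fin k → ℂ[X]) (Q : ℂ[X]), (∀ i, (P i).natDegree ≤ k) ∧ Q.natDegree ≤ k ∧ Q ≠ 0 ∧
      ∀ (t : ℂ) (u : Spin k), u + t • L u = w → ∀ i, Q.eval t * u i = (P i).eval t := by
  set N := Matrix.toEuclideanLin.symm L with hN
  have hL : L = Matrix.toEuclideanLin N := by rw [hN, LinearEquiv.apply_symm_apply]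
  -- Cramer's rule for (1 + tN)u = w. The i-th column of the t-part is zero in the numerator because
  -- that column is replaced by `w`, which does not depend on t.
  refine ⟨fun i => Matrix.det ((X : ℂ[X]) • (N.updateCol i 0).map C +
    ((1 : Matrix (Fin k) (Fin k) ℂ).updateCol i w.ofLp).map C),
    Matrix.det ((X : ℂ[X]) • N.map C + (1 : Matrix (Fin k) (Fin k) ℂ).map C),
    fun i => ?_, ?_, ?_, ?_⟩
  · simpa using natDegree_det_X_add_C_le (N.updateCol i 0)
      ((1 : Matrix (Fin k) (Fin k) ℂ).updateCol i w.ofLp)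
  · simpa using natDegree_det_X_add_C_le N (1 : Matrix (Fin k) (Fin k) ℂ)
  -- At t = 0 the denominator is det 1 = 1.
  · intro h
    have h1 := eval_det_X_smul_add N 1 0
    rw [h] at h1
    simp at h1
  · intro t u hu i
    rw [eval_det_X_smul_add, eval_det_X_smul_add]
    have h1 : (t • N + 1).mulVec u.ofLp = w.ofLp := by
      rw [← hu, hL, Matrix.add_mulVec, Matrix.one_mulVec, Matrix.smul_mulVec, add_comm]
      rfl
    have h2 : t • N.updateCol i 0 + (1 : Matrix (Fin k) (Fin k) ℂ).updateCol i w.ofLp =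
        (t • N + 1).updateCol i w.ofLp := by
      ext a b
      by_cases hb : b = i <;> simp [hb]
    rw [h2, ← Matrix.cramer_apply, Matrix.cramer_eq_adjugate_mulVec, ← h1, Matrix.mulVec_mulVec,
      Matrix.adjugate_mul, Matrix.smul_mulVec, Matrix.one_mulVec]
    rfl

variable {α q C₁ C₂ : ℝ}

/-- The fractional moment of a solution of a system depending affinely on the potential at a site
is bounded by the fractional moment of its image under `t A + B - z`. -/
theorem exists_site_decoupling (k : ℕ) (hα : 0 < α) (hq : 0 < q) (hC₁ : 0 ≤ C₁) (hC₂ : 0 ≤ C₂)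
    {CB1 CB2 : ℝ} (h1 : 0 ≤ CB1) (h2 : 0 ≤ CB2) {s : ℝ} (hs : 0 < s) (hs1 : s ≤ 1)
    (hsk : s * (k * (2 / q + 1 / α)) = 1) :
    ∃ K : ℝ, 0 < K ∧ ∀ (μ : Measure ℝ) [IsProbabilityMeasure μ], TameLaw α q C₁ C₂ μ →
      ∀ A B : Matrix (Fin k) (Fin k) ℂ, IsUnit A → ‖A‖ ≤ CB1 → ‖A⁻¹‖ ≤ CB1 → ‖B‖ ≤ CB2 →
      ∀ (z : ℂ) (L : Spin k →ₗ[ℂ] Spin k) (w : Spin k) (u : ℝ → Spin k),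
        (∀ t : ℝ, u t + (t : ℂ) • L (u t) = w) →
        ∫⁻ t, ENNReal.ofReal (‖u t‖ ^ s) ∂μ ≤ ENNReal.ofReal (K * (1 + ‖z‖) ^ (-s)) *
          ∫⁻ t, ENNReal.ofReal
            (‖Matrix.toEuclideanLin ((t : ℂ) • A + B) (u t) - z • u t‖ ^ s) ∂μ := by
  obtain ⟨T, c, C, hT, hc, hc1, hC, hdec⟩ := exists_decoupling hα hq hC₁ hC₂ hs hsk
  obtain ⟨C', hC', hlow⟩ := exists_site_lower_bound k h1 h2 hT hc hc1
  refine ⟨(k + 1) * C * C' ^ s, by positivity, ?_⟩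
  intro μ _ hμ A B hA hAn hAi hB z L w u hu
  obtain ⟨P, Q, hP, hQ, hQ0, hPQ⟩ := exists_rational_solution L w
  set R := (A⁻¹ * (z • 1 - B)).charpoly.roots with hR
  have hRk : R.card ≤ k := by
    refine (card_roots' _).trans (le_of_eq ?_)
    rw [Matrix.charpoly_natDegree_eq_dim, Fintype.card_fin]
  -- Regularity excludes atoms, so the finitely many zeros of Q are negligible.
  have hae : ∀ᵐ t : ℝ ∂μ, Q.eval (t : ℂ) ≠ 0 := by
    have hfin : {t : ℝ | Q.eval (t : ℂ) = 0}.Finite := by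
      refine Set.Finite.of_finite_image (f := fun t : ℝ => (t : ℂ)) ?_
        (Complex.ofReal_injective.injOn)
      refine (Q.rootSet_finite ℂ).subset ?_
      rintro _ ⟨t, ht, rfl⟩
      rw [mem_rootSet]
      exact ⟨hQ0, by simpa using ht⟩
    rw [ae_iff]
    simp only [not_not]
    rw [← Set.biUnion_of_singleton {t : ℝ | Q.eval (t : ℂ) = 0},
      measure_biUnion_null_iff hfin.countable]
    exact fun t _ => hμ.measure_singleton hα t
  have hfrac : ∀ᵐ t : ℝ ∂μ, ∀ i, ‖u t i‖ = ‖(P i).eval (t : ℂ)‖ / ‖Q.eval (t : ℂ)‖ := by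
    filter_upwards [hae] with t ht i
    rw [← hPQ t (u t) (hu t) i, norm_mul, mul_div_cancel_left₀ _ (norm_ne_zero_iff.2 ht)]
  have hz : 0 < 1 + ‖z‖ := by positivity
  -- `R` consists of the eigenvalues of A⁻¹(z - B), so on the good set the inverse of tA + B - z is
  -- under control. The decoupling then extends this to the integral over all t.
  have hgood : ∀ i, ∫⁻ t : ℝ in goodSet T c R,
      ENNReal.ofReal ((‖(P i).eval (t : ℂ)‖ / ‖Q.eval (t : ℂ)‖) ^ s) ∂μ ≤
      ENNReal.ofReal (C' ^ s * (1 + ‖z‖) ^ (-s)) * ∫⁻ t, ENNReal.ofReal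
        (‖Matrix.toEuclideanLin ((t : ℂ) • A + B) (u t) - z • u t‖ ^ s) ∂μ := by
    intro i
    rw [← lintegral_const_mul' _ _ ENNReal.ofReal_ne_top]
    refine le_trans ?_ (setLIntegral_le_lintegral (goodSet T c R) _)
    refine lintegral_mono_ae ?_
    filter_upwards [ae_restrict_of_ae hfrac, ae_restrict_mem (measurableSet_goodSet T c R)]
      with t ht hmem
    rw [← ht i, ← ENNReal.ofReal_mul (by positivity)]
    refine ENNReal.ofReal_le_ofReal ?_
    set y := Matrix.toEuclideanLin ((t : ℂ) • A + B) (u t) - z • u t with hy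
    have h3 : ‖u t‖ ≤ C' * (1 + ‖z‖)⁻¹ * ‖y‖ := by
      have := hlow A B hA hAn hAi hB z t hmem (u t)
      rw [mul_right_comm, ← div_eq_mul_inv, le_div_iff₀ hz, mul_comm]
      exact this
    calc ‖u t i‖ ^ s ≤ (C' * (1 + ‖z‖)⁻¹ * ‖y‖) ^ s :=
          Real.rpow_le_rpow (norm_nonneg _) ((PiLp.norm_apply_le _ _).trans h3) hs.le
      _ = _ := by
        rw [Real.mul_rpow (by positivity) (norm_nonneg _), Real.mul_rpow hC'.le (by positivity),
          Real.inv_rpow hz.le, Real.rpow_neg hz.le]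
  calc ∫⁻ t, ENNReal.ofReal (‖u t‖ ^ s) ∂μ
      ≤ ∫⁻ t, ∑ i, ENNReal.ofReal ((‖(P i).eval (t : ℂ)‖ / ‖Q.eval (t : ℂ)‖) ^ s) ∂μ := by
        refine lintegral_mono_ae ?_
        filter_upwards [hfrac] with t ht
        rw [← ENNReal.ofReal_sum_of_nonneg fun i _ => by positivity]
        refine ENNReal.ofReal_le_ofReal ?_
        simp only [← ht]
        refine (Real.rpow_le_rpow (norm_nonneg _) (norm_le_sum_norm_apply _) hs.le).trans ?_
        exact rpow_sum_le_sum_rpow _ (fun i => norm_nonneg _) hs hs1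
    _ = ∑ i, ∫⁻ t, ENNReal.ofReal ((‖(P i).eval (t : ℂ)‖ / ‖Q.eval (t : ℂ)‖) ^ s) ∂μ := by
        refine lintegral_finsetSum _ fun i _ => ?_
        have h3 : ∀ p : ℂ[X], Measurable fun t : ℝ => ‖p.eval (t : ℂ)‖ := fun p => by
          have : Continuous fun t : ℝ => ‖p.eval (t : ℂ)‖ := by fun_prop
          exact this.measurable
        exact (((h3 _).div (h3 _)).pow_const s).ennreal_ofReal
    _ ≤ ∑ i : Fin k, ENNReal.ofReal C * (ENNReal.ofReal (C' ^ s * (1 + ‖z‖) ^ (-s)) *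
        ∫⁻ t, ENNReal.ofReal
          (‖Matrix.toEuclideanLin ((t : ℂ) • A + B) (u t) - z • u t‖ ^ s) ∂μ) := by
        refine Finset.sum_le_sum fun i _ => ?_
        refine (hdec μ hμ (P i) Q (hP i) hQ hQ0 R hRk).trans ?_
        gcongr
        exact hgood i
    _ ≤ _ := by
        rw [Finset.sum_const, Finset.card_univ, Fintype.card_fin, nsmul_eq_mul, ← mul_assoc,
          ← mul_assoc, ← ENNReal.ofReal_natCast, ← ENNReal.ofReal_mul (by positivity),
          ← ENNReal.ofReal_mul (by positivity)]
        gcongr ENNReal.ofReal ?_ * _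
        calc (k : ℝ) * C * (C' ^ s * (1 + ‖z‖) ^ (-s)) ≤
              (k + 1) * C * (C' ^ s * (1 + ‖z‖) ^ (-s)) := by gcongr; linarith
          _ = _ := by ring

end Site

/-! ### Fractional moments of the resolvent -/

section Moments

variable {d k : ℕ} {μ : Measure ℝ}

/-- On cylinders the factor of the coordinate `x`, if present, is simply supplied by the second
measure. This replaces conditioning on all sites but one. -/
theorem infinitePi_map_update {ι : Type*} [DecidableEq ι] (μ : Measure ℝ) [IsProbabilityMeasure μ]
    (x : ι) : ((Measure.infinitePi fun _ : ι => μ).prod μ).map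
      (fun p => Function.update p.1 x p.2) = Measure.infinitePi fun _ : ι => μ := by
  refine Measure.eq_infinitePi _ fun S t ht => ?_
  have hmeas : Measurable fun p : (ι → ℝ) × ℝ => Function.update p.1 x p.2 := measurable_update'
  rw [Measure.map_apply hmeas (MeasurableSet.pi S.countable_toSet fun i _ => ht i)]
  by_cases hx : x ∈ S
  · have : (fun p : (ι → ℝ) × ℝ => Function.update p.1 x p.2) ⁻¹' (Set.pi S t) =
        (Set.pi (S.erase x : Finset ι) t) ×ˢ (t x) := by
      ext ⟨w, r⟩
      simp only [Set.mem_preimage, Set.mem_pi, Set.mem_prod, Finset.mem_coe, Finset.mem_erase]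
      constructor
      · intro h
        refine ⟨fun i hi => ?_, by simpa using h x hx⟩
        simpa [Function.update_of_ne hi.1] using h i hi.2
      · rintro ⟨h1, h2⟩ i hi
        by_cases hix : i = x
        · subst hix; simpa using h2
        · simpa [Function.update_of_ne hix] using h1 i ⟨hix, hi⟩
    rw [this, Measure.prod_prod, Measure.infinitePi_pi _ fun i _ => ht i,
      Finset.prod_erase_mul S (fun i => μ (t i)) hx]
  · have : (fun p : (ι → ℝ) × ℝ => Function.update p.1 x p.2) ⁻¹' (Set.pi S t) =
        (Set.pi S t) ×ˢ Set.univ := by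
      ext ⟨w, r⟩
      simp only [Set.mem_preimage, Set.mem_pi, Set.mem_prod, Finset.mem_coe, Set.mem_univ, and_true]
      refine forall₂_congr fun i hi => ?_
      rw [Function.update_of_ne (fun h : i = x => hx (h ▸ hi))]
    rw [this, Measure.prod_prod, Measure.infinitePi_pi _ fun i _ => ht i, measure_univ, mul_one]

theorem lintegral_resample {ι : Type*} [DecidableEq ι] (μ : Measure ℝ) [IsProbabilityMeasure μ]
    (x : ι) {F : (ι → ℝ) → ℝ≥0∞} (hF : Measurable F) :
    ∫⁻ v, F v ∂(Measure.infinitePi fun _ : ι => μ) =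
      ∫⁻ v, ∫⁻ t, F (Function.update v x t) ∂μ ∂(Measure.infinitePi fun _ : ι => μ) := by
  have hmeas : Measurable fun p : (ι → ℝ) × ℝ => Function.update p.1 x p.2 := measurable_update'
  conv_lhs => rw [← infinitePi_map_update μ x]
  rw [lintegral_map hF hmeas]
  exact lintegral_prod (fun p => F (Function.update p.1 x p.2)) (hF.comp hmeas).aemeasurable

theorem infinitePi_map_shift (μ : Measure ℝ) [IsProbabilityMeasure μ] (a : Site d) :
    (Measure.infinitePi fun _ : Site d => μ).map (fun v x => v (x + a)) =
      Measure.infinitePi fun _ : Site d => μ := by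
  refine Measure.eq_infinitePi _ fun S t ht => ?_
  rw [Measure.map_apply (by fun_prop) (MeasurableSet.pi S.countable_toSet fun i _ => ht i)]
  have : (fun (v : Site d → ℝ) x => v (x + a)) ⁻¹' (Set.pi S t) =
      Set.pi (S.map (Equiv.addRight a).toEmbedding : Finset (Site d)) (fun x => t (x - a)) := by
    ext v
    simp only [Set.mem_preimage, Set.mem_pi, Finset.mem_coe, Finset.mem_map_equiv,
      Equiv.addRight_symm_apply]
    constructor
    · intro h i hi
      simpa [sub_eq_add_neg] using h _ hi
    · intro h i hi
      simpa using h (i + a) (by simpa using hi)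
  rw [this, Measure.infinitePi_pi _ fun i _ => ht _, Finset.prod_map]
  simp

variable {M : ModelData d k} {CB1 CB2 CB3 : ℝ}

theorem continuous_apply_wave {X : Type*} [TopologicalSpace X] {f : X → Wave d k}
    (hf : Continuous f) (x : Site d) : Continuous fun y => f y x :=
  (lp.lipschitzWith_one_eval 2 x).continuous.comp hf

theorem ModelData.Admissible.norm_hopping_apply_le (hM : M.Admissible CB1 CB2 CB3)
    (ψ : Wave d k) (x : Site d) : ‖M.hopping ψ x‖ ≤
      ∑ i : Fin d, (CB3 * ‖ψ (x - unitVec i)‖ + CB3 * ‖ψ (x + unitVec i)‖) := by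
  rw [ModelData.hopping_apply]
  refine (norm_sum_le _ _).trans (Finset.sum_le_sum fun i _ => (norm_add_le _ _).trans ?_)
  have := hM.norm_K i
  exact add_le_add
    ((norm_toEuclideanLin_le _ _).trans (mul_le_mul_of_nonneg_right this.1 (norm_nonneg _)))
    ((norm_toEuclideanLin_le _ _).trans (mul_le_mul_of_nonneg_right this.2 (norm_nonneg _)))

/-- The resolvent equation trades the on-site term for the source and the neighbouring values, and
for s ≤ 1 the power is subadditive. -/
theorem ModelData.Admissible.rpow_site_term_le (hM : M.Admissible CB1 CB2 CB3) (h3 : 0 ≤ CB3)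
    {g : ℝ} (hg : 0 < g) (v : Site d → ℝ) {z : ℂ} (hz : z.im ≠ 0) {s : ℝ} (hs : 0 < s)
    (hs1 : s ≤ 1) (ψ : Wave d k) (x : Site d) :
    ‖Matrix.toEuclideanLin ((v x : ℂ) • M.A + M.B) (M.green g v z ψ x) -
      z • M.green g v z ψ x‖ ^ s ≤ ‖ψ x‖ ^ s + (CB3 / g) ^ s *
        ∑ i : Fin d, (‖M.green g v z ψ (x - unitVec i)‖ ^ s +
          ‖M.green g v z ψ (x + unitVec i)‖ ^ s) := by
  set u := M.green g v z ψ with hu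
  have h1 : Matrix.toEuclideanLin ((v x : ℂ) • M.A + M.B) (u x) - z • u x =
      ψ x - ((g⁻¹ : ℝ) : ℂ) • M.hopping u x := by
    rw [← hM.green_equation g v hz ψ x]
    abel
  have h2 : ‖Matrix.toEuclideanLin ((v x : ℂ) • M.A + M.B) (u x) - z • u x‖ ≤
      ‖ψ x‖ + ∑ i : Fin d, (CB3 / g * ‖u (x - unitVec i)‖ + CB3 / g * ‖u (x + unitVec i)‖) := by
    rw [h1]
    refine (norm_sub_le _ _).trans ?_
    gcongr
    rw [norm_smul, Complex.norm_real, Real.norm_eq_abs, abs_of_pos (by positivity)]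
    refine (mul_le_mul_of_nonneg_left (hM.norm_hopping_apply_le u x) (by positivity)).trans ?_
    rw [Finset.mul_sum]
    refine le_of_eq (Finset.sum_congr rfl fun i _ => ?_)
    field_simp
  have hnn : ∀ i : Fin d, 0 ≤ CB3 / g * ‖u (x - unitVec i)‖ + CB3 / g * ‖u (x + unitVec i)‖ :=
    fun i => by positivity
  calc _ ≤ (‖ψ x‖ + ∑ i : Fin d,
        (CB3 / g * ‖u (x - unitVec i)‖ + CB3 / g * ‖u (x + unitVec i)‖)) ^ s :=
        Real.rpow_le_rpow (norm_nonneg _) h2 hs.le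
    _ ≤ ‖ψ x‖ ^ s + (∑ i : Fin d,
        (CB3 / g * ‖u (x - unitVec i)‖ + CB3 / g * ‖u (x + unitVec i)‖)) ^ s :=
        Real.rpow_add_le_add_rpow (norm_nonneg _) (Finset.sum_nonneg fun i _ => hnn i) hs.le hs1
    _ ≤ ‖ψ x‖ ^ s + ∑ i : Fin d,
        (CB3 / g * ‖u (x - unitVec i)‖ + CB3 / g * ‖u (x + unitVec i)‖) ^ s := by
        gcongr
        exact rpow_sum_le_sum_rpow _ hnn hs hs1
    _ ≤ _ := by
        rw [Finset.mul_sum]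
        gcongr with i
        refine (Real.rpow_add_le_add_rpow (by positivity) (by positivity) hs.le hs1).trans ?_
        rw [Real.mul_rpow (by positivity) (norm_nonneg _),
          Real.mul_rpow (by positivity) (norm_nonneg _), mul_add]

/-- The fractional moments of the resolvent are bounded uniformly in the distance to the real axis
when the coupling is weak. -/
theorem exists_green_moment {α q C₁ C₂ : ℝ} (k : ℕ) (hα : 0 < α) (hq : 0 < q) (hC₁ : 0 ≤ C₁)
    (hC₂ : 0 ≤ C₂) {CB1 CB2 CB3 : ℝ} (h1 : 0 ≤ CB1) (h2 : 0 ≤ CB2) (h3 : 0 ≤ CB3) {s : ℝ}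
    (hs : 0 < s) (hs1 : s ≤ 1) (hsk : s * (k * (2 / q + 1 / α)) = 1) :
    ∃ K : ℝ, 0 < K ∧ ∀ (d : ℕ) (M : ModelData d k), M.Admissible CB1 CB2 CB3 →
      ∀ (μ : Measure ℝ) [IsProbabilityMeasure μ], TameLaw α q C₁ C₂ μ → ∀ g : ℝ, 0 < g →
      ∀ z : ℂ, z.im ≠ 0 → 4 * K * d * CB3 ^ s ≤ (g * (1 + ‖z‖)) ^ s → ∀ ψ : Wave d k, ‖ψ‖ ≤ 1 →
      ∀ x : Site d, ∫⁻ v, ENNReal.ofReal (‖M.green g v z ψ x‖ ^ s)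
        ∂(Measure.infinitePi fun _ : Site d => μ) ≤ ENNReal.ofReal (2 * K * (1 + ‖z‖) ^ (-s)) := by
  obtain ⟨K, hK, hdec⟩ := exists_site_decoupling k hα hq hC₁ hC₂ h1 h2 hs hs1 hsk
  refine ⟨K, hK, ?_⟩
  intro d M hM μ _ hμ g hg z hz hgz ψ hψ x₀
  set ν := Measure.infinitePi fun _ : Site d => μ with hν
  have hcont : ∀ x, Continuous fun v : Site d → ℝ => M.green g v z ψ x := fun x =>
    continuous_apply_wave (hM.continuous_green g hz ψ) x
  have hmeas : ∀ x, Measurable fun v : Site d → ℝ =>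
      ENNReal.ofReal (‖M.green g v z ψ x‖ ^ s) := fun x =>
    (((hcont x).norm.rpow_const fun _ => Or.inr hs.le).measurable).ennreal_ofReal
  let S : Site d → ℝ≥0∞ := fun x => ∫⁻ v, ENNReal.ofReal (‖M.green g v z ψ x‖ ^ s) ∂ν
  set S' : ℝ≥0∞ := ⨆ x, S x with hS'
  have hSle : ∀ x, S x ≤ S' := fun x => le_iSup S x
  -- The crude bound |Im z|^(-s) serves only to make the later absorption legitimate; it leaves no
  -- trace in the final constant.
  have hfin : S' ≠ ⊤ := by
    refine ne_top_of_le_ne_top (ENNReal.ofReal_ne_top (r := (|z.im|⁻¹) ^ s)) (iSup_le fun x => ?_)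
    calc S x ≤ ∫⁻ v, ENNReal.ofReal ((|z.im|⁻¹) ^ s) ∂ν := by
          refine lintegral_mono fun v => ENNReal.ofReal_le_ofReal ?_
          refine Real.rpow_le_rpow (norm_nonneg _) ?_ hs.le
          refine (lp.norm_apply_le_norm two_ne_zero _ x).trans ?_
          refine ((M.green g v z).le_opNorm ψ).trans ?_
          calc _ ≤ |z.im|⁻¹ * 1 := by
                gcongr
                exact hM.norm_green_le g v hz
            _ = _ := mul_one _
      _ = _ := by rw [lintegral_const, measure_univ, mul_one]
  have hone : ∀ x, ‖ψ x‖ ^ s ≤ 1 := fun x =>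
    Real.rpow_le_one (norm_nonneg _) ((lp.norm_apply_le_norm two_ne_zero ψ x).trans hψ) hs.le
  have hstep : ∀ x, S x ≤ ENNReal.ofReal (K * (1 + ‖z‖) ^ (-s)) *
      (1 + ENNReal.ofReal ((CB3 / g) ^ s) * (2 * d * S')) := by
    intro x
    have hcterm : Continuous fun v : Site d → ℝ =>
        Matrix.toEuclideanLin ((v x : ℂ) • M.A + M.B) (M.green g v z ψ x) -
          z • M.green g v z ψ x := by
      simp only [map_add, map_smul, LinearMap.add_apply, LinearMap.smul_apply]
      have hlin : ∀ N : Matrix (Fin k) (Fin k) ℂ, Continuous fun v : Site d → ℝ =>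
          Matrix.toEuclideanLin N (M.green g v z ψ x) := fun N =>
        (LinearMap.continuous_of_finiteDimensional _).comp (hcont x)
      exact (((by fun_prop : Continuous fun v : Site d → ℝ => ((v x : ℝ) : ℂ)).smul
        (hlin M.A)).add (hlin M.B)).sub ((hcont x).const_smul z)
    have hmterm : Measurable fun v : Site d → ℝ => ENNReal.ofReal
        (‖Matrix.toEuclideanLin ((v x : ℂ) • M.A + M.B) (M.green g v z ψ x) -
          z • M.green g v z ψ x‖ ^ s) :=
      ((hcterm.norm.rpow_const fun _ => Or.inr hs.le).measurable).ennreal_ofReal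
    calc S x = ∫⁻ v, ∫⁻ t, ENNReal.ofReal (‖M.green g (Function.update v x t) z ψ x‖ ^ s) ∂μ ∂ν :=
          lintegral_resample μ x (hmeas x)
      _ ≤ ∫⁻ v, ENNReal.ofReal (K * (1 + ‖z‖) ^ (-s)) * ∫⁻ t, ENNReal.ofReal
            (‖Matrix.toEuclideanLin ((Function.update v x t x : ℂ) • M.A + M.B)
              (M.green g (Function.update v x t) z ψ x) -
                z • M.green g (Function.update v x t) z ψ x‖ ^ s) ∂μ ∂ν := by
          refine lintegral_mono fun v => ?_
          simp only [Function.update_self]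
          -- This is G(x, x)A for the configuration with the potential at `x` set to 0; by
          -- `green_update` the value at `x` solves u + tLu = w.
          let L : Spin k →ₗ[ℂ] Spin k :=
            (lp.evalₗ (𝕜 := ℂ) (fun _ : Site d => Spin k) 2 x) ∘ₗ
              (M.green g (Function.update v x 0) z).toLinearMap ∘ₗ
              (lp.lsingle (𝕜 := ℂ) 2 x) ∘ₗ Matrix.toEuclideanLin M.A
          refine hdec μ hμ M.A M.B hM.isUnit_A hM.norm_A hM.norm_inv_A hM.norm_B z L
            (M.green g (Function.update v x 0) z ψ x) _ fun t => ?_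
          have h4 := hM.green_update g (Function.update v x 0) hz x t ψ
          rw [Function.update_idem, Function.update_self, sub_zero] at h4
          have h5 := congrArg (fun φ : Wave d k => φ x) h4
          exact h5
      _ = ENNReal.ofReal (K * (1 + ‖z‖) ^ (-s)) * ∫⁻ v, ENNReal.ofReal
            (‖Matrix.toEuclideanLin ((v x : ℂ) • M.A + M.B) (M.green g v z ψ x) -
                z • M.green g v z ψ x‖ ^ s) ∂ν := by
          rw [lintegral_const_mul' _ _ ENNReal.ofReal_ne_top, lintegral_resample μ x hmterm]
      _ ≤ _ := by
          gcongr
          calc _ ≤ ∫⁻ v, (1 + ENNReal.ofReal ((CB3 / g) ^ s) * ∑ i : Fin d,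
                (ENNReal.ofReal (‖M.green g v z ψ (x - unitVec i)‖ ^ s) +
                  ENNReal.ofReal (‖M.green g v z ψ (x + unitVec i)‖ ^ s))) ∂ν := by
                refine lintegral_mono fun v => ?_
                have h4 : ∀ i : Fin d, ENNReal.ofReal (‖M.green g v z ψ (x - unitVec i)‖ ^ s) +
                    ENNReal.ofReal (‖M.green g v z ψ (x + unitVec i)‖ ^ s) =
                    ENNReal.ofReal (‖M.green g v z ψ (x - unitVec i)‖ ^ s +
                      ‖M.green g v z ψ (x + unitVec i)‖ ^ s) := fun i =>
                  (ENNReal.ofReal_add (by positivity) (by positivity)).symm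
                simp only [h4]
                rw [← ENNReal.ofReal_sum_of_nonneg fun i _ => by positivity,
                  ← ENNReal.ofReal_mul (by positivity), ← ENNReal.ofReal_one,
                  ← ENNReal.ofReal_add zero_le_one (mul_nonneg (by positivity)
                    (Finset.sum_nonneg fun i _ => by positivity))]
                refine ENNReal.ofReal_le_ofReal
                  ((hM.rpow_site_term_le h3 hg v hz hs hs1 ψ x).trans ?_)
                gcongr
                exact hone x
            _ = 1 + ENNReal.ofReal ((CB3 / g) ^ s) *
                ∑ i : Fin d, (S (x - unitVec i) + S (x + unitVec i)) := by
                rw [lintegral_add_left measurable_const, lintegral_const, measure_univ, mul_one,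
                  lintegral_const_mul' _ _ ENNReal.ofReal_ne_top]
                congr 2
                exact (lintegral_finsetSum _ fun i _ => (hmeas _).add (hmeas _)).trans
                  (Finset.sum_congr rfl fun i _ => lintegral_add_left (hmeas _) _)
            _ ≤ 1 + ENNReal.ofReal ((CB3 / g) ^ s) * ∑ i : Fin d, (S' + S') := by
                gcongr <;> exact hSle _
            _ = _ := by
                rw [Finset.sum_const, Finset.card_univ, Fintype.card_fin, nsmul_eq_mul, ← two_mul]
                ring_nf
  have hSS : S' ≤ ENNReal.ofReal (K * (1 + ‖z‖) ^ (-s)) *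
      (1 + ENNReal.ofReal ((CB3 / g) ^ s) * (2 * d * S')) := iSup_le hstep
  refine (hSle x₀).trans ?_
  set r := S'.toReal with hr
  have hrS : S' = ENNReal.ofReal r := (ENNReal.ofReal_toReal hfin).symm
  have hr0 : 0 ≤ r := ENNReal.toReal_nonneg
  have hz1 : 0 < 1 + ‖z‖ := by positivity
  rw [hrS] at hSS ⊢
  have hSS' : r ≤ K * (1 + ‖z‖) ^ (-s) * (1 + (CB3 / g) ^ s * (2 * d * r)) := by
    have h4 : ENNReal.ofReal (K * (1 + ‖z‖) ^ (-s)) *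
      (1 + ENNReal.ofReal ((CB3 / g) ^ s) * (2 * d * ENNReal.ofReal r)) =
        ENNReal.ofReal (K * (1 + ‖z‖) ^ (-s) * (1 + (CB3 / g) ^ s * (2 * d * r))) := by
      rw [ENNReal.ofReal_mul (by positivity : 0 ≤ K * (1 + ‖z‖) ^ (-s)), ENNReal.ofReal_add (by positivity) (by positivity),
        ENNReal.ofReal_mul (by positivity : 0 ≤ (CB3 / g) ^ s),
        ENNReal.ofReal_mul (by positivity : (0 : ℝ) ≤ 2 * d),
        ENNReal.ofReal_mul (by positivity : (0 : ℝ) ≤ 2), ENNReal.ofReal_natCast]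
      simp
    rw [h4] at hSS
    exact (ENNReal.ofReal_le_ofReal_iff (by positivity)).1 hSS
  -- The coefficient of the supremum on the right is at most 1/2, which is exactly what the
  -- hypothesis on g provides.
  have hsmall : K * (1 + ‖z‖) ^ (-s) * ((CB3 / g) ^ s * (2 * d)) ≤ 1 / 2 := by
    rw [Real.mul_rpow hg.le hz1.le] at hgz
    rw [Real.rpow_neg hz1.le, Real.div_rpow h3 hg.le]
    have h5 : 0 < g ^ s := by positivity
    have h6 : 0 < (1 + ‖z‖) ^ s := by positivity
    rw [show K * ((1 + ‖z‖) ^ s)⁻¹ * (CB3 ^ s / g ^ s * (2 * d)) =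
      (2 * K * d * CB3 ^ s) / (g ^ s * (1 + ‖z‖) ^ s) by field_simp,
      div_le_iff₀ (by positivity)]
    linarith
  refine ENNReal.ofReal_le_ofReal ?_
  have h7 : r ≤ K * (1 + ‖z‖) ^ (-s) + 1 / 2 * r := by
    calc r ≤ K * (1 + ‖z‖) ^ (-s) * (1 + (CB3 / g) ^ s * (2 * d * r)) := hSS'
      _ = K * (1 + ‖z‖) ^ (-s) + K * (1 + ‖z‖) ^ (-s) * ((CB3 / g) ^ s * (2 * d)) * r := by ring
      _ ≤ _ := by gcongr
  linarith

end Moments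

/-! ### Measures from positive functionals -/

section Riesz

open scoped CompactlySupported

/-- A trapezoidal cutoff function. -/
def cutoff (R : ℝ) : C_c(ℝ, ℝ) where
  toFun t := max 0 (min 1 (R + 1 - |t|))
  continuous_toFun := by fun_prop
  hasCompactSupport' := by
    refine HasCompactSupport.intro (isCompact_Icc (a := -(R + 1)) (b := R + 1)) fun t ht => ?_
    refine max_eq_left ((min_le_right _ _).trans ?_)
    by_contra h
    exact ht (abs_le.1 (by linarith))

theorem cutoff_apply (R t : ℝ) : cutoff R t = max 0 (min 1 (R + 1 - |t|)) := rfl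

theorem cutoff_nonneg (R t : ℝ) : 0 ≤ cutoff R t := le_max_left _ _

theorem cutoff_le_one (R t : ℝ) : cutoff R t ≤ 1 := max_le zero_le_one (min_le_left _ _)

theorem cutoff_eq_one {R t : ℝ} (h : |t| ≤ R) : cutoff R t = 1 := by
  rw [cutoff_apply, min_eq_left (by linarith), max_eq_right zero_le_one]

/-- A compactly supported continuous function vanishes at infinity. -/
def vanishing (f : C_c(ℝ, ℝ)) : C₀(ℝ, ℝ) where
  toFun := f
  continuous_toFun := map_continuous f
  zero_at_infty' := zero_at_infty f

theorem vanishing_apply (f : C_c(ℝ, ℝ)) (t : ℝ) : vanishing f t = f t := rfl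

theorem integrable_zeroAtInfty (ρ : Measure ℝ) [IsFiniteMeasure ρ] (f : C₀(ℝ, ℝ)) :
    Integrable (fun t => f t) ρ :=
  Integrable.of_bound (map_continuous f).aestronglyMeasurable ‖f‖
    (ae_of_all _ fun t => f.toBCF.norm_coe_le_norm t)

/-- Riesz representation applies on compactly supported functions; testing against cutoffs bounds
the mass by 1, and the sup-norm bound extends the formula to C₀(ℝ). Uniqueness already holds on
compactly supported functions. -/
theorem existsUnique_measure_integral_eq (Λ : C₀(ℝ, ℝ) →ₗ[ℝ] ℝ)
    (hpos : ∀ f : C₀(ℝ, ℝ), (∀ t, 0 ≤ f t) → 0 ≤ Λ f)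
    (hbound : ∀ (f : C₀(ℝ, ℝ)) (C : ℝ), 0 ≤ C → (∀ t, |f t| ≤ C) → |Λ f| ≤ C) :
    ∃! ρ : Measure ℝ, IsFiniteMeasure ρ ∧ ∀ f : C₀(ℝ, ℝ), ∫ t, f t ∂ρ = Λ f := by
  let L : C_c(ℝ, ℝ) →ₚ[ℝ] ℝ := PositiveLinearMap.mk₀
    { toFun := fun f => Λ (vanishing f)
      map_add' := fun f h => by rw [← map_add]; rfl
      map_smul' := fun c f => by rw [RingHom.id_apply, ← map_smul]; rfl }
    fun f hf => hpos _ fun t => hf t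
  have hL : ∀ f, L f = Λ (vanishing f) := fun f => rfl
  let ρ := RealRMK.rieszMeasure L
  have hcut : ∀ n : ℕ, ρ (Set.Icc (-(n : ℝ)) n) ≤ 1 := by
    intro n
    refine (RealRMK.rieszMeasure_le_of_eq_one L (f := cutoff n) (cutoff_nonneg _) isCompact_Icc
      fun t ht => cutoff_eq_one (abs_le.2 ht)).trans ?_
    rw [← ENNReal.ofReal_one]
    refine ENNReal.ofReal_le_ofReal ((le_abs_self _).trans (hbound _ 1 zero_le_one fun t => ?_))
    rw [vanishing_apply, abs_of_nonneg (cutoff_nonneg _ _)]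
    exact cutoff_le_one _ _
  have hfin : IsFiniteMeasure ρ := by
    refine ⟨lt_of_le_of_lt ?_ ENNReal.one_lt_top⟩
    have h1 : (Set.univ : Set ℝ) = ⋃ n : ℕ, Set.Icc (-(n : ℝ)) n := by
      refine (Set.eq_univ_of_forall fun t => ?_).symm
      obtain ⟨n, hn⟩ := exists_nat_ge |t|
      exact Set.mem_iUnion.2 ⟨n, abs_le.1 hn⟩
    have h2 : Monotone fun n : ℕ => Set.Icc (-(n : ℝ)) n := fun m n hmn => by
      have : (m : ℝ) ≤ n := by exact_mod_cast hmn
      exact Set.Icc_subset_Icc (by linarith) this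
    rw [h1, h2.measure_iUnion]
    exact iSup_le hcut
  refine ⟨ρ, ⟨hfin, fun f => ?_⟩, ?_⟩
  · rw [← sub_eq_zero, ← abs_eq_zero]
    refine le_antisymm (le_of_forall_pos_le_add fun ε hε => ?_) (abs_nonneg _)
    rw [zero_add]
    set m := ρ.real Set.univ
    have hm : 0 ≤ m := measureReal_nonneg
    set η := ε / (m + 1) with hη_def
    have hη : 0 < η := by positivity
    obtain ⟨R, hR⟩ : ∃ R : ℝ, ∀ t, R < |t| → |f t| ≤ η := by
      have h1 := Metric.tendsto_nhds.1 (zero_at_infty f) η hη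
      rw [← Metric.cobounded_eq_cocompact, ← comap_norm_atTop, eventually_comap] at h1
      obtain ⟨R, hR⟩ := eventually_atTop.1 h1
      refine ⟨R, fun t ht => ?_⟩
      have := hR _ ht.le t rfl
      rw [Real.dist_eq, sub_zero] at this
      exact this.le
    -- A compactly supported approximation of f, uniformly within η; both sides of the identity are
    -- stable under such an error.
    let fc : C_c(ℝ, ℝ) :=
      ⟨⟨fun t => f t * cutoff R t, (map_continuous f).mul (map_continuous (cutoff R))⟩,
        (cutoff R).hasCompactSupport'.mul_left⟩
    have hfc : ∀ t, fc t = f t * cutoff R t := fun t => rfl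
    have hdiff : ∀ t, |f t - fc t| ≤ η := by
      intro t
      rw [hfc]
      rcases le_or_gt |t| R with h | h
      · rw [cutoff_eq_one h, mul_one, sub_self, abs_zero]; exact hη.le
      · rw [show f t - f t * cutoff R t = f t * (1 - cutoff R t) by ring, abs_mul]
        have h1 : |1 - cutoff R t| ≤ 1 := by
          rw [abs_le]
          constructor <;> linarith [cutoff_nonneg R t, cutoff_le_one R t]
        calc _ ≤ η * 1 := by gcongr; exact hR t h
          _ = η := mul_one _
    have h1 : |Λ f - Λ (vanishing fc)| ≤ η := by
      rw [← map_sub]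
      exact hbound _ _ hη.le hdiff
    have h2 : |∫ t, f t ∂ρ - ∫ t, vanishing fc t ∂ρ| ≤ η * m := by
      rw [← integral_sub (integrable_zeroAtInfty ρ f) (integrable_zeroAtInfty ρ _)]
      exact norm_integral_le_of_norm_le_const (f := fun t => f t - vanishing fc t)
        (ae_of_all _ fun t => hdiff t)
    have h3 : ∫ t, vanishing fc t ∂ρ = Λ (vanishing fc) :=
      (RealRMK.integral_rieszMeasure L fc).trans (hL fc)
    have h4 : η * m + η = ε := by rw [hη_def]; field_simp
    rw [h3] at h2
    calc _ = |(∫ t, f t ∂ρ - Λ (vanishing fc)) - (Λ f - Λ (vanishing fc))| := by congr 1; ring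
      _ ≤ _ := (abs_sub _ _)
      _ ≤ η * m + η := add_le_add h2 h1
      _ = ε := h4
  · rintro ρ' ⟨hfin', hρ'⟩
    refine Measure.ext_of_integral_eq_on_compactlySupported fun f => ?_
    exact (hρ' (vanishing f)).trans (RealRMK.integral_rieszMeasure L f).symm

end Riesz

/-! ### The density of states -/

section DensityOfStates

variable {d k : ℕ} {M : ModelData d k} {g : ℝ} {CB1 CB2 CB3 : ℝ}

theorem kernel_add (T T' : Wave d k →L[ℂ] Wave d k) (m n : Site d) :
    kernel (T + T') m n = kernel T m n + kernel T' m n := rfl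

theorem kernel_smul (c : ℂ) (T : Wave d k →L[ℂ] Wave d k) (m n : Site d) :
    kernel (c • T) m n = c • kernel T m n := rfl

theorem ModelData.Admissible.continuous_kernel (hM : M.Admissible CB1 CB2 CB3) (g : ℝ)
    (h : C(cayleyCircle, ℂ)) (m n : Site d) (i j : Fin k) :
    Continuous fun v : Site d → ℝ => kernel (hM.calculus g v h) m n i j := by
  have h1 := continuous_apply_wave (hM.continuous_calculus g h
    (lp.single 2 n (EuclideanSpace.single j (1 : ℂ)))) m
  exact (EuclideanSpace.proj (𝕜 := ℂ) i).continuous.comp h1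

theorem ModelData.Admissible.kernel_calculus_im (hM : M.Admissible CB1 CB2 CB3) (v : Site d → ℝ)
    (f : C₀(ℝ, ℝ)) (n : Site d) (i : Fin k) :
    (kernel (hM.calculus g v (circleFun f)) n n i i).im = 0 := by
  have h1 : star (circleFun f) = circleFun f := by
    ext w
    by_cases h0 : (w : ℂ) = 0 <;> simp [circleWeight, h0]
  have h2 : star (hM.calculus g v (circleFun f)) = hM.calculus g v (circleFun f) := by
    rw [← map_star, h1]
  rw [ContinuousLinearMap.star_eq_adjoint] at h2
  rw [← Complex.conj_eq_iff_im, kernel_self_eq_inner, inner_conj_symm]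
  nth_rewrite 1 [← h2]
  rw [ContinuousLinearMap.adjoint_inner_left]

theorem ModelData.Admissible.norm_kernel_calculus_le (hM : M.Admissible CB1 CB2 CB3)
    (v : Site d → ℝ) (h : C(cayleyCircle, ℂ)) (m n : Site d) (i j : Fin k) :
    ‖kernel (hM.calculus g v h) m n i j‖ ≤ ‖h‖ :=
  (norm_kernel_le _ m n i j).trans (hM.norm_calculus_le h)

theorem IsIID.map_eq {μ : Measure ℝ} {Ω : Type*} [MeasurableSpace Ω] {P : Measure Ω} {v : Site d → Ω → ℝ}
    (hv : IsIID v P μ) :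
    P.map (fun ω x => v x ω) = Measure.infinitePi fun _ : Site d => μ := by
  rw [hv.indep.map_fun_eq_infinitePi_map hv.measurable]
  simp only [hv.law]

variable (μ : Measure ℝ) [IsProbabilityMeasure μ]

theorem ModelData.Admissible.integrable_kernel (hM : M.Admissible CB1 CB2 CB3) (g : ℝ)
    (h : C(cayleyCircle, ℂ)) (m n : Site d) (i j : Fin k) :
    Integrable (fun v => kernel (hM.calculus g v h) m n i j)
      (Measure.infinitePi fun _ : Site d => μ) :=
  Integrable.of_bound (hM.continuous_kernel g h m n i j).aestronglyMeasurable ‖h‖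
    (ae_of_all _ fun v => hM.norm_kernel_calculus_le v h m n i j)

theorem ModelData.Admissible.integral_kernel_shift (hM : M.Admissible CB1 CB2 CB3) (g : ℝ)
    (h : C(cayleyCircle, ℂ)) (n : Site d) (i j : Fin k) :
    ∫ v, kernel (hM.calculus g v h) n n i j ∂(Measure.infinitePi fun _ : Site d => μ) =
      ∫ v, kernel (hM.calculus g v h) 0 0 i j ∂(Measure.infinitePi fun _ : Site d => μ) := by
  nth_rewrite 2 [← infinitePi_map_shift μ n]
  have hmeas : Measurable fun (v : Site d → ℝ) x => v (x + n) :=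
    measurable_pi_iff.2 fun x => measurable_pi_apply _
  rw [integral_map hmeas.aemeasurable (hM.continuous_kernel g h 0 0 i j).aestronglyMeasurable]
  simp only [hM.calculus_shift, kernel_shift, zero_add]

/-- The averaged trace per unit volume of a function of the Hamiltonian. -/
def ModelData.Admissible.averagedTrace (hM : M.Admissible CB1 CB2 CB3) (g : ℝ) :
    C₀(ℝ, ℝ) →ₗ[ℝ] ℝ where
  toFun f := (k : ℝ)⁻¹ * ∑ i : Fin k, ∫ v, (kernel (hM.calculus g v (circleFun f)) 0 0 i i).re
    ∂(Measure.infinitePi fun _ : Site d => μ)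
  map_add' f h := by
    rw [← mul_add, ← Finset.sum_add_distrib]
    congr 1
    refine Finset.sum_congr rfl fun i _ => ?_
    refine Eq.trans ?_ (integral_add (hM.integrable_kernel μ g (circleFun f) 0 0 i i).re
      (hM.integrable_kernel μ g (circleFun h) 0 0 i i).re)
    simp only [circleFun_add, map_add, kernel_add]
    rfl
  map_smul' c f := by
    rw [RingHom.id_apply, smul_eq_mul, mul_left_comm c, Finset.mul_sum _ _ c]
    congr 1
    refine Finset.sum_congr rfl fun i _ => ?_
    rw [← integral_const_mul]
    simp only [circleFun_smul, map_smul, kernel_smul, Matrix.smul_apply, smul_eq_mul,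
      Complex.re_ofReal_mul]

theorem ModelData.Admissible.averagedTrace_apply (hM : M.Admissible CB1 CB2 CB3) (f : C₀(ℝ, ℝ)) :
    hM.averagedTrace μ g f = (k : ℝ)⁻¹ * ∑ i : Fin k,
      ∫ v, (kernel (hM.calculus g v (circleFun f)) 0 0 i i).re
        ∂(Measure.infinitePi fun _ : Site d => μ) := rfl

theorem ModelData.Admissible.averagedTrace_nonneg (hM : M.Admissible CB1 CB2 CB3) {f : C₀(ℝ, ℝ)}
    (hf : ∀ t, 0 ≤ f t) : 0 ≤ hM.averagedTrace μ g f :=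
  mul_nonneg (by positivity) (Finset.sum_nonneg fun i _ =>
    integral_nonneg fun v => hM.kernel_calculus_nonneg hf 0 i)

theorem inv_mul_sum_le {k : ℕ} {F : Fin k → ℝ} {C : ℝ} (hC : 0 ≤ C) (hF : ∀ i, F i ≤ C) :
    (k : ℝ)⁻¹ * ∑ i, F i ≤ C := by
  rcases Nat.eq_zero_or_pos k with rfl | hk
  · simpa using hC
  · have hk' : (0 : ℝ) < k := by exact_mod_cast hk
    rw [inv_mul_le_iff₀ hk']
    calc ∑ i, F i ≤ ∑ _i : Fin k, C := Finset.sum_le_sum fun i _ => hF i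
      _ = k * C := by simp

theorem ModelData.Admissible.abs_averagedTrace_le (hM : M.Admissible CB1 CB2 CB3) (f : C₀(ℝ, ℝ))
    (C : ℝ) (hC : 0 ≤ C) (hf : ∀ t, |f t| ≤ C) : |hM.averagedTrace μ g f| ≤ C := by
  rw [hM.averagedTrace_apply μ, abs_mul, abs_of_nonneg (by positivity)]
  refine (mul_le_mul_of_nonneg_left (Finset.abs_sum_le_sum_abs _ _) (by positivity)).trans
    (inv_mul_sum_le hC fun i => ?_)
  refine (norm_integral_le_of_norm_le_const (C := C)
    (f := fun v => (kernel (hM.calculus g v (circleFun f)) 0 0 i i).re)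
    (μ := Measure.infinitePi fun _ : Site d => μ) (ae_of_all _ fun v => ?_)).trans ?_
  · exact (Complex.abs_re_le_norm _).trans ((hM.norm_kernel_calculus_le v _ _ _ _ _).trans
      (norm_circleFun_le f hC hf))
  · simp

variable {μ}

/-- The probability space enters only through the product law of the configuration, and stationarity
removes the dependence on the vertex. Real parts suffice since diagonal entries of f(H) are real for
real f. -/
theorem IsIID.isDensityOfStates_iff {Ω : Type*} [MeasurableSpace Ω] {P : Measure Ω}
    {v : Site d → Ω → ℝ} (hv : IsIID v P μ) (hM : M.Admissible CB1 CB2 CB3) (ρ : Measure ℝ) :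
    IsDensityOfStates (fun ω => M.hamiltonian g (fun x => v x ω)) P ρ ↔
      IsFiniteMeasure ρ ∧ ∀ f : C₀(ℝ, ℝ), ∫ t, f t ∂ρ = hM.averagedTrace μ g f := by
  have hmeas : Measurable fun ω x => v x ω := measurable_pi_iff.2 hv.measurable
  have hint : ∀ (f : C₀(ℝ, ℝ)) (n : Site d) (i j : Fin k), Integrable (fun ω =>
      kernel (hM.calculus g (fun x => v x ω) (circleFun f)) n n i j) P := fun f n i j => by
    have h1 := hM.integrable_kernel μ g (circleFun f) n n i j
    rw [← hv.map_eq] at h1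
    exact h1.comp_measurable hmeas
  have htrace : ∀ (f : C₀(ℝ, ℝ)) (n : Site d), (k : ℂ)⁻¹ * Matrix.trace (Matrix.of fun i j =>
      ∫ ω, kernel (hM.calculus g (fun x => v x ω) (circleFun f)) n n i j ∂P) =
      ((hM.averagedTrace μ g f : ℝ) : ℂ) := by
    intro f n
    rw [hM.averagedTrace_apply μ, Complex.ofReal_mul, Complex.ofReal_inv, Complex.ofReal_natCast,
      Complex.ofReal_sum]
    congr 1
    refine Finset.sum_congr rfl fun i _ => ?_
    change ∫ ω, kernel (hM.calculus g (fun x => v x ω) (circleFun f)) n n i i ∂P = _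
    rw [← integral_map (μ := P) (φ := fun ω x => v x ω)
      (f := fun w => kernel (hM.calculus g w (circleFun f)) n n i i) hmeas.aemeasurable
      (hM.continuous_kernel g _ n n i i).aestronglyMeasurable, hv.map_eq,
      hM.integral_kernel_shift μ, ← integral_complex_ofReal]
    congr 1
    funext w
    apply Complex.ext
    · simp
    · simpa using hM.kernel_calculus_im w f 0 i
  constructor
  · intro h
    refine ⟨h.finite, fun f => ?_⟩
    have h1 := h.integral_eq f 0
    simp only [hM.funCalc_eq] at h1
    rw [htrace] at h1
    exact_mod_cast h1
  · rintro ⟨h1, h2⟩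
    refine ⟨h1, fun f n i j => ?_, fun f n => ?_⟩
    · simp only [hM.funCalc_eq]
      exact hint f n i j
    · simp only [hM.funCalc_eq]
      rw [htrace, h2]

theorem IsIID.existsUnique_densityOfStates {Ω : Type*} [MeasurableSpace Ω] {P : Measure Ω}
    {v : Site d → Ω → ℝ} (hv : IsIID v P μ) (hM : M.Admissible CB1 CB2 CB3) :
    ∃! ρ : Measure ℝ, IsDensityOfStates (fun ω => M.hamiltonian g (fun x => v x ω)) P ρ := by
  simp only [hv.isDensityOfStates_iff hM]
  exact existsUnique_measure_integral_eq _ (fun f hf => hM.averagedTrace_nonneg μ hf)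
    (hM.abs_averagedTrace_le μ)

end DensityOfStates

/-! ### The Wegner estimate -/

section Wegner

variable {d k : ℕ} {M : ModelData d k} {g : ℝ} {CB1 CB2 CB3 : ℝ}

theorem ModelData.Admissible.mono (hM : M.Admissible CB1 CB2 CB3) {CB1' CB2' CB3' : ℝ}
    (h1 : CB1 ≤ CB1') (h2 : CB2 ≤ CB2') (h3 : CB3 ≤ CB3') : M.Admissible CB1' CB2' CB3' where
  hermitian_A := hM.hermitian_A
  hermitian_B := hM.hermitian_B
  isUnit_A := hM.isUnit_A
  norm_A := hM.norm_A.trans h1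
  norm_inv_A := hM.norm_inv_A.trans h1
  norm_B := hM.norm_B.trans h2
  hermitian_K := hM.hermitian_K
  norm_K i := ⟨(hM.norm_K i).1.trans h3, (hM.norm_K i).2.trans h3⟩

/-- The wave function supported at the origin, with spin `i`. -/
def originWave (d : ℕ) (i : Fin k) : Wave d k := lp.single 2 0 (EuclideanSpace.single i (1 : ℂ))

theorem norm_originWave (i : Fin k) : ‖originWave d i‖ = 1 := by
  rw [originWave, lp.norm_single (by norm_num), PiLp.norm_single, norm_one]

theorem norm_kernel_le_norm_apply (T : Wave d k →L[ℂ] Wave d k) (i : Fin k) :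
    ‖kernel T 0 0 i i‖ ≤ ‖T (originWave d i) 0‖ :=
  PiLp.norm_apply_le (T (originWave d i) 0) i

theorem ModelData.Admissible.re_kernel_poisson_le (hM : M.Admissible CB1 CB2 CB3) (g : ℝ)
    (v : Site d → ℝ) {z : ℂ} (hz : z.im ≠ 0) (i : Fin k) {s : ℝ} (hs1 : s ≤ 1) :
    |z.im| * (kernel (hM.calculus g v (circleFun (poisson z))) 0 0 i i).re ≤
      |z.im| ^ s / 2 * (‖M.green g v z (originWave d i) 0‖ ^ s +
        ‖M.green g v (conj z) (originWave d i) 0‖ ^ s) := by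
  have hz' : (conj z).im ≠ 0 := by simpa using hz
  have hpos : 0 < |z.im| := abs_pos.2 hz
  -- The product |Im z| ‖G‖ lies in [0, 1], where x ≤ x^s for s ≤ 1. This is the step that trades a
  -- first moment, which need not be bounded, for a fractional one.
  have hbound : ∀ u : ℂ, |u.im| = |z.im| → u.im ≠ 0 →
      |z.im| * ‖M.green g v u (originWave d i) 0‖ ≤
        |z.im| ^ s * ‖M.green g v u (originWave d i) 0‖ ^ s := by
    intro u hu hu0
    rw [← Real.mul_rpow hpos.le (norm_nonneg _)]
    refine Real.self_le_rpow_of_le_one (by positivity) ?_ hs1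
    have h1 : ‖M.green g v u (originWave d i) 0‖ ≤ |z.im|⁻¹ := by
      refine (lp.norm_apply_le_norm two_ne_zero _ _).trans ?_
      refine ((M.green g v u).le_of_opNorm_le (hM.norm_green_le g v hu0) _).trans ?_
      rw [norm_originWave, mul_one, hu]
    calc _ ≤ |z.im| * |z.im|⁻¹ := by gcongr
      _ = 1 := mul_inv_cancel₀ hpos.ne'
  have hid := (hM.isResolventAt_green g v hz).identity (hM.isResolventAt_green g v hz')
  set X := M.green g v z
  set Y := M.green g v (conj z)
  have h1 : 2 * |z.im| * ‖kernel (X * Y) 0 0 i i‖ ≤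
      ‖X (originWave d i) 0‖ + ‖Y (originWave d i) 0‖ := by
    have h2 : ‖kernel ((z - conj z) • (X * Y)) 0 0 i i‖ = 2 * |z.im| * ‖kernel (X * Y) 0 0 i i‖ := by
      rw [kernel_smul, Matrix.smul_apply, norm_smul, Complex.sub_conj]
      simp
    rw [← h2, ← hid]
    have h3 : kernel (X - Y) 0 0 i i = kernel X 0 0 i i - kernel Y 0 0 i i := rfl
    rw [h3]
    exact (norm_sub_le _ _).trans (add_le_add (norm_kernel_le_norm_apply X i)
      (norm_kernel_le_norm_apply Y i))
  have h4 : (kernel (hM.calculus g v (circleFun (poisson z))) 0 0 i i).re ≤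
      |z.im| * ‖kernel (X * Y) 0 0 i i‖ := by
    rw [hM.calculus_poisson hz, kernel_smul, Matrix.smul_apply, smul_eq_mul,
      Complex.re_ofReal_mul]
    gcongr
    exact Complex.re_le_norm _
  have h5 := hbound z rfl hz
  have h6 := hbound (conj z) (by simp) hz'
  have h7 := mul_le_mul_of_nonneg_left h4 hpos.le
  have h8 := mul_le_mul_of_nonneg_left h1 hpos.le
  linarith

/-- On the interval (t - λ)² + ε² ≤ 2ε², so 2ε times the kernel is at least 1 there. -/
theorem measureReal_Icc_le_integral_poisson (ρ : Measure ℝ) [IsFiniteMeasure ρ] (lam : ℝ) {ε : ℝ}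
    (hε : 0 < ε) :
    ρ.real (Set.Icc (lam - ε) (lam + ε)) ≤ 2 * ε * ∫ t, poisson ⟨lam, ε⟩ t ∂ρ := by
  have h1 : ∀ t, poisson ⟨lam, ε⟩ t = ε / ((t - lam) ^ 2 + ε ^ 2) := fun t => by
    rw [poisson_apply (z := ⟨lam, ε⟩) hε.ne', abs_of_pos hε]
  rw [← integral_indicator_one measurableSet_Icc, ← integral_const_mul]
  refine integral_mono ((integrable_const (1 : ℝ)).indicator measurableSet_Icc)
    ((integrable_zeroAtInfty ρ _).const_mul _) fun t => ?_
  change _ ≤ 2 * ε * poisson ⟨lam, ε⟩ t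
  rw [h1]
  by_cases ht : t ∈ Set.Icc (lam - ε) (lam + ε)
  · rw [Set.indicator_of_mem ht, Pi.one_apply, mul_div_assoc', le_div_iff₀ (by positivity)]
    have h2 : (t - lam) ^ 2 ≤ ε ^ 2 := by
      exact sq_le_sq' (by linarith [ht.1]) (by linarith [ht.2])
    linarith
  · rw [Set.indicator_of_notMem ht]
    positivity

/-- Average of `re_kernel_poisson_le`; z and z̄ have the same modulus, so one moment bound and one
condition on g serve both. -/
theorem exists_averagedTrace_poisson_le {α q C₁ C₂ : ℝ} (k : ℕ) (hα : 0 < α) (hq : 0 < q)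
    (hC₁ : 0 ≤ C₁) (hC₂ : 0 ≤ C₂) {CB1 CB2 CB3 : ℝ} (h1 : 0 ≤ CB1) (h2 : 0 ≤ CB2) (h3 : 0 ≤ CB3)
    {s : ℝ} (hs : 0 < s) (hs1 : s ≤ 1) (hsk : s * (k * (2 / q + 1 / α)) = 1) :
    ∃ K : ℝ, 0 < K ∧ ∀ (d : ℕ) (M : ModelData d k) (hM : M.Admissible CB1 CB2 CB3)
      (μ : Measure ℝ) [IsProbabilityMeasure μ], TameLaw α q C₁ C₂ μ → ∀ g : ℝ, 0 < g →
      ∀ z : ℂ, z.im ≠ 0 → 4 * K * d * CB3 ^ s ≤ (g * (1 + ‖z‖)) ^ s →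
      |z.im| * hM.averagedTrace μ g (poisson z) ≤ 2 * K * |z.im| ^ s * (1 + ‖z‖) ^ (-s) := by
  obtain ⟨K, hK, hmom⟩ := exists_green_moment k hα hq hC₁ hC₂ h1 h2 h3 hs hs1 hsk
  refine ⟨K, hK, ?_⟩
  intro d M hM μ _ hμ g hg z hz hgz
  have hz' : (conj z).im ≠ 0 := by simpa using hz
  have hnorm : ‖conj z‖ = ‖z‖ := Complex.norm_conj z
  rw [hM.averagedTrace_apply μ, mul_left_comm, Finset.mul_sum]
  refine inv_mul_sum_le (by positivity) fun i => ?_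
  rw [← integral_const_mul]
  set ν := Measure.infinitePi fun _ : Site d => μ
  have hpois : ∀ t, 0 ≤ poisson z t := fun t => by rw [poisson_apply hz]; positivity
  have hmeas : ∀ u : ℂ, u.im ≠ 0 → Measurable fun v : Site d → ℝ =>
      ENNReal.ofReal (‖M.green g v u (originWave d i) 0‖ ^ s) := fun u hu =>
    ((continuous_apply_wave (hM.continuous_green g hu _) 0).norm.rpow_const
      fun _ => Or.inr hs.le).measurable.ennreal_ofReal
  have hψ : ‖originWave d i‖ ≤ 1 := (norm_originWave i).le
  have hm1 := hmom d M hM μ hμ g hg z hz hgz (originWave d i) hψ 0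
  have hm2 := hmom d M hM μ hμ g hg (conj z) hz' (by rwa [hnorm]) (originWave d i) hψ 0
  rw [hnorm] at hm2
  have hr0 : 0 ≤ 2 * K * (1 + ‖z‖) ^ (-s) := by positivity
  rw [← ENNReal.ofReal_le_ofReal_iff (by positivity)]
  refine (ofReal_integral_eq_lintegral_ofReal
    ((hM.integrable_kernel μ g (circleFun (poisson z)) 0 0 i i).re.const_mul |z.im|)
    (ae_of_all _ fun v => mul_nonneg (abs_nonneg _)
      (hM.kernel_calculus_nonneg hpois 0 i))).le.trans ?_
  calc _ ≤ ∫⁻ v, ENNReal.ofReal (|z.im| ^ s / 2) *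
        (ENNReal.ofReal (‖M.green g v z (originWave d i) 0‖ ^ s) +
          ENNReal.ofReal (‖M.green g v (conj z) (originWave d i) 0‖ ^ s)) ∂ν := by
        refine lintegral_mono fun v => ?_
        rw [← ENNReal.ofReal_add (by positivity) (by positivity),
          ← ENNReal.ofReal_mul (by positivity)]
        exact ENNReal.ofReal_le_ofReal (hM.re_kernel_poisson_le g v hz i hs1)
    _ = ENNReal.ofReal (|z.im| ^ s / 2) *
        (∫⁻ v, ENNReal.ofReal (‖M.green g v z (originWave d i) 0‖ ^ s) ∂ν +
          ∫⁻ v, ENNReal.ofReal (‖M.green g v (conj z) (originWave d i) 0‖ ^ s) ∂ν) :=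
        (lintegral_const_mul' _ _ ENNReal.ofReal_ne_top).trans
          (congrArg _ (lintegral_add_left (hmeas z hz) _))
    _ ≤ ENNReal.ofReal (|z.im| ^ s / 2) * (ENNReal.ofReal (2 * K * (1 + ‖z‖) ^ (-s)) +
          ENNReal.ofReal (2 * K * (1 + ‖z‖) ^ (-s))) := by gcongr
    _ = _ := by
        rw [← ENNReal.ofReal_add hr0 hr0, ← ENNReal.ofReal_mul (by positivity)]
        congr 1
        ring

theorem wegnerExponent_pos {α q : ℝ} (hα : 0 < α) (hq : 0 < q) (hk : 0 < k) :
    0 < wegnerExponent α q k := by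
  have hk' : (0 : ℝ) < k := by exact_mod_cast hk
  unfold wegnerExponent
  positivity

theorem wegnerExponent_le_one {α q : ℝ} (hα : 0 < α) (hα1 : α ≤ 1) (hq : 0 < q) (hk : 0 < k) :
    wegnerExponent α q k ≤ 1 := by
  have hk' : (1 : ℝ) ≤ k := by exact_mod_cast hk
  unfold wegnerExponent
  rw [div_le_one (by positivity)]
  have h1 : α * q ≤ 1 * q := by gcongr
  have h2 : 1 * q ≤ k * q := by gcongr
  have h3 : 0 ≤ 2 * k * α := by positivity
  linarith

theorem wegnerExponent_mul {α q : ℝ} (hα : 0 < α) (hq : 0 < q) (hk : 0 < k) :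
    wegnerExponent α q k * (k * (2 / q + 1 / α)) = 1 := by
  have hk' : (0 : ℝ) < k := by exact_mod_cast hk
  unfold wegnerExponent
  field_simp

theorem IsIID.isProbabilityMeasure {Ω : Type*} [MeasurableSpace Ω] {P : Measure Ω}
    [IsProbabilityMeasure P] {v : Site d → Ω → ℝ} {μ : Measure ℝ} (hv : IsIID v P μ) :
    IsProbabilityMeasure μ := by
  rw [← hv.law 0]
  exact Measure.isProbabilityMeasure_map (hv.measurable 0).aemeasurable

/-- The Wegner estimate for the density of states. -/
theorem exists_wegner_estimate (k : ℕ) (hk : 0 < k) {α q : ℝ} (hα : 0 < α) (hq : 0 < q)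
    (CA1 CA2 CB1 CB2 CB3 : ℝ) :
    ∃ C : ℝ, 0 < C ∧ ∀ (d : ℕ) (M : ModelData d k), M.Admissible CB1 CB2 CB3 →
      ∀ (μ : Measure ℝ), IsRegularWith α CA1 μ → HasMomentBound q CA2 μ →
      ∀ (Ω : Type*) [MeasurableSpace Ω] (P : Measure Ω) [IsProbabilityMeasure P]
        (v : Site d → Ω → ℝ), IsIID v P μ → ∀ (g : ℝ), 0 < g → ∀ ρ : Measure ℝ,
      IsDensityOfStates (fun ω => M.hamiltonian g (fun x => v x ω)) P ρ →
      ∀ lam : ℝ, C * (d : ℝ) ^ (1 / wegnerExponent α q k) / (1 + |lam|) ≤ g →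
      ∀ ε : ℝ, 0 < ε → ρ.real (Set.Icc (lam - ε) (lam + ε)) ≤
        C * (1 + |lam|) ^ (-wegnerExponent α q k) * ε ^ wegnerExponent α q k := by
  set s := wegnerExponent α q k with hs_def
  have hs : 0 < s := wegnerExponent_pos hα hq hk
  rcases le_or_gt α 1 with hα1 | hα1
  swap
  -- No probability law is regular with α > 1, so any constant will do. The remaining case α ≤ 1
  -- gives s ≤ 1, which the moment argument needs.
  · refine ⟨1, one_pos, ?_⟩
    intro d M hM μ hreg hmom Ω _ P _ v hv
    have := hv.isProbabilityMeasure
    exact absurd ((TameLaw.of_bounds hreg hmom).exponent_le_one (by positivity)) hα1.not_ge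
  obtain ⟨K, hK, hest⟩ := exists_averagedTrace_poisson_le (C₁ := max CA1 1) (C₂ := max CA2 1) k
    hα hq (by positivity) (by positivity) (le_max_right CB1 0) (le_max_right CB2 0)
    (le_max_right CB3 0) hs (wegnerExponent_le_one hα hα1 hq hk) (wegnerExponent_mul hα hq hk)
  set b := max CB3 0 with hb_def
  have hb : 0 ≤ b := le_max_right _ _
  -- The first entry is the prefactor of the estimate; the second turns the hypothesis on g into the
  -- smallness condition.
  set C := max (4 * K) ((4 * K * b ^ s) ^ (1 / s)) with hC_def
  have hC : 0 < C := lt_of_lt_of_le (by positivity) (le_max_left _ _)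
  refine ⟨C, hC, ?_⟩
  intro d M hM μ hreg hmom Ω _ P _ v hv g hg ρ hρ lam hlam ε hε
  have := hv.isProbabilityMeasure
  have hM' := hM.mono (le_max_left CB1 0) (le_max_left CB2 0) (le_max_left CB3 0)
  obtain ⟨hfin, hint⟩ := (hv.isDensityOfStates_iff hM' ρ).1 hρ
  let z : ℂ := ⟨lam, ε⟩
  have hlz : |lam| ≤ ‖z‖ := Complex.abs_re_le_norm z
  have hl0 : 0 < 1 + |lam| := by positivity
  -- As |z| ≥ |λ|, one threshold in terms of λ works for every ε.
  have hcond : 4 * K * d * b ^ s ≤ (g * (1 + ‖z‖)) ^ s := by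
    have h1 : (4 * K * b ^ s) ^ (1 / s) * (d : ℝ) ^ (1 / s) ≤ g * (1 + ‖z‖) := by
      rw [div_le_iff₀ hl0] at hlam
      calc _ ≤ C * (d : ℝ) ^ (1 / s) := by gcongr; exact le_max_right _ _
        _ ≤ g * (1 + |lam|) := hlam
        _ ≤ _ := by gcongr
    calc 4 * K * d * b ^ s = (((4 * K * b ^ s) * d) ^ (1 / s)) ^ s := by
          rw [← Real.rpow_mul (by positivity), one_div_mul_cancel hs.ne', Real.rpow_one]
          ring
      _ ≤ _ := by
          rw [Real.mul_rpow (by positivity) (by positivity)]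
          gcongr
  have h1 := hest d M hM' μ (TameLaw.of_bounds hreg hmom) g hg z hε.ne' hcond
  rw [← hint, show |z.im| = ε from abs_of_pos hε] at h1
  calc _ ≤ 2 * ε * ∫ t, poisson z t ∂ρ := measureReal_Icc_le_integral_poisson ρ lam hε
    _ ≤ 2 * (2 * K * ε ^ s * (1 + ‖z‖) ^ (-s)) := by linarith
    _ = 4 * K * (1 + ‖z‖) ^ (-s) * ε ^ s := by ring
    _ ≤ _ := by
        have h2 : (1 + ‖z‖) ^ (-s) ≤ (1 + |lam|) ^ (-s) :=
          Real.rpow_le_rpow_of_nonpos hl0 (by linarith) (by linarith)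
        have h3 : 4 * K ≤ C := le_max_left _ _
        exact mul_le_mul_of_nonneg_right (mul_le_mul h3 h2 (by positivity) hC.le) (by positivity)

theorem abs_ids_sub_le {ρ : Measure ℝ} [IsFiniteMeasure ρ] {lam c s : ℝ} (hs : 0 < s)
    (h : ∀ ε : ℝ, 0 < ε → ρ.real (Set.Icc (lam - ε) (lam + ε)) ≤ c * ε ^ s) (lam' : ℝ) :
    |ids ρ lam' - ids ρ lam| ≤ c * |lam' - lam| ^ s := by
  rcases eq_or_ne lam' lam with rfl | hne
  · simp [Real.zero_rpow hs.ne']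
  · exact (abs_measureReal_Iic_sub_le ρ lam lam').trans (h _ (abs_pos.2 (sub_ne_zero.2 hne)))

theorem isRegularWith_of_density {D : ℝ≥0} {f : ℝ → ℝ≥0∞} (hf : ∀ x, f x ≤ D) :
    IsRegularWith 1 (2 * D) ((volume : Measure ℝ).withDensity f) := by
  intro ε hε t
  refine ENNReal.toReal_le_of_le_ofReal (by positivity) ?_
  rw [withDensity_apply _ measurableSet_Icc, Real.rpow_one]
  calc _ ≤ ∫⁻ _ in Set.Icc (t - ε) (t + ε), (D : ℝ≥0∞) := lintegral_mono fun x => hf x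
    _ = D * ENNReal.ofReal (2 * ε) := by
        rw [setLIntegral_const, Real.volume_Icc]
        congr 2
        ring
    _ = _ := by
        rw [← ENNReal.ofReal_coe_nnreal, ← ENNReal.ofReal_mul (by positivity)]
        congr 1
        ring

theorem integrable_abs_rpow {μ : Measure ℝ} (h : ∀ n : ℕ, Integrable (fun x : ℝ => |x| ^ n) μ)
    {q : ℝ} (hq : 0 ≤ q) : Integrable (fun x : ℝ => |x| ^ q) μ := by
  obtain ⟨n, hn⟩ := exists_nat_ge q
  refine ((h 0).add (h n)).mono' (by fun_prop) (ae_of_all _ fun x => ?_)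
  have hx := abs_nonneg x
  rw [Real.norm_of_nonneg (by positivity)]
  simp only [Pi.add_apply, pow_zero]
  rcases le_total |x| 1 with h1 | h1
  · linarith [Real.rpow_le_one hx h1 hq, pow_nonneg hx n]
  · have := Real.rpow_le_rpow_of_exponent_le h1 hn
    rw [Real.rpow_natCast] at this
    linarith

theorem wegnerExponent_one_eq (hk : 0 < k) {δ : ℝ} (hδ : 0 < δ) :
    wegnerExponent 1 (2 * k / δ) k = 1 / ((k : ℝ) + δ) := by
  have hk' : (0 : ℝ) < k := by exact_mod_cast hk
  unfold wegnerExponent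
  field_simp
  ring

end Wegner

end

theorem corollary2 :
    -- the Wegner-type estimate, with `s = αq / (2kα + kq)`
    (∀ (k : ℕ), 0 < k → ∀ (α q : ℝ), 0 < α → 0 < q → ∀ (CA1 CA2 CB1 CB2 CB3 : ℝ),
      ∃ C : ℝ, 0 < C ∧
        ∀ (d : ℕ) (M : ModelData d k), M.Admissible CB1 CB2 CB3 →
        ∀ (μ : Measure ℝ), IsRegularWith α CA1 μ → HasMomentBound q CA2 μ →
        ∀ (Ω : Type*) [MeasurableSpace Ω] (P : Measure Ω) [IsProbabilityMeasure P]
          (v : Site d → Ω → ℝ), IsIID v P μ →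
        ∀ (g : ℝ), 0 < g →
          (∃! ρ : Measure ℝ,
            IsDensityOfStates (fun ω => M.hamiltonian g (fun x => v x ω)) P ρ) ∧
          ∀ ρ : Measure ℝ,
            IsDensityOfStates (fun ω => M.hamiltonian g (fun x => v x ω)) P ρ →
            ∀ lam : ℝ, C * (d : ℝ) ^ (1 / wegnerExponent α q k) / (1 + |lam|) ≤ g →
              (∀ ε : ℝ, 0 < ε →
                ρ.real (Set.Icc (lam - ε) (lam + ε)) ≤
                  C * (1 + |lam|) ^ (-wegnerExponent α q k) * ε ^ wegnerExponent α q k) ∧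
              ∀ lam' : ℝ,
                |ids ρ lam' - ids ρ lam| ≤
                  C * (1 + |lam|) ^ (-wegnerExponent α q k) *
                    |lam' - lam| ^ wegnerExponent α q k) ∧
    -- bounded densities with all moments: the exponent `1 / (k + δ)` for every `δ > 0`
    (∀ (k : ℕ), 0 < k → ∀ (δ : ℝ), 0 < δ → ∀ (CB1 CB2 CB3 : ℝ) (μ : Measure ℝ),
      (∃ (D : ℝ≥0) (f : ℝ → ℝ≥0∞), Measurable f ∧ (∀ x, f x ≤ D) ∧
        μ = (volume : Measure ℝ).withDensity f) →
      (∀ n : ℕ, Integrable (fun x : ℝ => |x| ^ n) μ) →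
      ∃ C : ℝ, 0 < C ∧
        ∀ (d : ℕ) (M : ModelData d k), M.Admissible CB1 CB2 CB3 →
        ∀ (Ω : Type*) [MeasurableSpace Ω] (P : Measure Ω) [IsProbabilityMeasure P]
          (v : Site d → Ω → ℝ), IsIID v P μ →
        ∀ (g : ℝ), 0 < g →
        ∀ ρ : Measure ℝ,
          IsDensityOfStates (fun ω => M.hamiltonian g (fun x => v x ω)) P ρ →
          (∀ lam : ℝ, C * (d : ℝ) ^ ((k : ℝ) + δ) / (1 + |lam|) ≤ g →
            ∀ lam' : ℝ,
              |ids ρ lam' - ids ρ lam| ≤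
                C * (1 + |lam|) ^ (-(1 / ((k : ℝ) + δ))) *
                  |lam' - lam| ^ (1 / ((k : ℝ) + δ))) ∧
          (C * (d : ℝ) ^ ((k : ℝ) + δ) ≤ g →
            ∀ lam lam' : ℝ,
              |ids ρ lam' - ids ρ lam| ≤ C * |lam' - lam| ^ (1 / ((k : ℝ) + δ)))) := by
  refine ⟨?_, ?_⟩
  · intro k hk α q hα hq CA1 CA2 CB1 CB2 CB3
    obtain ⟨C, hC, hest⟩ := exists_wegner_estimate k hk hα hq CA1 CA2 CB1 CB2 CB3
    refine ⟨C, hC, ?_⟩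
    intro d M hM μ hreg hmom Ω _ P _ v hv g hg
    have := hv.isProbabilityMeasure
    refine ⟨hv.existsUnique_densityOfStates hM, ?_⟩
    intro ρ hρ lam hlam
    have := hρ.finite
    have h := hest d M hM μ hreg hmom Ω P v hv g hg ρ hρ lam hlam
    exact ⟨h, abs_ids_sub_le (wegnerExponent_pos hα hq hk) h⟩
  · rintro k hk δ hδ CB1 CB2 CB3 μ ⟨D, f, -, hfD, hμ⟩ hmom
    have hk' : (0 : ℝ) < k := by exact_mod_cast hk
    have hs := wegnerExponent_one_eq hk hδ
    -- A bounded density is 1-regular, and with α = 1 this is the moment order for which s = 1/(k +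
    -- δ).
    have hq : 0 < 2 * k / δ := by positivity
    have hreg : IsRegularWith 1 (2 * D) μ := hμ ▸ isRegularWith_of_density hfD
    have hmom' : HasMomentBound (2 * k / δ) (∫ x, |x| ^ (2 * k / δ) ∂μ) μ :=
      ⟨integrable_abs_rpow hmom hq.le, le_rfl⟩
    obtain ⟨C, hC, hest⟩ := exists_wegner_estimate k hk one_pos hq (2 * D)
      (∫ x, |x| ^ (2 * k / δ) ∂μ) CB1 CB2 CB3
    rw [hs, one_div_one_div] at hest
    refine ⟨C, hC, ?_⟩
    intro d M hM Ω _ P _ v hv g hg ρ hρ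
    have := hρ.finite
    have key : ∀ lam : ℝ, C * (d : ℝ) ^ ((k : ℝ) + δ) / (1 + |lam|) ≤ g → ∀ lam' : ℝ,
        |ids ρ lam' - ids ρ lam| ≤ C * (1 + |lam|) ^ (-(1 / ((k : ℝ) + δ))) *
          |lam' - lam| ^ (1 / ((k : ℝ) + δ)) := fun lam hlam =>
      abs_ids_sub_le (by positivity) (hest d M hM μ hreg hmom' Ω P v hv g hg ρ hρ lam hlam)
    refine ⟨key, fun hg' lam lam' => ?_⟩
    have hl : 1 ≤ 1 + |lam| := by linarith [abs_nonneg lam]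
    -- Since 1 + |λ| ≥ 1, the threshold without λ implies all the others, and the decaying prefactor
    -- is at most 1.
    refine (key lam ((div_le_self (by positivity) hl).trans hg') lam').trans ?_
    gcongr
    refine mul_le_of_le_one_right hC.le (Real.rpow_le_one_of_one_le_of_nonpos hl ?_)
    rw [neg_nonpos]
    positivity
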